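/- **Setting.** Let $\Phi$ be a countable Hilbertian nuclear space: a separable real Fréchet space whose topology is given by an increasing sequence of compatible Hilbertian norms $\|\cdot\|_n$, $n\in\mathbb N_0$, such that, $\Phi_n$ being the completion of $\Phi$ for $\|\cdot\|_n$, for each $n$ there is $m>n$ with $\Phi_m\to\Phi_n$ Hilbert–Schmidt. Let $\Phi_{-n}$ be the Hilbert space of bounded linear functionals on $\Phi_n$ (with its norm $\|\cdot\|_{-n}$ and inner product $\langle\cdot,\cdot\rangle_{-n}$), regarded as a subspace of the topological dual $\Phi'=\bigcup_n\Phi_{-n}$; write $u[\phi]$ for the value of $u$ at $\phi$. Identify $\Phi_0$ with its dual, so that $\Phi\subset\Phi_{-n}$. Assume that there is a sequence $(\phi_j)\subset\Phi$ that is a complete orthonormal system in $\Phi_0$ and a complete orthogonal system in each $\Phi_n$, $n\in\mathbb Z$. Put $\phi_j^n=\phi_j/\|\phi_j\|_n$ and let $\theta_n:\Phi_{-n}\to\Phi_n$ be the isometry with $\theta_n\phi_j^{-n}=\phi_j^n$. Let $\mathbb X$ be a locally compact Polish space, $\nu$ a Borel measure on $\mathbb X$ that is finite on compact sets, $T\in(0,\infty)$,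 $\nu_T=\nu\otimes\lambda_T$ with $\lambda_T$ Lebesgue measure on $[0,T]$, and $B_2(M)$ the ball of radius $M$ in $L^2(\nu_T)$. Let $b:\Phi'\to\Phi'$, $G:\Phi'\times\mathbb X\to\Phi'$, $M_G,L_G:\mathbb X\to\mathbb R$ and natural numbers $p<q<q_1$ be given. **Condition A.** The embedding $\Phi_{-p}\to\Phi_{-q}$ is Hilbert–Schmidt; $M_G,L_G\in L^1(\nu)\cap L^2(\nu)$; and for some $M_b,C_b,L_b\in(0,\infty)$, for all $u,u'\in\Phi_{-p}$, $y\in\mathbb X$, $\phi\in\Phi$: (a) $b$ maps $\Phi_{-p}$ continuously into $\Phi_{-q}$; $G(u,\cdot)\in L^2(\mathbb X,\nu,\Phi_{-p})$, and $u\mapsto G(u,\cdot)$ is continuous from $\Phi_{-p}$ to $L^2(\mathbb X,\nu,\Phi_{-p})$; (b) $\|b(u)\|_{-q}\le M_b(1+\|u\|_{-p})$ and $\|G(u,y)\|_{-p}\le M_G(y)(1+\|u\|_{-p})$; (c) $2b(\phi)[\theta_p\phi]\le C_b(1+\|\phi\|_{-p}^2)$; (d) $\langle u-u',b(u)-b(u')\rangle_{-q}\le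 L_b\|u-u'\|_{-q}^2$; (e) $\|G(u,y)-G(u',y)\|_{-q}\le L_G(y)\|u-u'\|_{-q}$. **Limit path.** Let $x_0\in\Phi_{-p}$ and let $X^0\in C([0,T],\Phi_{-q})$ be a solution, with values in $\Phi_{-p}$ and with $m_T=\sup_{0\le t\le T}\|X^0(t)\|_{-p}<\infty$, of $$X^0(t)[\phi]=x_0[\phi]+\int_0^t b(X^0(s))[\phi]\,ds+\int_{\mathbb X\times[0,t]}G(X^0(s),y)[\phi]\,\nu(dy)\,ds,\qquad t\in[0,T],\ \phi\in\Phi .$$ **Condition B.** The embedding $\Phi_{-q}\to\Phi_{-q_1}$ is Hilbert–Schmidt, and: (a) for every $\phi\in\Phi$ the map $v\mapsto b(v)[\phi]$ is Fréchet differentiable on $\Phi_{-q}$, with derivative $D(b(v)[\phi])$, and for some $L_{Db}(\phi)\in(0,\infty)$, $\|D(b(u)[\phi])-D(b(u')[\phi])\|_{op}\le L_{Db}(\phi)\|u-u'\|_{-q}$ for $u,u'\in\Phi_{-p}$ (operator norm of $L(\Phi_{-q},\mathbb R)$); (b) for every $\eta\in\Phi_{-q}$, $\sup_{\|v\|_{-p}\le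 m_T}\sum_k|D(b(v)[\phi_k^{q_1}])[\eta]|^2<\infty$, so that $A_v(\eta)[\phi]=D(b(v)[\phi])[\eta]$ defines $A_v(\eta)\in\Phi_{-q_1}$; for $v\in\Phi_{-p}$ with $\|v\|_{-p}\le m_T$, $A_v:\Phi_{-q}\to\Phi_{-q_1}$ is continuous; and for some $M_A,L_A,C_A\in(0,\infty)$, for all such $v$ and all $\eta\in\Phi_{-q}$, $\phi\in\Phi$, $\zeta\in\Phi_{-p}$: $\|A_v(\eta)\|_{-q_1}\le M_A(1+\|\eta\|_{-q})$, $\langle\eta,A_v(\eta)\rangle_{-q_1}\le L_A\|\eta\|_{-q_1}^2$ and $2A_v(\phi+\zeta)[\theta_q\phi]\le C_A(\|\zeta\|_{-p}+\|\phi\|_{-q})\|\phi\|_{-q}$; (c) for every $\phi\in\Phi$, $y\in\mathbb X$, the map $u\mapsto G(u,y)[\phi]$ is Fréchet differentiable on $\Phi_{-q_1}$, with derivative $D_x(G(u,y)[\phi])$; for each $\phi\in\Phi$ there is $L_{DG}(\phi,\cdot)\in L^1(\nu)$ with $\|D_x(G(u,y)[\phi])-D_x(G(u',y)[\phi])\|_{op,-q_1}\le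 L_{DG}(\phi,y)\|u-u'\|_{-q}$ for $u,u'\in\Phi_{-p}$, $y\in\mathbb X$; and there is $M_{DG}:\Phi_{-p}\times\mathbb X\to[0,\infty)$ with $\|D_x(G(u,y)[\phi])\|_{op,-q_1}\le M_{DG}(u,y)\|\phi\|_{q_1}$ and $\|D_x(G(u,y)[\phi])\|_{op,-q}\le M_{DG}(u,y)\|\phi\|_q$ for all $u\in\Phi_{-p}$, $\phi\in\Phi$, $y\in\mathbb X$, and $\sup_{\|u\|_{-p}\le m_T}\int_{\mathbb X}\max\{M_{DG}(u,y),M_{DG}^2(u,y)\}\,\nu(dy)<\infty$ (here $\|\cdot\|_{op,-r}$ is the norm of $L(\Phi_{-r},\mathbb R)$, after restriction to $\Phi_{-q}$ if $r=q$); (d) for $h=M_G$ and for $h=L_G$ there is $\delta>0$ with $\int_\Gamma e^{\delta h^2}\,d\nu<\infty$ for all measurable $\Gamma$ with $\nu(\Gamma)<\infty$. **Theorem.** Under Conditions A and B, for every $\psi\in L^2(\nu_T)$ there is a unique $\eta_\psi\in C([0,T],\Phi_{-q_1})$ such that $\eta=\eta_\psi$ solves $$\eta(t)[\phi]=\int_0^t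 D(b(X^0(s))[\phi])\,\eta(s)\,ds+\int_{\mathbb X\times[0,t]}D_x(G(X^0(s),y)[\phi])\,\eta(s)\,\nu(dy)\,ds+\int_{\mathbb X\times[0,t]}G(X^0(s),y)[\phi]\,\psi(y,s)\,\nu(dy)\,ds$$ for all $t\in[0,T]$ and $\phi\in\Phi$; being a solution includes that the terms of the equation are meaningful, i.e. $\eta(s)\in\Phi_{-q}$ for every $s\in[0,T]$ and the three integrands are integrable for each $\phi$. Moreover, for every $M\in(0,\infty)$, $\sup_{\psi\in B_2(M)}\sup_{0\le t\le T}\|\eta_\psi(t)\|_{-q}<\infty$. -/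

import Mathlib

open MeasureTheory Topology Filter Set

noncomputable section

/-! ### Hilbert space preliminaries -/

/-- The strong dual of a real Hilbert space, as a Hilbert space: its inner product is the one
transported through the Riesz isometry (so it induces the usual dual norm). -/
@[reducible]
def strongDualInner {H : Type*} [NormedAddCommGroup H] [InnerProductSpace ℝ H]
    [CompleteSpace H] : InnerProductSpace ℝ (StrongDual ℝ H) where
  inner u v := inner ℝ ((InnerProductSpace.toDual ℝ H).symm u)
    ((InnerProductSpace.toDual ℝ H).symm v)
  norm_sq_eq_re_inner u := by
    rw [inner_self_eq_norm_sq]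
    simp
  conj_inner_symm u v := inner_conj_symm _ _
  add_left u v w := by rw [map_add, inner_add_left]
  smul_left u v r := by
    rw [map_smulₛₗ, inner_smul_left]
    simp

/-- A bounded operator between Hilbert spaces is Hilbert-Schmidt if `∑ ‖T bᵢ‖² < ∞` for a complete
orthonormal system `(bᵢ)` of its domain. -/
def IsHilbertSchmidt {E F : Type*} [NormedAddCommGroup E] [InnerProductSpace ℝ E]
    [NormedAddCommGroup F] [InnerProductSpace ℝ F] (A : E →L[ℝ] F) : Prop :=
  ∃ (w : Set E) (c : HilbertBasis w ℝ E), Summable fun i => ‖A (c i)‖ ^ 2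

/-- Complete orthogonal system (COS): pairwise orthogonal, nonzero, with dense linear span. -/
structure IsCompleteOrthogonal {H : Type*} [NormedAddCommGroup H] [InnerProductSpace ℝ H]
    (v : ℕ → H) : Prop where
  orthogonal : Pairwise fun i j => inner ℝ (v i) (v j) = 0
  ne_zero : ∀ i, v i ≠ 0
  dense_span : Dense (Submodule.span ℝ (range v) : Set H)

/-! ### Countable Hilbertian nuclear spaces -/

section Renormed

variable {Φ : Type*} [AddCommGroup Φ] [Module ℝ Φ]

/-- The space `Φ`, to be equipped with the single Hilbertian norm given by an inner product. -/
def Renormed (_ : InnerProductSpace.Core ℝ Φ) : Type _ := Φ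

instance (c : InnerProductSpace.Core ℝ Φ) : NormedAddCommGroup (Renormed c) :=
  c.toNormedAddCommGroup

instance (c : InnerProductSpace.Core ℝ Φ) : InnerProductSpace ℝ (Renormed c) :=
  InnerProductSpace.ofCore c.toCore

/-- The identity map from `Φ` to the renormed space. -/
def toRenormed (c : InnerProductSpace.Core ℝ Φ) : Φ →ₗ[ℝ] Renormed c where
  toFun φ := φ
  map_add' _ _ := rfl
  map_smul' _ _ := rfl

/-- The Hilbertian norm of an inner product, as a seminorm on `Φ`. -/
def hilbertNorm (c : InnerProductSpace.Core ℝ Φ) : Seminorm ℝ Φ :=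
  (normSeminorm ℝ (Renormed c)).comp (toRenormed c)

end Renormed

/-- A separable Fréchet space whose topology is given by an increasing sequence of compatible
Hilbertian norms `‖·‖ₙ`, `n = 0, 1, 2, …`. -/
structure CountablyHilbertian (Φ : Type*) [AddCommGroup Φ] [Module ℝ Φ] [UniformSpace Φ] where
  uniformAddGroup : IsUniformAddGroup Φ
  complete : CompleteSpace Φ
  separable : TopologicalSpace.SeparableSpace Φ
  /-- the inner product `⟨·,·⟩ₙ` -/
  core : ℕ → InnerProductSpace.Core ℝ Φ
  withSeminorms : WithSeminorms fun n => hilbertNorm (core n)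
  mono : ∀ n m : ℕ, n ≤ m → ∀ φ : Φ, hilbertNorm (core n) φ ≤ hilbertNorm (core m) φ
  /-- compatibility of the norms: a sequence that is Cauchy for two of the norms and tends to zero
  for one of them tends to zero for the other -/
  compatible : ∀ (n m : ℕ) (u : ℕ → Φ), CauchySeq (fun k => toRenormed (core n) (u k)) →
    CauchySeq (fun k => toRenormed (core m) (u k)) →
    Tendsto (fun k => hilbertNorm (core n) (u k)) atTop (𝓝 0) →
    Tendsto (fun k => hilbertNorm (core m) (u k)) atTop (𝓝 0)

namespace CountablyHilbertian

variable {Φ : Type*} [AddCommGroup Φ] [Module ℝ Φ] [UniformSpace Φ] (S : CountablyHilbertian Φ)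

/-- `Φₙ`, the completion of `Φ` with respect to `‖·‖ₙ`. -/
def Pos (n : ℕ) : Type _ := UniformSpace.Completion (Renormed (S.core n))

instance (n : ℕ) : NormedAddCommGroup (S.Pos n) :=
  inferInstanceAs (NormedAddCommGroup (UniformSpace.Completion (Renormed (S.core n))))

instance (n : ℕ) : InnerProductSpace ℝ (S.Pos n) :=
  inferInstanceAs (InnerProductSpace ℝ (UniformSpace.Completion (Renormed (S.core n))))

instance (n : ℕ) : CompleteSpace (S.Pos n) :=
  inferInstanceAs (CompleteSpace (UniformSpace.Completion (Renormed (S.core n))))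

/-- `Φ₋ₙ`, the Hilbert space of bounded linear functionals on `Φₙ`. -/
def Neg (n : ℕ) : Type _ := StrongDual ℝ (S.Pos n)

instance (n : ℕ) : NormedAddCommGroup (S.Neg n) :=
  inferInstanceAs (NormedAddCommGroup (StrongDual ℝ (S.Pos n)))

instance (n : ℕ) : InnerProductSpace ℝ (S.Neg n) :=
  strongDualInner (H := S.Pos n)

/-- An element of `Φ₋ₙ` as a functional on `Φₙ` (the identity map). -/
def negEquiv (n : ℕ) : S.Neg n ≃ₗᵢ[ℝ] StrongDual ℝ (S.Pos n) where
  toFun u := u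
  invFun u := u
  map_add' _ _ := rfl
  map_smul' _ _ := rfl
  left_inv _ := rfl
  right_inv _ := rfl
  norm_map' _ := rfl

instance (n : ℕ) : CompleteSpace (S.Neg n) :=
  inferInstanceAs (CompleteSpace (StrongDual ℝ (S.Pos n)))

/-- The renormed space as a dense subspace of its completion. -/
def complIncl (n : ℕ) : Renormed (S.core n) →ₗᵢ[ℝ] S.Pos n :=
  (UniformSpace.Completion.toComplₗᵢ :
    Renormed (S.core n) →ₗᵢ[ℝ] UniformSpace.Completion (Renormed (S.core n)))

/-- The canonical map `Φ → Φₙ`. -/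
def toPos (n : ℕ) : Φ →L[ℝ] S.Pos n where
  toLinearMap := (S.complIncl n).toLinearMap ∘ₗ toRenormed (S.core n)
  cont := by
    have := S.uniformAddGroup
    refine continuous_of_continuousAt_zero
      ((S.complIncl n).toLinearMap ∘ₗ toRenormed (S.core n)) ?_
    have h := (S.withSeminorms.continuous_seminorm n).tendsto 0
    rw [map_zero] at h
    rw [ContinuousAt, map_zero, tendsto_zero_iff_norm_tendsto_zero]
    refine h.congr fun φ => ?_
    simp [hilbertNorm]

theorem norm_toPos (n : ℕ) (φ : Φ) : ‖S.toPos n φ‖ = hilbertNorm (S.core n) φ :=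
  (S.complIncl n).norm_map (toRenormed (S.core n) φ)

theorem inner_toPos (n : ℕ) (φ χ : Φ) :
    inner ℝ (S.toPos n φ) (S.toPos n χ) = (S.core n).inner φ χ :=
  (S.complIncl n).inner_map_map (toRenormed (S.core n) φ) (toRenormed (S.core n) χ)

theorem denseRange_toPos (n : ℕ) : DenseRange (S.toPos n) :=
  UniformSpace.Completion.denseRange_coe (α := Renormed (S.core n))

/-- The canonical map `Φₘ → Φₙ` for `n ≤ m`, extending the identity of `Φ`. -/
def posIncl {n m : ℕ} (h : n ≤ m) : S.Pos m →L[ℝ] S.Pos n :=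
  (LinearMap.mkContinuous
    ({ toFun := fun φ => φ, map_add' := fun _ _ => rfl, map_smul' := fun _ _ => rfl } :
      Renormed (S.core m) →ₗ[ℝ] Renormed (S.core n)) 1
    (fun φ => by rw [one_mul]; exact S.mono n m h φ)).completion

theorem posIncl_toPos {n m : ℕ} (h : n ≤ m) (φ : Φ) :
    S.posIncl h (S.toPos m φ) = S.toPos n φ :=
  ContinuousLinearMap.completion_apply_coe _ (toRenormed (S.core m) φ)

/-- The canonical embedding `Φ₋ₙ → Φ₋ₘ` for `n ≤ m`. -/
def negIncl {n m : ℕ} (h : n ≤ m) : S.Neg n →L[ℝ] S.Neg m :=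
  ((S.negEquiv m).symm.toContinuousLinearEquiv.toContinuousLinearMap.comp
    (ContinuousLinearMap.precomp ℝ (S.posIncl h))).comp
    (S.negEquiv n).toContinuousLinearEquiv.toContinuousLinearMap

/-- The canonical embedding `Φ₋ₙ → Φ'`; thus `S.emb n u φ` is `u[φ]`. -/
def emb (n : ℕ) (u : S.Neg n) : StrongDual ℝ Φ := (S.negEquiv n u).comp (S.toPos n)

theorem emb_negIncl {n m : ℕ} (h : n ≤ m) (u : S.Neg n) : S.emb m (S.negIncl h u) = S.emb n u := by
  ext φ
  exact congrArg (S.negEquiv n u) (S.posIncl_toPos h φ)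

theorem emb_injective (n : ℕ) : Function.Injective (S.emb n) := by
  intro u v h
  apply (S.negEquiv n).injective
  apply ContinuousLinearMap.coeFn_injective
  refine (S.denseRange_toPos n).equalizer (S.negEquiv n u).continuous (S.negEquiv n v).continuous ?_
  funext φ
  exact DFunLike.congr_fun h φ

/-- For a functional in `Φ'` that belongs to `Φ₋ₙ`, the same functional as an element of `Φ₋ₙ`
(a junk value otherwise). -/
def lift (n : ℕ) (u : StrongDual ℝ Φ) : S.Neg n := Function.invFun (S.emb n) u

theorem lift_emb (n : ℕ) (u : S.Neg n) : S.lift n (S.emb n u) = u :=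
  Function.leftInverse_invFun (S.emb_injective n) u

/-- `u ∈ Φ'` belongs to `Φ₋ₙ`. -/
def MemNeg (n : ℕ) (u : StrongDual ℝ Φ) : Prop := ∃ w : S.Neg n, S.emb n w = u

/-- The embedding `Φ → Φ₋ₙ` that comes from the identification of `Φ₀` with its dual:
`φ` acts as `⟨φ,·⟩₀`. -/
def toNeg (n : ℕ) (φ : Φ) : S.Neg n :=
  (S.negEquiv n).symm
    ((InnerProductSpace.toDual ℝ (S.Pos 0) (S.toPos 0 φ)).comp (S.posIncl n.zero_le))

theorem emb_toNeg (n : ℕ) (φ χ : Φ) :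
    S.emb n (S.toNeg n φ) χ = inner ℝ (S.toPos 0 φ) (S.toPos 0 χ) := by
  change inner ℝ (S.toPos 0 φ) (S.posIncl n.zero_le (S.toPos n χ)) = _
  rw [posIncl_toPos]

/-- The isometry `θₙ : Φ₋ₙ → Φₙ`, i.e. the Riesz isometry of `Φₙ`; see `theta_basis` below. -/
def theta (n : ℕ) (u : S.Neg n) : S.Pos n :=
  (InnerProductSpace.toDual ℝ (S.Pos n)).symm (S.negEquiv n u)

/-- Nuclearity: for each `n` there is `m > n` with `Φₘ → Φₙ` Hilbert-Schmidt. -/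
def IsNuclear : Prop :=
  ∀ n : ℕ, ∃ (m : ℕ) (h : n < m), IsHilbertSchmidt (S.posIncl h.le)

/-- `(φⱼ)` is a CONS in `Φ₀` and a COS in each `Φₙ`, `n ∈ ℤ`. -/
structure IsBasis (e : ℕ → Φ) : Prop where
  normalized : ∀ j, ‖S.toPos 0 (e j)‖ = 1
  pos : ∀ n, IsCompleteOrthogonal fun j => S.toPos n (e j)
  neg : ∀ n, IsCompleteOrthogonal fun j => S.toNeg n (e j)

/-- The normalized vector `φₖⁿ = φₖ / ‖φₖ‖ₙ`. -/
def normalize (n : ℕ) (φ : Φ) : Φ := ‖S.toPos n φ‖⁻¹ • φ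

theorem norm_theta (n : ℕ) (u : S.Neg n) : ‖S.theta n u‖ = ‖u‖ := by
  simp [theta]

/-- `θₙ (φⱼ) = ‖φⱼ‖ₙ⁻² φⱼ`. -/
theorem theta_toNeg_basis {e : ℕ → Φ} (he : S.IsBasis e) (n j : ℕ) :
    S.theta n (S.toNeg n (e j)) = (‖S.toPos n (e j)‖ ^ 2)⁻¹ • S.toPos n (e j) := by
  rw [theta, LinearIsometryEquiv.symm_apply_eq]
  apply ContinuousLinearMap.coeFn_injective
  refine Continuous.ext_on (he.pos n).dense_span (ContinuousLinearMap.continuous _)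
    (ContinuousLinearMap.continuous _) ?_
  intro x hx
  induction hx using Submodule.span_induction with
  | mem x h =>
    obtain ⟨i, rfl⟩ := h
    change inner ℝ (S.toPos 0 (e j)) (S.posIncl n.zero_le (S.toPos n (e i))) =
      inner ℝ ((‖S.toPos n (e j)‖ ^ 2)⁻¹ • S.toPos n (e j)) (S.toPos n (e i))
    rw [posIncl_toPos, real_inner_smul_left]
    by_cases hij : j = i
    · subst hij
      rw [real_inner_self_eq_norm_sq, real_inner_self_eq_norm_sq, he.normalized]
      have h0 : ‖S.toPos n (e j)‖ ≠ 0 := norm_ne_zero_iff.mpr ((he.pos n).ne_zero j)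
      field_simp
    · rw [(he.pos 0).orthogonal hij, (he.pos n).orthogonal hij, mul_zero]
  | zero => simp only [map_zero]
  | add x y _ _ hx hy => simp only [map_add, hx, hy]
  | smul a x _ hx => simp only [map_smul, hx]

/-- The defining property of `θₙ`: `θₙ (φⱼ / ‖φⱼ‖₋ₙ) = φⱼ / ‖φⱼ‖ₙ`. -/
theorem theta_basis {e : ℕ → Φ} (he : S.IsBasis e) (n j : ℕ) :
    S.theta n (‖S.toNeg n (e j)‖⁻¹ • S.toNeg n (e j)) = S.toPos n (S.normalize n (e j)) := by
  have h0 : ‖S.toPos n (e j)‖ ≠ 0 := norm_ne_zero_iff.mpr ((he.pos n).ne_zero j)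
  have hn : ‖S.toNeg n (e j)‖ = ‖S.toPos n (e j)‖⁻¹ := by
    rw [← S.norm_theta, S.theta_toNeg_basis he, norm_smul, norm_inv, norm_pow, norm_norm]
    field_simp
  have hs : ∀ (r : ℝ) (u : S.Neg n), S.theta n (r • u) = r • S.theta n u := fun r u => by
    simp [theta]
  rw [hs, S.theta_toNeg_basis he, hn, normalize, map_smul, smul_smul]
  congr 1
  field_simp

end CountablyHilbertian

/-! ### Coefficients, the deterministic limit and the linearized equation -/

section Equation

variable {Φ : Type*} [AddCommGroup Φ] [Module ℝ Φ] [UniformSpace Φ] (S : CountablyHilbertian Φ)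
  {X : Type*} [MeasurableSpace X] (ν : Measure X)
  (b : StrongDual ℝ Φ → StrongDual ℝ Φ) (G : StrongDual ℝ Φ → X → StrongDual ℝ Φ)

/-- The derivative `D(b(v)[φ])` of `v ↦ b(v)[φ]`, `Φ_{-q} → ℝ`. -/
def derivB (q : ℕ) (φ : Φ) (v : S.Neg q) : S.Neg q →L[ℝ] ℝ :=
  fderiv ℝ (fun w : S.Neg q => b (S.emb q w) φ) v

/-- The derivative `D_x(G(u,y)[φ])` of `u ↦ G(u,y)[φ]`, `Φ_{-r} → ℝ`. -/
def derivG (r : ℕ) (φ : Φ) (u : S.Neg r) (y : X) : S.Neg r →L[ℝ] ℝ :=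
  fderiv ℝ (fun w : S.Neg r => G (S.emb r w) y φ) u

/-- The class `𝓗`: for some `δ > 0`, `exp(δ h²)` is integrable on every set of finite measure. -/
def ExpSquareIntegrable (h : X → ℝ) : Prop :=
  ∃ δ : ℝ, 0 < δ ∧ ∀ Γ : Set X, MeasurableSet Γ → ν Γ < ⊤ →
    IntegrableOn (fun y => Real.exp (δ * h y ^ 2)) Γ ν

/-- First set of conditions on the coefficients. -/
structure BasicConditions (MG LG : X → ℝ) {p q : ℕ} (hpq : p < q) : Prop where
  hilbertSchmidt : IsHilbertSchmidt (S.negIncl hpq.le)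
  /- (a) -/
  b_mem : ∀ u : S.Neg p, S.MemNeg q (b (S.emb p u))
  b_cont : Continuous fun u : S.Neg p => S.lift q (b (S.emb p u))
  G_mem : ∀ (u : S.Neg p) (y : X), S.MemNeg p (G (S.emb p u) y)
  G_memLp : ∀ u : S.Neg p, MemLp (fun y => S.lift p (G (S.emb p u) y)) 2 ν
  G_cont : ∀ u : S.Neg p, Tendsto (fun u' : S.Neg p =>
    eLpNorm (fun y => S.lift p (G (S.emb p u') y) - S.lift p (G (S.emb p u) y)) 2 ν) (𝓝 u) (𝓝 0)
  /- (b) -/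
  b_growth : ∃ Mb : ℝ, 0 < Mb ∧ ∀ u : S.Neg p, ‖S.lift q (b (S.emb p u))‖ ≤ Mb * (1 + ‖u‖)
  MG_integrable : Integrable MG ν
  MG_memLp : MemLp MG 2 ν
  G_growth : ∀ (u : S.Neg p) (y : X), ‖S.lift p (G (S.emb p u) y)‖ ≤ MG y * (1 + ‖u‖)
  /- (c), where `χ` is `θ_p φ` -/
  b_coercive : ∃ Cb : ℝ, 0 < Cb ∧ ∀ φ χ : Φ, S.theta p (S.toNeg p φ) = S.toPos p χ →
    2 * b (S.emb p (S.toNeg p φ)) χ ≤ Cb * (1 + ‖S.toNeg p φ‖ ^ 2)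
  /- (d) -/
  b_monotone : ∃ Lb : ℝ, 0 < Lb ∧ ∀ u u' : S.Neg p,
    inner ℝ (S.negIncl hpq.le (u - u')) (S.lift q (b (S.emb p u)) - S.lift q (b (S.emb p u')))
      ≤ Lb * ‖S.negIncl hpq.le (u - u')‖ ^ 2
  /- (e) -/
  LG_integrable : Integrable LG ν
  LG_memLp : MemLp LG 2 ν
  G_lipschitz : ∀ (u u' : S.Neg p) (y : X),
    ‖S.negIncl hpq.le (S.lift p (G (S.emb p u) y) - S.lift p (G (S.emb p u') y))‖
      ≤ LG y * ‖S.negIncl hpq.le (u - u')‖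

/-- Second set of conditions on the coefficients; `m` is the bound for `‖v‖_{-p}`. -/
structure DerivativeConditions (e : ℕ → Φ) (MG LG : X → ℝ) {p q q₁ : ℕ} (hpq : p < q)
    (hq : q < q₁) (m : ℝ) : Prop where
  hilbertSchmidt : IsHilbertSchmidt (S.negIncl hq.le)
  /- (a) -/
  b_diff : ∀ φ : Φ, Differentiable ℝ fun v : S.Neg q => b (S.emb q v) φ
  Db_lipschitz : ∀ φ : Φ, ∃ L : ℝ, 0 < L ∧ ∀ u u' : S.Neg p,
    ‖derivB S b q φ (S.negIncl hpq.le u) - derivB S b q φ (S.negIncl hpq.le u')‖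
      ≤ L * ‖S.negIncl hpq.le (u - u')‖
  /- (b) -/
  Db_sum : ∀ η : S.Neg q, ∃ M₂ : ℝ, ∀ v : S.Neg p, ‖v‖ ≤ m →
    Summable (fun k => |derivB S b q (S.normalize q₁ (e k)) (S.negIncl hpq.le v) η| ^ 2) ∧
    ∑' k, |derivB S b q (S.normalize q₁ (e k)) (S.negIncl hpq.le v) η| ^ 2 ≤ M₂
  /- `A v η` is the functional `φ ↦ D(b(v)[φ])[η]` as an element of `Φ_{-q₁}` -/
  Db_bounds : ∃ A : S.Neg p → S.Neg q → S.Neg q₁,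
    (∀ v : S.Neg p, ‖v‖ ≤ m → ∀ (η : S.Neg q) (φ : Φ),
      S.emb q₁ (A v η) φ = derivB S b q φ (S.negIncl hpq.le v) η) ∧
    (∀ v : S.Neg p, ‖v‖ ≤ m → Continuous (A v)) ∧
    (∃ MA : ℝ, 0 < MA ∧ ∀ v : S.Neg p, ‖v‖ ≤ m → ∀ η : S.Neg q, ‖A v η‖ ≤ MA * (1 + ‖η‖)) ∧
    (∃ LA : ℝ, 0 < LA ∧ ∀ v : S.Neg p, ‖v‖ ≤ m → ∀ η : S.Neg q,
      inner ℝ (S.negIncl hq.le η) (A v η) ≤ LA * ‖S.negIncl hq.le η‖ ^ 2) ∧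
    (∃ CA : ℝ, 0 < CA ∧ ∀ v : S.Neg p, ‖v‖ ≤ m → ∀ (φ χ : Φ) (ζ : S.Neg p),
      S.theta q (S.toNeg q φ) = S.toPos q χ →
      2 * S.emb q₁ (A v (S.toNeg q φ + S.negIncl hpq.le ζ)) χ
        ≤ CA * (‖ζ‖ + ‖S.toNeg q φ‖) * ‖S.toNeg q φ‖)
  /- (c) -/
  G_diff : ∀ (φ : Φ) (y : X), Differentiable ℝ fun u : S.Neg q₁ => G (S.emb q₁ u) y φ
  DG_lipschitz : ∀ φ : Φ, ∃ L : X → ℝ, Integrable L ν ∧ ∀ (u u' : S.Neg p) (y : X),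
    ‖derivG S G q₁ φ (S.negIncl (hpq.trans hq).le u) y
      - derivG S G q₁ φ (S.negIncl (hpq.trans hq).le u') y‖
      ≤ L y * ‖S.negIncl hpq.le (u - u')‖
  DG_bounds : ∃ M : S.Neg p → X → ℝ, (∀ u y, 0 ≤ M u y) ∧
    (∀ (u : S.Neg p) (φ : Φ) (y : X),
      ‖derivG S G q₁ φ (S.negIncl (hpq.trans hq).le u) y‖ ≤ M u y * ‖S.toPos q₁ φ‖) ∧
    (∀ (u : S.Neg p) (φ : Φ) (y : X),
      ‖(derivG S G q₁ φ (S.negIncl (hpq.trans hq).le u) y).comp (S.negIncl hq.le)‖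
        ≤ M u y * ‖S.toPos q φ‖) ∧
    ∃ C : ℝ, ∀ u : S.Neg p, ‖u‖ ≤ m →
      Integrable (fun y => max (M u y) (M u y ^ 2)) ν ∧
      ∫ y, max (M u y) (M u y ^ 2) ∂ν ≤ C
  /- (d) -/
  MG_exp : ExpSquareIntegrable ν MG
  LG_exp : ExpSquareIntegrable ν LG

/-- `λ_T`, the Lebesgue measure on `[0,T]`. -/
def lebT (T : ℝ) : Measure (Icc (0 : ℝ) T) := Measure.comap Subtype.val volume

/-- `ν_T = ν ⊗ λ_T` on `X × [0,T]`. -/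
def nuT (T : ℝ) : Measure (X × Icc (0 : ℝ) T) := ν.prod (lebT T)

/-- `X⁰`, a continuous `Φ_{-q}`-valued solution of
`X⁰(t) = x₀ + ∫₀ᵗ b(X⁰(s)) ds + ∫_{X×[0,t]} G(X⁰(s),y) ν(dy) ds` with values in `Φ_{-p}` and
`sup_t ‖X⁰(t)‖_{-p} < ∞`. -/
structure IsLimitPath {p q : ℕ} (hpq : p < q) {T : ℝ} (x₀ : S.Neg p)
    (X₀ : Icc (0 : ℝ) T → S.Neg p) : Prop where
  cont : Continuous fun t => S.negIncl hpq.le (X₀ t)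
  bdd : BddAbove (range fun t => ‖X₀ t‖)
  b_integrable : ∀ φ : Φ, Integrable (fun s : Icc (0 : ℝ) T => b (S.emb p (X₀ s)) φ) (lebT T)
  G_integrable : ∀ φ : Φ,
    Integrable (fun z : X × Icc (0 : ℝ) T => G (S.emb p (X₀ z.2)) z.1 φ) (nuT ν T)
  eq : ∀ (t : Icc (0 : ℝ) T) (φ : Φ), S.emb p (X₀ t) φ = S.emb p x₀ φ
    + (∫ s in {s : Icc (0 : ℝ) T | s ≤ t}, b (S.emb p (X₀ s)) φ ∂(lebT T))
    + ∫ z in {z : X × Icc (0 : ℝ) T | z.2 ≤ t}, G (S.emb p (X₀ z.2)) z.1 φ ∂(nuT ν T)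

/-- `η ∈ C([0,T], Φ_{-q₁})` solves the linearized equation along `X₀`, driven by `ψ`, tested against
every `φ ∈ Φ`. All terms of the equation have to be meaningful: `η(s)` lies in `Φ_{-q}` (where it is
called `ζ s`), the domain of `D(b(X₀(s))[φ])`, for each `s`, and the integrals converge. -/
def SolvesLinearized {p q q₁ : ℕ} (hpq : p < q) (hq : q < q₁) {T : ℝ}
    (X₀ : Icc (0 : ℝ) T → S.Neg p) (ψ : Lp ℝ 2 (nuT ν T)) (η : C(Icc (0 : ℝ) T, S.Neg q₁)) :
    Prop :=
  ∃ ζ : Icc (0 : ℝ) T → S.Neg q, (∀ s, S.negIncl hq.le (ζ s) = η s) ∧ ∀ φ : Φ,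
    Integrable (fun s => derivB S b q φ (S.negIncl hpq.le (X₀ s)) (ζ s)) (lebT T) ∧
    Integrable (fun z : X × Icc (0 : ℝ) T =>
      derivG S G q₁ φ (S.negIncl (hpq.trans hq).le (X₀ z.2)) z.1 (η z.2)) (nuT ν T) ∧
    Integrable (fun z : X × Icc (0 : ℝ) T => G (S.emb p (X₀ z.2)) z.1 φ * ψ z) (nuT ν T) ∧
    ∀ t : Icc (0 : ℝ) T, S.emb q₁ (η t) φ =
      (∫ s in {s : Icc (0 : ℝ) T | s ≤ t},
          derivB S b q φ (S.negIncl hpq.le (X₀ s)) (ζ s) ∂(lebT T))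
      + (∫ z in {z : X × Icc (0 : ℝ) T | z.2 ≤ t},
          derivG S G q₁ φ (S.negIncl (hpq.trans hq).le (X₀ z.2)) z.1 (η z.2) ∂(nuT ν T))
      + ∫ z in {z : X × Icc (0 : ℝ) T | z.2 ≤ t}, G (S.emb p (X₀ z.2)) z.1 φ * ψ z ∂(nuT ν T)

end Equation

end

/-!
The linearized equation is read in the orthogonal basis `(φⱼ)`, as an evolution equation
`u' = Λ(t) u + f(t)` with `Λ(t) : Φ_{-q} → Φ_{-q₁}` the sum of `A_{X⁰(t)}` and of the integral over
`y` of the derivative of `G`. The conditions say that `Λ(t)` is quasi-dissipative for the inner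
product of `Φ_{-q₁}` and, on finite linear combinations of the basis, also for that of `Φ_{-q}`
(`IsDissipativeSystem`, `DerivativeConditions.exists_isDissipativeSystem`), and `f` is square
integrable in time with values in `Φ_{-q}` (`exists_forcing_bound`).

Existence (`IsDissipativeSystem.exists_isCoordSolution`): the Galerkin approximations, which solve
finite systems of ordinary differential equations, are bounded in `Φ_{-q}` by the energy estimate
there. By the energy estimate in `Φ_{-q₁}` they form a Cauchy sequence in `C([0,T], Φ_{-q₁})`,
because the Hilbert-Schmidt embedding is small on the basis vectors of large index. The limit is a
solution with the same bound in `Φ_{-q}`. The equation holds for every test function because its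
right-hand side is a functional in `Φ_{-q₁}`.

Uniqueness (`IsCoordSolution.eqOn`): the energy estimate in `Φ_{-q₁}` needs a bound for the
difference of two solutions in `Φ_{-q}`, which the notion of solution does not contain. The points
near which the difference is unbounded form a closed set; by Baire's theorem there is a nonempty
relatively open part of it on which the difference is bounded. Restarting the equation at the points
of this part, and using existence with its bound, one controls the difference in the gaps too, so
the exceptional set is empty (`IsCoordSolution.exists_norm_le`). Every solution is thus the one
constructed, and has its bound.
-/

noncomputable section

/-! ### Integral equations on an interval -/

/-- The chain rule for `u ↦ u²` along an absolutely continuous function. -/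
theorem sq_eq_add_integral_of_eq_add_integral {u g : ℝ → ℝ} {a b : ℝ} (hab : a ≤ b)
    (hg : IntervalIntegrable g volume a b)
    (hu : ∀ t ∈ Icc a b, u t = u a + ∫ r in a..t, g r) :
    ContinuousOn u (Icc a b) ∧ IntervalIntegrable (fun r => 2 * u r * g r) volume a b ∧
      ∀ t ∈ Icc a b, u t ^ 2 = u a ^ 2 + ∫ r in a..t, 2 * u r * g r := by
  have hac : AbsolutelyContinuousOnInterval (fun t => u a + ∫ r in a..t, g r) a b :=
    (LipschitzWith.const (u a)).lipschitzOnWith.absolutelyContinuousOnInterval.add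
      (hg.absolutelyContinuousOnInterval_intervalIntegral (c := a) (by simp))
  have hcont : ContinuousOn u (Icc a b) := by
    have h := hac.continuousOn
    rw [uIcc_of_le hab] at h
    exact h.congr hu
  have hint : IntervalIntegrable (fun r => 2 * u r * g r) volume a b := by
    refine hg.continuousOn_mul ?_
    rw [uIcc_of_le hab]
    exact continuousOn_const.mul hcont
  refine ⟨hcont, hint, fun t ht => ?_⟩
  have hsub : uIcc a t ⊆ uIcc a b := by
    rw [uIcc_of_le hab, uIcc_of_le ht.1]
    exact Icc_subset_Icc_right ht.2
  have h := (hac.mono hsub).integral_deriv_mul_eq_sub (hac.mono hsub)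
  have hd : ∫ r in a..t, 2 * u r * g r = ∫ x in a..t,
      deriv (fun t => u a + ∫ r in a..t, g r) x * (u a + ∫ r in a..x, g r)
        + (u a + ∫ r in a..x, g r) * deriv (fun t => u a + ∫ r in a..t, g r) x := by
    apply intervalIntegral.integral_congr_ae
    filter_upwards [hg.ae_hasDerivAt_integral] with x hx hxt
    have hxb : x ∈ uIcc a b := hsub (uIoc_subset_uIcc hxt)
    rw [((hx hxb a (by simp)).const_add (u a)).deriv,
      ← hu x (by rwa [uIcc_of_le hab] at hxb)]
    ring
  rw [hd, h, ← hu t ht]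
  simp
  ring

/-- Grönwall's inequality in integral form. -/
theorem le_mul_exp_of_le_add_mul_integral {y : ℝ → ℝ} {a b A κ : ℝ} (hκ : 0 ≤ κ)
    (hy : ContinuousOn y (Icc a b))
    (h : ∀ t ∈ Icc a b, y t ≤ A + κ * ∫ r in a..t, y r) :
    ∀ t ∈ Icc a b, y t ≤ A * Real.exp (κ * (t - a)) := by
  intro t ht
  have hab : a ≤ b := ht.1.trans ht.2
  set Y : ℝ → ℝ := IccExtend hab ((Icc a b).domRestrict y) with hY
  have hYc : Continuous Y := (continuousOn_iff_continuous_domRestrict.mp hy).Icc_extend'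
  have hYy : ∀ x ∈ Icc a b, Y x = y x := fun x hx => by
    rw [hY, IccExtend_of_mem _ _ hx]; rfl
  have hYint : ∀ x ∈ Icc a b, ∫ r in a..x, y r = ∫ r in a..x, Y r := fun x hx => by
    refine intervalIntegral.integral_congr fun r hr => ?_
    rw [uIcc_of_le hx.1] at hr
    exact (hYy r ⟨hr.1, hr.2.trans hx.2⟩).symm
  have hder : ∀ x, HasDerivAt (fun x => A + κ * ∫ r in a..x, Y r) (κ * Y x) x := fun x =>
    ((intervalIntegral.integral_hasDerivAt_right (hYc.intervalIntegrable _ _)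
      (hYc.stronglyMeasurableAtFilter _ _) hYc.continuousAt).const_mul κ).const_add A
  have key := le_gronwallBound_of_liminf_deriv_right_le (δ := A) (K := κ) (ε := 0) (a := a)
    (b := b) (f := fun x => A + κ * ∫ r in a..x, Y r) (f' := fun x => κ * Y x)
    (fun x _ => (hder x).continuousAt.continuousWithinAt)
    (fun x _ r hr => (hder x).hasDerivWithinAt.liminf_right_slope_le hr) (by simp)
    (fun x hx => by
      have := h x ⟨hx.1, hx.2.le⟩
      rw [hYint x ⟨hx.1, hx.2.le⟩, ← hYy x ⟨hx.1, hx.2.le⟩] at this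
      rw [add_zero]
      exact mul_le_mul_of_nonneg_left this hκ) t ht
  rw [gronwallBound_ε0] at key
  refine (h t ht).trans ?_
  rw [hYint t ht]
  exact key

/-- A linear Volterra equation with continuous kernel and continuous forcing has a solution. -/
theorem exists_eq_add_integral_clm {E : Type*} [NormedAddCommGroup E] [NormedSpace ℝ E]
    [CompleteSpace E] {L : ℝ → E →L[ℝ] E} (hL : Continuous L) {F : ℝ → E} {a b : ℝ} (hab : a ≤ b)
    (hF : ContinuousOn F (Icc a b)) :
    ∃ c : ℝ → E, Continuous c ∧ ∀ t ∈ Icc a b, c t = F t + ∫ r in a..t, L r (c r) := by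
  obtain ⟨M, hM⟩ := isCompact_Icc.exists_bound_of_continuousOn (s := Icc a b) hL.continuousOn
  have hM0 : 0 ≤ M := (norm_nonneg _).trans (hM a ⟨le_rfl, hab⟩)
  set l : ℝ := 2 * M + 1 with hl
  have hl0 : 0 < l := by positivity
  -- the weight `exp (-l t)` turns the Volterra operator into a contraction
  let w : C(Icc a b, E) → ℝ → E := fun y r => Real.exp (l * r) • L r (IccExtend hab y r)
  have hw : ∀ y, Continuous (w y) := fun y => by
    have h2 : Continuous (IccExtend hab y) := y.continuous.Icc_extend'
    exact ((Real.continuous_exp.comp (continuous_const.mul continuous_id)).smul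
      (hL.clm_apply h2))
  have hFr : Continuous ((Icc a b).domRestrict F) := continuousOn_iff_continuous_domRestrict.mp hF
  let Ψ : C(Icc a b, E) → C(Icc a b, E) := fun y =>
    ⟨fun t => Real.exp (-(l * t)) • (F t + ∫ r in a..t, w y r), by
      have h1 : Continuous fun t : ℝ => ∫ r in a..t, w y r :=
        intervalIntegral.continuous_primitive (fun _ _ => (hw y).intervalIntegrable _ _) a
      have h2 : Continuous fun t : Icc a b => Real.exp (-(l * t)) := by fun_prop
      exact h2.smul (hFr.add (h1.comp continuous_subtype_val))⟩
  have hcontr : ContractingWith (1 / 2) Ψ := by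
    refine ⟨by norm_num, LipschitzWith.of_dist_le_mul fun y z => ?_⟩
    rw [ContinuousMap.dist_le (by positivity)]
    intro t
    rw [dist_eq_norm]
    change ‖Real.exp (-(l * t)) • (F t + ∫ r in a..t, w y r)
      - Real.exp (-(l * t)) • (F t + ∫ r in a..t, w z r)‖ ≤ _
    rw [← smul_sub, add_sub_add_left_eq_sub,
      ← intervalIntegral.integral_sub ((hw y).intervalIntegrable _ _)
        ((hw z).intervalIntegrable _ _), norm_smul, Real.norm_of_nonneg (Real.exp_pos _).le]
    have hb : ∀ r ∈ Icc a (t : ℝ),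
        ‖w y r - w z r‖ ≤ Real.exp (l * r) * (M * dist y z) := by
      intro r hr
      have hr' : r ∈ Icc a b := ⟨hr.1, hr.2.trans t.2.2⟩
      rw [← smul_sub, ← map_sub, norm_smul, Real.norm_of_nonneg (Real.exp_pos _).le]
      gcongr
      refine (ContinuousLinearMap.le_opNorm _ _).trans ?_
      gcongr
      · exact hM r hr'
      · rw [← dist_eq_norm]
        exact ContinuousMap.dist_apply_le_dist _
    have hexp : ∫ r in a..t, Real.exp (l * r) * (M * dist y z)
        = (Real.exp (l * t) - Real.exp (l * a)) / l * (M * dist y z) := by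
      rw [intervalIntegral.integral_mul_const]
      congr 1
      have hd : ∀ x ∈ uIcc a (t : ℝ), HasDerivAt (fun r => Real.exp (l * r) / l)
          (Real.exp (l * x)) x := fun x _ => by
        have := (((hasDerivAt_id x).const_mul l).exp).div_const l
        simp only [id, mul_one] at this
        rwa [mul_div_assoc, div_self hl0.ne', mul_one] at this
      rw [intervalIntegral.integral_eq_sub_of_hasDerivAt hd
        (Continuous.intervalIntegrable (by fun_prop) _ _)]
      ring
    have hI : ‖∫ r in a..t, (w y r - w z r)‖
        ≤ (Real.exp (l * t) - Real.exp (l * a)) / l * (M * dist y z) := by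
      rw [← hexp]
      refine intervalIntegral.norm_integral_le_of_norm_le t.2.1 ?_
        (Continuous.intervalIntegrable (by fun_prop) _ _)
      exact Eventually.of_forall fun r hr => hb r ⟨hr.1.le, hr.2⟩
    have hI2 : ‖∫ r in a..t, (w y r - w z r)‖ ≤ Real.exp (l * t) / l * (M * dist y z) := by
      refine hI.trans ?_
      gcongr
      linarith [Real.exp_pos (l * a)]
    calc Real.exp (-(l * t)) * ‖∫ r in a..t, (w y r - w z r)‖
        ≤ Real.exp (-(l * t)) * (Real.exp (l * t) / l * (M * dist y z)) := by gcongr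
      _ = M / l * dist y z := by
        rw [Real.exp_neg]
        field_simp
      _ ≤ 1 / 2 * dist y z := by
        refine mul_le_mul_of_nonneg_right ?_ dist_nonneg
        rw [div_le_div_iff₀ hl0 two_pos]
        linarith
      _ = _ := by simp
  obtain ⟨y, hy⟩ : ∃ y, Ψ y = y := ⟨_, hcontr.fixedPoint_isFixedPt⟩
  have hyt : ∀ t (ht : t ∈ Icc a b), IccExtend hab y t
      = Real.exp (-(l * t)) • (F t + ∫ r in a..t, w y r) := fun t ht => by
    rw [IccExtend_of_mem _ _ ht]
    conv_lhs => rw [← hy]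
    rfl
  refine ⟨fun t => Real.exp (l * t) • IccExtend hab y t, ?_, fun t ht => ?_⟩
  · have h2 : Continuous (IccExtend hab y) := y.continuous.Icc_extend'
    exact (Real.continuous_exp.comp (continuous_const.mul continuous_id)).smul h2
  · simp only [map_smul]
    rw [hyt t ht, smul_smul, ← Real.exp_add, add_neg_cancel, Real.exp_zero, one_smul]

/-- Energy estimate: a weighted sum of squares of absolutely continuous functions obeys the Grönwall
bound that its differential inequality suggests. -/
theorem sum_mul_sq_le_of_energy {J : Type*} (s : Finset J) {μ : J → ℝ} (hμ : ∀ j ∈ s, 0 ≤ μ j)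
    {u g : J → ℝ → ℝ} {γ : ℝ → ℝ} {a b κ : ℝ} (hab : a ≤ b) (hκ : 0 ≤ κ)
    (hg : ∀ j ∈ s, IntervalIntegrable (g j) volume a b)
    (hu : ∀ j ∈ s, ∀ t ∈ Icc a b, u j t = u j a + ∫ r in a..t, g j r)
    (hγ : IntervalIntegrable γ volume a b) (hγ0 : ∀ᵐ r ∂volume.restrict (Icc a b), 0 ≤ γ r)
    (hle : ∀ᵐ r ∂volume.restrict (Icc a b),
      ∑ j ∈ s, μ j * (2 * u j r * g j r) ≤ κ * ∑ j ∈ s, μ j * u j r ^ 2 + γ r) :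
    ∀ t ∈ Icc a b, ∑ j ∈ s, μ j * u j t ^ 2
      ≤ (∑ j ∈ s, μ j * u j a ^ 2 + ∫ r in a..b, γ r) * Real.exp (κ * (b - a)) := by
  have hsq := fun j hj => sq_eq_add_integral_of_eq_add_integral hab (hg j hj) (hu j hj)
  have hycont : ContinuousOn (fun t => ∑ j ∈ s, μ j * u j t ^ 2) (Icc a b) :=
    continuousOn_finsetSum s fun j hj => continuousOn_const.mul ((hsq j hj).1.pow 2)
  have hsumint : IntervalIntegrable (fun r => ∑ j ∈ s, μ j * (2 * u j r * g j r)) volume a b :=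
    by simpa only [Finset.sum_fn] using
      IntervalIntegrable.sum s fun j hj => (hsq j hj).2.1.const_mul (μ j)
  have hsubint : ∀ {f : ℝ → ℝ}, IntervalIntegrable f volume a b → ∀ t ∈ Icc a b,
      IntervalIntegrable f volume a t := fun hf t ht => hf.mono_set (by
    rw [uIcc_of_le hab, uIcc_of_le ht.1]
    exact Icc_subset_Icc_right ht.2)
  have haer : ∀ {P : ℝ → Prop}, (∀ᵐ r ∂volume.restrict (Icc a b), P r) → ∀ t ∈ Icc a b,
      ∀ᵐ r ∂volume.restrict (Icc a t), P r := fun h t ht =>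
    ae_restrict_of_ae_restrict_of_subset (Icc_subset_Icc_right ht.2) h
  have hA : 0 ≤ ∑ j ∈ s, μ j * u j a ^ 2 + ∫ r in a..b, γ r := by
    refine add_nonneg (Finset.sum_nonneg fun j hj => mul_nonneg (hμ j hj) (sq_nonneg _)) ?_
    exact intervalIntegral.integral_nonneg_of_ae_restrict hab hγ0
  intro t ht
  refine (le_mul_exp_of_le_add_mul_integral (A := ∑ j ∈ s, μ j * u j a ^ 2 + ∫ r in a..b, γ r)
    hκ hycont (fun t ht => ?_) t ht).trans ?_
  · have hyint : IntervalIntegrable (fun t => ∑ j ∈ s, μ j * u j t ^ 2) volume a b :=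
      ContinuousOn.intervalIntegrable (by rwa [uIcc_of_le hab])
    have h1 : ∑ j ∈ s, μ j * u j t ^ 2 = ∑ j ∈ s, μ j * u j a ^ 2
        + ∫ r in a..t, ∑ j ∈ s, μ j * (2 * u j r * g j r) := by
      rw [intervalIntegral.integral_finsetSum
        fun j hj => ((hsubint (hsq j hj).2.1 t ht).const_mul (μ j))]
      rw [← Finset.sum_add_distrib]
      refine Finset.sum_congr rfl fun j hj => ?_
      rw [(hsq j hj).2.2 t ht, intervalIntegral.integral_const_mul]
      ring
    have h2 : ∫ r in a..t, ∑ j ∈ s, μ j * (2 * u j r * g j r)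
        ≤ ∫ r in a..t, (κ * ∑ j ∈ s, μ j * u j r ^ 2 + γ r) :=
      intervalIntegral.integral_mono_ae_restrict ht.1 (hsubint hsumint t ht)
        ((hsubint (hyint.const_mul κ) t ht).add (hsubint hγ t ht)) (haer hle t ht)
    have h3 : ∫ r in a..t, (κ * ∑ j ∈ s, μ j * u j r ^ 2 + γ r)
        = κ * (∫ r in a..t, ∑ j ∈ s, μ j * u j r ^ 2) + ∫ r in a..t, γ r := by
      rw [intervalIntegral.integral_add (hsubint (hyint.const_mul κ) t ht) (hsubint hγ t ht),
        intervalIntegral.integral_const_mul]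
    have h4 : ∫ r in a..t, γ r ≤ ∫ r in a..b, γ r := by
      refine intervalIntegral.integral_mono_interval le_rfl ht.1 ht.2 ?_ hγ
      exact ae_restrict_of_ae_restrict_of_subset Ioc_subset_Icc_self hγ0
    linarith
  · exact mul_le_mul_of_nonneg_left (Real.exp_le_exp.2
      (mul_le_mul_of_nonneg_left (by linarith [ht.2]) hκ)) hA

/-! ### Linear evolution equations between two Hilbert spaces -/

/-- The data of a linear evolution equation `u' = Λ(t) u` in a Hilbert space `K`, with `Λ(t)`
defined on a Hilbert space `H` that is compactly embedded into `K` by `ι`. The spaces share an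
orthogonal basis, orthonormal in `H`; `ℓ j t` is the `j`-th coordinate of `Λ(t)` with respect to it. The
operator is quasi-dissipative for the inner product of `K`, and, on finite linear combinations of
the basis, for that of `H`. -/
structure IsDissipativeSystem {H K : Type*} [NormedAddCommGroup H] [InnerProductSpace ℝ H]
    [NormedAddCommGroup K] [InnerProductSpace ℝ K] (h : HilbertBasis ℕ ℝ H) (ι : H →L[ℝ] K)
    (ℓ : ℕ → ℝ → H →L[ℝ] ℝ) (Λ : ℝ → H → K) (M L C : ℝ) : Prop where
  orthogonal : Pairwise fun i j => inner ℝ (ι (h i)) (ι (h j)) = 0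
  ne_zero : ∀ j, ι (h j) ≠ 0
  tendsto_norm : Tendsto (fun j => ‖ι (h j)‖) atTop (𝓝 0)
  continuous_coord : ∀ j, Continuous (ℓ j)
  inner_eq : ∀ j t x, inner ℝ (ι (h j)) (Λ t x) = ‖ι (h j)‖ ^ 2 * ℓ j t x
  M_nonneg : 0 ≤ M
  L_nonneg : 0 ≤ L
  C_nonneg : 0 ≤ C
  growth : ∀ t x, ‖Λ t x‖ ≤ M * (1 + ‖x‖)
  dissipative : ∀ t x, inner ℝ (ι x) (Λ t x) ≤ L * ‖ι x‖ ^ 2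
  coercive : ∀ (s : Finset ℕ) (t : ℝ) (c : ℕ → ℝ),
    ∑ j ∈ s, c j * ℓ j t (∑ i ∈ s, c i • h i) ≤ C * ∑ j ∈ s, c j ^ 2

namespace IsDissipativeSystem

variable {H K : Type*} [NormedAddCommGroup H] [InnerProductSpace ℝ H]
  [NormedAddCommGroup K] [InnerProductSpace ℝ K] {h : HilbertBasis ℕ ℝ H} {ι : H →L[ℝ] K}
  {ℓ : ℕ → ℝ → H →L[ℝ] ℝ} {Λ : ℝ → H → K} {M L C : ℝ}

theorem norm_map_sum_sq (hD : IsDissipativeSystem h ι ℓ Λ M L C) (s : Finset ℕ) (c : ℕ → ℝ) :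
    ‖ι (∑ j ∈ s, c j • h j)‖ ^ 2 = ∑ j ∈ s, ‖ι (h j)‖ ^ 2 * c j ^ 2 := by
  rw [← real_inner_self_eq_norm_sq, map_sum, sum_inner]
  refine Finset.sum_congr rfl fun j hj => ?_
  rw [inner_sum, Finset.sum_eq_single j]
  · rw [map_smul, real_inner_smul_left, real_inner_smul_right, real_inner_self_eq_norm_sq]
    ring
  · intro i _ hij
    rw [map_smul, map_smul, real_inner_smul_left, real_inner_smul_right, hD.orthogonal hij.symm]
    ring
  · exact fun h => absurd hj h

theorem inner_map_sum (hD : IsDissipativeSystem h ι ℓ Λ M L C) (s : Finset ℕ) (c : ℕ → ℝ) (t : ℝ)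
    (x : H) : inner ℝ (ι (∑ j ∈ s, c j • h j)) (Λ t x) =
      ∑ j ∈ s, ‖ι (h j)‖ ^ 2 * (c j * ℓ j t x) := by
  rw [map_sum, sum_inner]
  refine Finset.sum_congr rfl fun j _ => ?_
  rw [map_smul, real_inner_smul_left, hD.inner_eq]
  ring

end IsDissipativeSystem

theorem HilbertBasis.norm_sum_smul_sq {H : Type*} [NormedAddCommGroup H] [InnerProductSpace ℝ H]
    (h : HilbertBasis ℕ ℝ H) (s : Finset ℕ) (c : ℕ → ℝ) :
    ‖∑ j ∈ s, c j • h j‖ ^ 2 = ∑ j ∈ s, c j ^ 2 := by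
  rw [← real_inner_self_eq_norm_sq, h.orthonormal.inner_sum]
  simp [pow_two]

theorem HilbertBasis.sum_sq_le {H : Type*} [NormedAddCommGroup H] [InnerProductSpace ℝ H]
    (h : HilbertBasis ℕ ℝ H) (s : Finset ℕ) (x : H) :
    ∑ j ∈ s, (inner ℝ (h j) x) ^ 2 ≤ ‖x‖ ^ 2 := by
  have := h.orthonormal.sum_inner_products_le x (s := s)
  simpa using this

/-! ### Galerkin approximations -/

section Galerkin

variable {H K : Type*} [NormedAddCommGroup H] [InnerProductSpace ℝ H]
  [NormedAddCommGroup K] [InnerProductSpace ℝ K] {h : HilbertBasis ℕ ℝ H} {ι : H →L[ℝ] K}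
  {ℓ : ℕ → ℝ → H →L[ℝ] ℝ} {Λ : ℝ → H → K} {M L C : ℝ}

/-- `z` solves the equation with initial value `x` and forcing `f`, projected onto the span of the
first `d` basis vectors. -/
structure IsGalerkin (h : HilbertBasis ℕ ℝ H) (ℓ : ℕ → ℝ → H →L[ℝ] ℝ) (f : ℕ → ℝ → ℝ) (a b : ℝ)
    (x : H) (d : ℕ) (z : ℝ → H) : Prop where
  cont : Continuous z
  eq_sum : ∀ t ∈ Icc a b, z t = ∑ j ∈ Finset.range d, inner ℝ (h j) (z t) • h j
  eq : ∀ j < d, ∀ t ∈ Icc a b,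
    inner ℝ (h j) (z t) = inner ℝ (h j) x + ∫ r in a..t, (ℓ j r (z r) + f j r)

theorem exists_isGalerkin [CompleteSpace H] (h : HilbertBasis ℕ ℝ H) (hℓ : ∀ j, Continuous (ℓ j))
    {f : ℕ → ℝ → ℝ} {a b : ℝ} (hab : a ≤ b) (hf : ∀ j, IntervalIntegrable (f j) volume a b)
    (x : H) (d : ℕ) : ∃ z, IsGalerkin h ℓ f a b x d z := by
  have hc : Continuous fun r => ∑ j ∈ Finset.range d, (ℓ j r).smulRight (h j) :=
    continuous_finsetSum _ fun j _ =>
      ((ContinuousLinearMap.smulRightL ℝ H H).flip (h j)).continuous.comp (hℓ j)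
  have hF : ContinuousOn (fun t => ∑ j ∈ Finset.range d,
      (inner ℝ (h j) x + ∫ r in a..t, f j r) • h j) (Icc a b) := by
    refine continuousOn_finsetSum _ fun j _ => ContinuousOn.smul ?_ continuousOn_const
    refine continuousOn_const.add ?_
    have := intervalIntegral.continuousOn_primitive_interval' (hf j) (a := a) (by simp)
    rwa [uIcc_of_le hab] at this
  obtain ⟨z, hz, hzeq⟩ := exists_eq_add_integral_clm hc hab hF
  have hinner : ∀ k, ∀ t ∈ Icc a b, inner ℝ (h k) (z t) =
      if k < d then inner ℝ (h k) x + ∫ r in a..t, (ℓ k r (z r) + f k r) else 0 := by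
    intro k t ht
    have hI : Continuous fun r => (∑ j ∈ Finset.range d, (ℓ j r).smulRight (h j)) (z r) :=
      hc.clm_apply hz
    have hsel : ∀ c : ℕ → ℝ, inner ℝ (h k) (∑ j ∈ Finset.range d, c j • h j)
        = if k < d then c k else 0 := by
      intro c
      split_ifs with hk
      · exact h.orthonormal.inner_right_sum c (Finset.mem_range.2 hk)
      · rw [inner_sum]
        refine Finset.sum_eq_zero fun j hj => ?_
        rw [real_inner_smul_right, h.orthonormal.2, mul_zero]
        rintro rfl
        exact hk (Finset.mem_range.1 hj)
    have hint : inner ℝ (h k) (∫ r in a..t, (∑ j ∈ Finset.range d, (ℓ j r).smulRight (h j)) (z r))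
        = ∫ r in a..t, if k < d then ℓ k r (z r) else 0 := by
      have := (innerSL ℝ (h k)).intervalIntegral_comp_comm (hI.intervalIntegrable (μ := volume) a t)
      rw [innerSL_apply_apply] at this
      rw [← this]
      refine intervalIntegral.integral_congr fun r _ => ?_
      simp only [innerSL_apply_apply, _root_.sum_apply,
        ContinuousLinearMap.smulRight_apply]
      exact hsel _
    rw [hzeq t ht, inner_add_right, hint, hsel]
    split_ifs with hk
    · rw [intervalIntegral.integral_add (((hℓ k).clm_apply hz).intervalIntegrable _ _)]
      · ring
      · refine (hf k).mono_set ?_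
        rw [uIcc_of_le hab, uIcc_of_le ht.1]
        exact Icc_subset_Icc_right ht.2
    · simp
  refine ⟨z, hz, fun t ht => ?_, fun j hj t ht => by rw [hinner j t ht, if_pos hj]⟩
  refine h.repr.injective ?_
  ext k
  rw [h.repr_apply_apply, h.repr_apply_apply]
  by_cases hk : k < d
  · rw [h.orthonormal.inner_right_sum _ (Finset.mem_range.2 hk)]
  · rw [hinner k t ht, if_neg hk, inner_sum, Finset.sum_eq_zero]
    intro j hj
    rw [real_inner_smul_right, h.orthonormal.2, mul_zero]
    rintro rfl
    exact hk (Finset.mem_range.1 hj)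

namespace IsGalerkin

variable {f : ℕ → ℝ → ℝ} {a b : ℝ} {x : H} {d : ℕ} {z : ℝ → H}

theorem norm_sq_eq (hz : IsGalerkin h ℓ f a b x d z) {t : ℝ} (ht : t ∈ Icc a b) :
    ‖z t‖ ^ 2 = ∑ j ∈ Finset.range d, inner ℝ (h j) (z t) ^ 2 := by
  conv_lhs => rw [hz.eq_sum t ht]
  exact h.norm_sum_smul_sq _ _

theorem inner_left (hz : IsGalerkin h ℓ f a b x d z) (hab : a ≤ b) {j : ℕ} (hj : j < d) :
    inner ℝ (h j) (z a) = inner ℝ (h j) x := by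
  rw [hz.eq j hj a ⟨le_rfl, hab⟩, intervalIntegral.integral_same, add_zero]

theorem inner_of_le (hz : IsGalerkin h ℓ f a b x d z) {t : ℝ} (ht : t ∈ Icc a b) {j : ℕ}
    (hj : d ≤ j) : inner ℝ (h j) (z t) = 0 := by
  rw [hz.eq_sum t ht, inner_sum, Finset.sum_eq_zero]
  intro i hi
  rw [real_inner_smul_right, h.orthonormal.2, mul_zero]
  rintro rfl
  exact absurd (Finset.mem_range.1 hi) (not_lt.2 hj)

/-- The Galerkin approximations are bounded in `H`, uniformly in the dimension. -/
theorem norm_sq_le (hz : IsGalerkin h ℓ f a b x d z) (hD : IsDissipativeSystem h ι ℓ Λ M L C)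
    (hab : a ≤ b) (hf : ∀ j, IntervalIntegrable (f j) volume a b) {β : ℝ → ℝ}
    (hβ : IntervalIntegrable β volume a b)
    (hfβ : ∀ᵐ r ∂volume.restrict (Icc a b), ∀ s : Finset ℕ, ∑ j ∈ s, f j r ^ 2 ≤ β r) :
    ∀ t ∈ Icc a b, ‖z t‖ ^ 2
      ≤ (‖x‖ ^ 2 + ∫ r in a..b, β r) * Real.exp ((2 * C + 1) * (b - a)) := by
  intro t ht
  have hC := hD.C_nonneg
  have key := sum_mul_sq_le_of_energy (Finset.range d) (μ := fun _ => 1)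
    (u := fun j r => inner ℝ (h j) (z r)) (g := fun j r => ℓ j r (z r) + f j r) (γ := β)
    (a := a) (b := b) (κ := 2 * C + 1) (fun _ _ => zero_le_one) hab (by positivity)
    (fun j _ => (((hD.continuous_coord j).clm_apply hz.cont).intervalIntegrable _ _).add (hf j))
    (fun j hj t ht => by
      rw [hz.inner_left hab (Finset.mem_range.1 hj)]
      exact hz.eq j (Finset.mem_range.1 hj) t ht) hβ
    (by
      filter_upwards [hfβ] with r hr
      simpa using hr ∅)
    (by
      filter_upwards [hfβ, ae_restrict_mem measurableSet_Icc] with r hr hrm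
      have h1 := hD.coercive (Finset.range d) r fun j => inner ℝ (h j) (z r)
      rw [← hz.eq_sum r hrm] at h1
      have h2 : ∑ j ∈ Finset.range d, 2 * inner ℝ (h j) (z r) * f j r
          ≤ ∑ j ∈ Finset.range d, (inner ℝ (h j) (z r) ^ 2 + f j r ^ 2) :=
        Finset.sum_le_sum fun j _ => two_mul_le_add_sq _ _
      rw [Finset.sum_add_distrib] at h2
      have h3 := hr (Finset.range d)
      have h4 : ∑ j ∈ Finset.range d, 1 * (2 * inner ℝ (h j) (z r) * (ℓ j r (z r) + f j r))
          = 2 * (∑ j ∈ Finset.range d, inner ℝ (h j) (z r) * ℓ j r (z r))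
            + ∑ j ∈ Finset.range d, 2 * inner ℝ (h j) (z r) * f j r := by
        rw [Finset.mul_sum, ← Finset.sum_add_distrib]
        exact Finset.sum_congr rfl fun j _ => by ring
      rw [h4]
      simp only [one_mul]
      linarith) t ht
  simp only [one_mul] at key
  rw [hz.norm_sq_eq ht]
  refine key.trans ?_
  gcongr
  rw [← hz.norm_sq_eq ⟨le_rfl, hab⟩]
  rw [hz.norm_sq_eq ⟨le_rfl, hab⟩]
  rw [Finset.sum_congr rfl fun j hj => by rw [hz.inner_left hab (Finset.mem_range.1 hj)]]
  exact h.sum_sq_le _ _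

/-- Two Galerkin approximations are close in `K` because the embedding is small on the
span of the basis vectors with large index. -/
theorem norm_map_sub_sq_le (hD : IsDissipativeSystem h ι ℓ Λ M L C) (hab : a ≤ b)
    (hf : ∀ j, IntervalIntegrable (f j) volume a b) {β : ℝ → ℝ}
    (hβ : IntervalIntegrable β volume a b)
    (hfβ : ∀ᵐ r ∂volume.restrict (Icc a b), ∀ s : Finset ℕ, ∑ j ∈ s, f j r ^ 2 ≤ β r)
    {d' : ℕ} (hd : d ≤ d') {z' : ℝ → H} (hz : IsGalerkin h ℓ f a b x d z)
    (hz' : IsGalerkin h ℓ f a b x d' z') {R ε : ℝ} (hx : ‖x‖ ≤ R)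
    (hR : ∀ t ∈ Icc a b, ‖z t‖ ≤ R) (hR' : ∀ t ∈ Icc a b, ‖z' t‖ ≤ R) (hε0 : 0 ≤ ε)
    (hε1 : ε ≤ 1) (hε : ∀ j, d ≤ j → ‖ι (h j)‖ ≤ ε) :
    ∀ t ∈ Icc a b, ‖ι (z t - z' t)‖ ^ 2 ≤ ε * ((R ^ 2
      + ∫ r in a..b, (4 * M * R * (1 + R) + 4 * R ^ 2 + β r)) * Real.exp (2 * L * (b - a))) := by
  have hu_le : ∀ t ∈ Icc a b, ‖z t - z' t‖ ≤ 2 * R := fun t ht =>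
    (norm_sub_le _ _).trans (by linarith [hR t ht, hR' t ht])
  have hR0 : 0 ≤ R := (norm_nonneg x).trans hx
  have hM := hD.M_nonneg
  have hL := hD.L_nonneg
  have hμ : ∀ j, d ≤ j → ‖ι (h j)‖ ^ 2 ≤ ε := fun j hj =>
    (pow_le_pow_left₀ (norm_nonneg _) (hε j hj) 2).trans (by nlinarith)
  have hsum : ∀ t ∈ Icc a b,
      z t - z' t = ∑ j ∈ Finset.range d', inner ℝ (h j) (z t - z' t) • h j := by
    intro t ht
    conv_lhs => rw [hz.eq_sum t ht, hz'.eq_sum t ht]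
    simp only [inner_sub_right, sub_smul, Finset.sum_sub_distrib]
    congr 1
    refine Finset.sum_subset (Finset.range_subset_range.2 hd) fun j _ hj => ?_
    rw [hz.inner_of_le ht (by simpa using hj), zero_smul]
  have hint : ∀ j, IntervalIntegrable (fun r => ℓ j r (z r) + f j r) volume a b := fun j =>
    (((hD.continuous_coord j).clm_apply hz.cont).intervalIntegrable _ _).add (hf j)
  have hint' : ∀ j, IntervalIntegrable (fun r => ℓ j r (z' r) + f j r) volume a b := fun j =>
    (((hD.continuous_coord j).clm_apply hz'.cont).intervalIntegrable _ _).add (hf j)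
  have hsub : ∀ {g : ℝ → ℝ}, IntervalIntegrable g volume a b → ∀ t ∈ Icc a b,
      IntervalIntegrable g volume a t := fun hg t ht => hg.mono_set (by
    rw [uIcc_of_le hab, uIcc_of_le ht.1]
    exact Icc_subset_Icc_right ht.2)
  have haI : a ∈ Icc a b := ⟨le_rfl, hab⟩
  -- for `d ≤ j` the coordinate of `z` vanishes, so that the coordinate of `z - z'` is driven by
  -- `-(ℓ j (z') + f j) = ℓ j (z - z') - (ℓ j z + f j)`
  have key := sum_mul_sq_le_of_energy (Finset.range d') (μ := fun j => ‖ι (h j)‖ ^ 2)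
    (u := fun j r => inner ℝ (h j) (z r - z' r))
    (g := fun j r => ℓ j r (z r - z' r) - if j < d then 0 else ℓ j r (z r) + f j r)
    (γ := fun r => ε * (4 * M * R * (1 + R) + 4 * R ^ 2 + β r))
    (a := a) (b := b) (κ := 2 * L) (fun _ _ => sq_nonneg _) hab (by positivity)
    (fun j _ => by
      refine (((hD.continuous_coord j).clm_apply
        (hz.cont.sub hz'.cont)).intervalIntegrable _ _).sub ?_
      split_ifs
      · exact intervalIntegrable_const
      · exact hint j)
    (fun j hj t ht => by
      have hj := Finset.mem_range.1 hj
      simp only [inner_sub_right, map_sub]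
      rw [hz'.inner_left hab hj, hz'.eq j hj t ht]
      split_ifs with hjd
      · rw [hz.inner_left hab hjd, hz.eq j hjd t ht, add_sub_add_left_eq_sub,
          ← intervalIntegral.integral_sub (hsub (hint j) t ht) (hsub (hint' j) t ht),
          sub_self, zero_add]
        exact intervalIntegral.integral_congr fun r _ => by simp
      · rw [hz.inner_of_le haI (not_lt.1 hjd), hz.inner_of_le ht (not_lt.1 hjd), zero_sub,
          neg_add, zero_sub, ← intervalIntegral.integral_neg]
        congr 1
        exact intervalIntegral.integral_congr fun r _ => by ring)
    ((intervalIntegrable_const.add hβ).const_mul ε)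
    (by
      filter_upwards [hfβ] with r hr
      have hr := hr ∅
      rw [Finset.sum_empty] at hr
      positivity)
    (by
      filter_upwards [hfβ, ae_restrict_mem measurableSet_Icc] with r hr hrm
      set u : H := z r - z' r with hu
      set U : Finset ℕ := (Finset.range d').filter fun j => ¬ j < d with hU
      have hUd : ∀ j ∈ U, d ≤ j := fun j hj => not_lt.1 (Finset.mem_filter.1 hj).2
      have h1 : ∑ j ∈ Finset.range d', ‖ι (h j)‖ ^ 2 * (2 * inner ℝ (h j) u
            * (ℓ j r u - if j < d then 0 else ℓ j r (z r) + f j r))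
          = 2 * (∑ j ∈ Finset.range d', ‖ι (h j)‖ ^ 2 * (inner ℝ (h j) u * ℓ j r u))
            - 2 * (∑ j ∈ U, ‖ι (h j)‖ ^ 2 * (inner ℝ (h j) u * ℓ j r (z r)))
            - ∑ j ∈ U, ‖ι (h j)‖ ^ 2 * (2 * inner ℝ (h j) u * f j r) := by
        rw [hU, Finset.sum_filter, Finset.sum_filter, Finset.mul_sum, Finset.mul_sum,
          ← Finset.sum_sub_distrib, ← Finset.sum_sub_distrib]
        refine Finset.sum_congr rfl fun j _ => ?_
        by_cases hjd : j < d <;> simp [hjd] <;> ring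
      have h2 : ∑ j ∈ Finset.range d', ‖ι (h j)‖ ^ 2 * (inner ℝ (h j) u * ℓ j r u)
          ≤ L * ∑ j ∈ Finset.range d', ‖ι (h j)‖ ^ 2 * inner ℝ (h j) u ^ 2 := by
        have := hD.dissipative r u
        rwa [← hD.inner_map_sum, ← hD.norm_map_sum_sq, ← hsum r hrm]
      have h3 : |∑ j ∈ U, ‖ι (h j)‖ ^ 2 * (inner ℝ (h j) u * ℓ j r (z r))|
          ≤ ε * (2 * R) * (M * (1 + R)) := by
        rw [← hD.inner_map_sum U (fun j => inner ℝ (h j) u)]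
        refine (abs_real_inner_le_norm _ _).trans ?_
        gcongr
        · refine le_of_sq_le_sq ?_ (by positivity)
          rw [hD.norm_map_sum_sq, mul_pow]
          calc ∑ j ∈ U, ‖ι (h j)‖ ^ 2 * inner ℝ (h j) u ^ 2
              ≤ ∑ j ∈ U, ε ^ 2 * inner ℝ (h j) u ^ 2 := by
                refine Finset.sum_le_sum fun j hj => ?_
                gcongr
                exact hε j (hUd j hj)
            _ = ε ^ 2 * ∑ j ∈ U, inner ℝ (h j) u ^ 2 := by rw [Finset.mul_sum]
            _ ≤ ε ^ 2 * ‖u‖ ^ 2 := by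
                gcongr
                exact h.sum_sq_le _ _
            _ ≤ ε ^ 2 * (2 * R) ^ 2 := by
                gcongr
                exact hu_le r hrm
        · refine (hD.growth _ _).trans ?_
          gcongr
          exact hR r hrm
      have h4 : -∑ j ∈ U, ‖ι (h j)‖ ^ 2 * (2 * inner ℝ (h j) u * f j r)
          ≤ ε * (4 * R ^ 2 + β r) := by
        calc -∑ j ∈ U, ‖ι (h j)‖ ^ 2 * (2 * inner ℝ (h j) u * f j r)
            ≤ ∑ j ∈ U, ε * (inner ℝ (h j) u ^ 2 + f j r ^ 2) := by
              rw [← Finset.sum_neg_distrib]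
              refine Finset.sum_le_sum fun j hj => ?_
              have h5 : -(2 * inner ℝ (h j) u * f j r) ≤ inner ℝ (h j) u ^ 2 + f j r ^ 2 := by
                linarith [sq_nonneg (inner ℝ (h j) u + f j r),
                  add_sq (inner ℝ (h j) u) (f j r)]
              calc -(‖ι (h j)‖ ^ 2 * (2 * inner ℝ (h j) u * f j r))
                  = ‖ι (h j)‖ ^ 2 * -(2 * inner ℝ (h j) u * f j r) := by ring
                _ ≤ ‖ι (h j)‖ ^ 2 * (inner ℝ (h j) u ^ 2 + f j r ^ 2) := by gcongr
                _ ≤ _ := by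
                  gcongr
                  exact hμ j (hUd j hj)
          _ = ε * (∑ j ∈ U, inner ℝ (h j) u ^ 2 + ∑ j ∈ U, f j r ^ 2) := by
              rw [← Finset.mul_sum, Finset.sum_add_distrib]
          _ ≤ _ := by
              gcongr
              · refine (h.sum_sq_le U u).trans ?_
                have := pow_le_pow_left₀ (norm_nonneg _) (hu_le r hrm) 2
                linarith [mul_pow 2 R 2]
              · exact hr U
      rw [h1]
      have h6 := (abs_le.1 h3).1
      linarith) 
  intro t ht
  have hle := key t ht
  rw [← hD.norm_map_sum_sq, ← hsum t ht] at hle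
  refine hle.trans ?_
  rw [intervalIntegral.integral_const_mul, ← mul_assoc, mul_add ε (R ^ 2)]
  refine mul_le_mul_of_nonneg_right (add_le_add ?_ le_rfl) (Real.exp_pos _).le
  calc ∑ j ∈ Finset.range d', ‖ι (h j)‖ ^ 2 * inner ℝ (h j) (z a - z' a) ^ 2
      ≤ ∑ j ∈ Finset.range d', ε * inner ℝ (h j) x ^ 2 := by
        refine Finset.sum_le_sum fun j hj => ?_
        have hj := Finset.mem_range.1 hj
        rw [inner_sub_right, hz'.inner_left hab hj]
        by_cases hjd : j < d
        · rw [hz.inner_left hab hjd, sub_self]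
          simp only [ne_eq, OfNat.ofNat_ne_zero, not_false_eq_true, zero_pow, mul_zero]
          positivity
        · rw [hz.inner_of_le haI (not_lt.1 hjd), zero_sub, neg_sq]
          gcongr
          exact hμ j (not_lt.1 hjd)
    _ ≤ ε * R ^ 2 := by
        rw [← Finset.mul_sum]
        gcongr
        exact (h.sum_sq_le _ _).trans (by gcongr)

end IsGalerkin

end Galerkin

/-! ### Existence of solutions -/

section Existence

/-- A bounded sequence in a Hilbert space whose coordinates converge is weakly convergent. -/
theorem HilbertBasis.exists_weak_limit {H : Type*} [NormedAddCommGroup H] [InnerProductSpace ℝ H]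
    (h : HilbertBasis ℕ ℝ H) {x : ℕ → H} {R : ℝ} (hx : ∀ n, ‖x n‖ ≤ R)
    (hc : ∀ j, CauchySeq fun n => inner ℝ (h j) (x n)) :
    ∃ y, ‖y‖ ≤ R ∧ ∀ v, Tendsto (fun n => inner ℝ v (x n)) atTop (𝓝 (inner ℝ v y)) := by
  have hR : 0 ≤ R := (norm_nonneg _).trans (hx 0)
  choose c hcl using fun j => cauchySeq_tendsto_of_complete (hc j)
  have hcs : ∀ s : Finset ℕ, ∑ j ∈ s, c j ^ 2 ≤ R ^ 2 := fun s =>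
    le_of_tendsto (tendsto_finsetSum s fun j _ => (hcl j).pow 2) (Eventually.of_forall fun n =>
      (h.sum_sq_le s (x n)).trans (pow_le_pow_left₀ (norm_nonneg _) (hx n) 2))
  have hmem : Memℓp c 2 := by
    refine memℓp_gen ?_
    simpa using summable_of_sum_le (fun j => sq_nonneg (c j)) hcs
  set y : H := h.repr.symm ⟨c, hmem⟩ with hy
  have hyc : ∀ j, inner ℝ (h j) y = c j := fun j => by
    rw [← h.repr_apply_apply, hy, LinearIsometryEquiv.apply_symm_apply]
  have hlim : ∀ v, Tendsto (fun n => inner ℝ v (x n)) atTop (𝓝 (inner ℝ v y)) := by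
    have hspan : ∀ v ∈ Submodule.span ℝ (range h),
        Tendsto (fun n => inner ℝ v (x n)) atTop (𝓝 (inner ℝ v y)) := by
      intro v hv
      induction hv using Submodule.span_induction with
      | mem v hv =>
        obtain ⟨j, rfl⟩ := hv
        rw [hyc]
        exact hcl j
      | zero => simp
      | add v w _ _ hv hw => simpa only [inner_add_left] using hv.add hw
      | smul r v _ hv => simpa only [real_inner_smul_left] using hv.const_mul r
    intro v
    rw [Metric.tendsto_atTop]
    intro ε hε
    have hdense : v ∈ closure (Submodule.span ℝ (range h) : Set H) := by
      rw [← Submodule.topologicalClosure_coe, h.dense_span]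
      trivial
    set D : ℝ := R + ‖y‖ + 1 with hD
    have hD0 : 0 < D := by positivity
    obtain ⟨w, hw, hvw⟩ := Metric.mem_closure_iff.1 hdense (ε / (2 * D)) (by positivity)
    obtain ⟨N, hN⟩ := Metric.tendsto_atTop.1 (hspan w hw) (ε / 2) (by positivity)
    refine ⟨N, fun n hn => ?_⟩
    have h1 := hN n hn
    rw [Real.dist_eq, ← inner_sub_right] at h1 ⊢
    have h2 : inner ℝ v (x n - y) = inner ℝ (v - w) (x n - y) + inner ℝ w (x n - y) := by
      rw [← inner_add_left, sub_add_cancel]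
    have h3 : |inner ℝ (v - w) (x n - y)| ≤ ε / (2 * D) * D := by
      refine (abs_real_inner_le_norm _ _).trans ?_
      rw [dist_eq_norm] at hvw
      gcongr
      exact (norm_sub_le _ _).trans (by linarith [hx n])
    have h4 : ε / (2 * D) * D = ε / 2 := by field_simp
    rw [h2]
    calc _ ≤ |inner ℝ (v - w) (x n - y)| + |inner ℝ w (x n - y)| := abs_add_le _ _
      _ < ε := by linarith
  refine ⟨y, ?_, hlim⟩
  have h1 : ‖y‖ * ‖y‖ ≤ ‖y‖ * R := by
    rw [← real_inner_self_eq_norm_mul_norm]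
    exact le_of_tendsto (hlim y) (Eventually.of_forall fun n =>
      (real_inner_le_norm _ _).trans (by gcongr; exact hx n))
  rcases (norm_nonneg y).eq_or_lt with h0 | h0
  · rw [← h0]; exact hR
  · exact le_of_mul_le_mul_left h1 h0

/-- If a bounded operator maps an orthonormal basis to an orthogonal system, it is diagonal. -/
theorem HilbertBasis.inner_map_of_orthogonal {H K : Type*} [NormedAddCommGroup H]
    [InnerProductSpace ℝ H] [NormedAddCommGroup K] [InnerProductSpace ℝ K]
    (h : HilbertBasis ℕ ℝ H) {ι : H →L[ℝ] K}
    (ho : Pairwise fun i j => inner ℝ (ι (h i)) (ι (h j)) = 0) (j : ℕ) (u : H) :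
    inner ℝ (ι (h j)) (ι u) = ‖ι (h j)‖ ^ 2 * inner ℝ (h j) u := by
  have h1 : HasSum (fun i => inner ℝ (ι (h j)) (ι (h.repr u i • h i)))
      (inner ℝ (ι (h j)) (ι u)) := by
    have := (h.hasSum_repr u).mapL ((innerSL ℝ (ι (h j))).comp ι)
    simpa [real_inner_smul_right] using this
  have h2 : HasSum (fun i => inner ℝ (ι (h j)) (ι (h.repr u i • h i)))
      (inner ℝ (ι (h j)) (ι (h.repr u j • h j))) := by
    refine hasSum_single j fun i hi => ?_
    rw [map_smul, real_inner_smul_right, ho hi.symm, mul_zero]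
  rw [h1.unique h2, map_smul, real_inner_smul_right, real_inner_self_eq_norm_sq,
    h.repr_apply_apply]
  ring

variable {H K : Type*} [NormedAddCommGroup H] [InnerProductSpace ℝ H]
  [NormedAddCommGroup K] [InnerProductSpace ℝ K] {h : HilbertBasis ℕ ℝ H} {ι : H →L[ℝ] K}
  {ℓ : ℕ → ℝ → H →L[ℝ] ℝ} {Λ : ℝ → H → K} {M L C : ℝ} {f : ℕ → ℝ → ℝ} {a b : ℝ} {x : H}
  {ζ : ℝ → H}

/-- `ζ` solves the evolution equation with coordinates `ℓ`, initial value `x` and forcing `f` on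
`[a, b]`: it is continuous in `K`, and the integrated equation holds in each coordinate. No bound on
the norm of `ζ` in `H` is part of the definition. -/
structure IsCoordSolution (h : HilbertBasis ℕ ℝ H) (ι : H →L[ℝ] K) (ℓ : ℕ → ℝ → H →L[ℝ] ℝ)
    (f : ℕ → ℝ → ℝ) (a b : ℝ) (x : H) (ζ : ℝ → H) : Prop where
  cont : ContinuousOn (fun t => ι (ζ t)) (Icc a b)
  integrable : ∀ j, IntervalIntegrable (fun r => ℓ j r (ζ r)) volume a b
  eq : ∀ j, ∀ t ∈ Icc a b,
    inner ℝ (h j) (ζ t) = inner ℝ (h j) x + ∫ r in a..t, (ℓ j r (ζ r) + f j r)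

namespace IsDissipativeSystem

theorem inner_map_basis (hD : IsDissipativeSystem h ι ℓ Λ M L C) (j : ℕ) (u : H) :
    inner ℝ (ι (h j)) (ι u) = ‖ι (h j)‖ ^ 2 * inner ℝ (h j) u :=
  h.inner_map_of_orthogonal hD.orthogonal j u

theorem eq_zero_of_map_eq_zero (hD : IsDissipativeSystem h ι ℓ Λ M L C) {u : H} (hu : ι u = 0) :
    u = 0 := by
  refine h.repr.injective ?_
  ext j
  have h1 := hD.inner_map_basis j u
  rw [hu, inner_zero_right, eq_comm, mul_eq_zero] at h1
  have h2 : ‖ι (h j)‖ ^ 2 ≠ 0 := pow_ne_zero 2 (norm_ne_zero_iff.2 (hD.ne_zero j))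
  rw [h.repr_apply_apply, h1.resolve_left h2, map_zero]
  rfl

/-- The Galerkin approximations form a Cauchy sequence in `C([a, b], K)`; their limit is a solution,
with the energy bound in `H`. -/
theorem exists_isCoordSolution [CompleteSpace H] [CompleteSpace K]
    (hD : IsDissipativeSystem h ι ℓ Λ M L C) (hab : a ≤ b)
    (hf : ∀ j, IntervalIntegrable (f j) volume a b) {β : ℝ → ℝ}
    (hβ : IntervalIntegrable β volume a b)
    (hfβ : ∀ᵐ r ∂volume.restrict (Icc a b), ∀ s : Finset ℕ, ∑ j ∈ s, f j r ^ 2 ≤ β r) (x : H) :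
    ∃ ζ, IsCoordSolution h ι ℓ f a b x ζ ∧ ∀ t ∈ Icc a b, ‖ζ t‖ ^ 2
      ≤ (‖x‖ ^ 2 + ∫ r in a..b, β r) * Real.exp ((2 * C + 1) * (b - a)) := by
  choose z hz using fun d => exists_isGalerkin h hD.continuous_coord hab hf x d
  set B : ℝ := (‖x‖ ^ 2 + ∫ r in a..b, β r) * Real.exp ((2 * C + 1) * (b - a)) with hB
  have hC := hD.C_nonneg
  have hβ0 : 0 ≤ ∫ r in a..b, β r := by
    refine intervalIntegral.integral_nonneg_of_ae_restrict hab ?_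
    filter_upwards [hfβ] with r hr
    simpa using hr ∅
  have hxB : ‖x‖ ^ 2 ≤ B := by
    have h1 : 1 ≤ Real.exp ((2 * C + 1) * (b - a)) :=
      Real.one_le_exp (mul_nonneg (by positivity) (by linarith))
    nlinarith [sq_nonneg ‖x‖]
  set R : ℝ := Real.sqrt B with hR
  have hB0 : 0 ≤ B := (sq_nonneg _).trans hxB
  have hxR : ‖x‖ ≤ R := Real.le_sqrt_of_sq_le hxB
  have hzR : ∀ d, ∀ t ∈ Icc a b, ‖z d t‖ ≤ R := fun d t ht =>
    Real.le_sqrt_of_sq_le ((hz d).norm_sq_le hD hab hf hβ hfβ t ht)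
  set D : ℝ := (R ^ 2 + ∫ r in a..b, (4 * M * R * (1 + R) + 4 * R ^ 2 + β r))
    * Real.exp (2 * L * (b - a)) with hDdef
  have hclose : ∀ ε, 0 < ε → ε ≤ 1 → ∃ N, ∀ m ≥ N, ∀ n ≥ m, ∀ t ∈ Icc a b,
      ‖ι (z m t - z n t)‖ ^ 2 ≤ ε * D := by
    intro ε hε hε1
    obtain ⟨N, hN⟩ := eventually_atTop.1 (hD.tendsto_norm.eventually_lt_const hε)
    exact ⟨N, fun m hm n hn => (hz m).norm_map_sub_sq_le hD hab hf hβ hfβ hn (hz n) hxR (hzR m)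
      (hzR n) hε.le hε1 fun j hj => (hN j (hm.trans hj)).le⟩
  have hD0 : 0 ≤ D := by
    obtain ⟨N, hN⟩ := hclose 1 one_pos le_rfl
    have := hN N le_rfl N le_rfl a ⟨le_rfl, hab⟩
    rw [one_mul] at this
    exact (sq_nonneg _).trans this
  have hcauchy : UniformCauchySeqOn (fun n t => ι (z n t)) atTop (Icc a b) := by
    rw [Metric.uniformCauchySeqOn_iff]
    intro ε hε
    obtain ⟨N, hN⟩ := hclose (min 1 (ε ^ 2 / (2 * (D + 1)))) (by positivity) (min_le_left _ _)
    have hlt : ∀ m ≥ N, ∀ n ≥ m, ∀ t ∈ Icc a b, dist (ι (z m t)) (ι (z n t)) < ε := by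
      intro m hm n hn t ht
      rw [dist_eq_norm, ← map_sub]
      refine lt_of_pow_lt_pow_left₀ 2 hε.le ((hN m hm n hn t ht).trans_lt ?_)
      calc min 1 (ε ^ 2 / (2 * (D + 1))) * D ≤ ε ^ 2 / (2 * (D + 1)) * D := by
            gcongr
            exact min_le_right _ _
        _ < ε ^ 2 := by
            rw [div_mul_eq_mul_div, div_lt_iff₀ (by positivity)]
            nlinarith [pow_pos hε 2]
    refine ⟨N, fun m hm n hn t ht => ?_⟩
    rcases le_total m n with hmn | hmn
    · exact hlt m hm n hmn t ht
    · rw [dist_comm]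
      exact hlt n hn m hmn t ht
  have hpt : ∀ t, ∃ y, t ∈ Icc a b → ‖y‖ ≤ R ∧
      ∀ v, Tendsto (fun n => inner ℝ v (z n t)) atTop (𝓝 (inner ℝ v y)) := by
    intro t
    by_cases ht : t ∈ Icc a b
    · obtain ⟨y, hy⟩ := h.exists_weak_limit (x := fun n => z n t) (fun n => hzR n t ht) (by
        intro j
        have h1 : CauchySeq fun n => (‖ι (h j)‖ ^ 2)⁻¹ * inner ℝ (ι (h j)) (ι (z n t)) :=
          (((‖ι (h j)‖ ^ 2)⁻¹) • innerSL ℝ (ι (h j))).uniformContinuous.comp_cauchySeq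
            (hcauchy.cauchySeq ht)
        have h2 : ‖ι (h j)‖ ^ 2 ≠ 0 := pow_ne_zero 2 (norm_ne_zero_iff.2 (hD.ne_zero j))
        simpa only [hD.inner_map_basis, inv_mul_cancel_left₀ h2] using h1)
      exact ⟨y, fun _ => hy⟩
    · exact ⟨0, fun h => absurd h ht⟩
  choose ζ hζ using hpt
  have hfun : ∀ t ∈ Icc a b, ∀ φ : H →L[ℝ] ℝ, Tendsto (fun n => φ (z n t)) atTop (𝓝 (φ (ζ t))) := by
    intro t ht φ
    have := (hζ t ht).2 ((InnerProductSpace.toDual ℝ H).symm φ)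
    simpa only [InnerProductSpace.toDual_symm_apply] using this
  have hunif : TendstoUniformlyOn (fun n t => ι (z n t)) (fun t => ι (ζ t)) atTop (Icc a b) := by
    refine hcauchy.tendstoUniformlyOn_of_tendsto fun t ht => ?_
    obtain ⟨k, hk⟩ := cauchySeq_tendsto_of_complete (hcauchy.cauchySeq ht)
    -- the strong limit in `K` is the image of the weak limit in `H`
    convert hk using 2
    refine ext_inner_left ℝ fun v => ?_
    exact tendsto_nhds_unique (hfun t ht ((innerSL ℝ v).comp ι)) 
      (((innerSL ℝ v).continuous.tendsto k).comp hk)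
  have hmeas : ∀ j, AEStronglyMeasurable (fun r => ℓ j r (ζ r)) (volume.restrict (Icc a b)) :=
    fun j => aestronglyMeasurable_of_tendsto_ae atTop
      (fun n => ((hD.continuous_coord j).clm_apply (hz n).cont).aestronglyMeasurable)
      (by
        filter_upwards [ae_restrict_mem measurableSet_Icc] with r hr
        exact hfun r hr (ℓ j r))
  have hbd : ∀ j, ∃ E, 0 ≤ E ∧ ∀ t ∈ Icc a b, ∀ y : H, ‖y‖ ≤ R → ‖ℓ j t y‖ ≤ E := by
    intro j
    obtain ⟨E, hE⟩ := isCompact_Icc.exists_bound_of_continuousOn (s := Icc a b)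
      (hD.continuous_coord j).continuousOn
    have hR0 : 0 ≤ R := Real.sqrt_nonneg _
    have hE0 : 0 ≤ E := (norm_nonneg _).trans (hE a ⟨le_rfl, hab⟩)
    refine ⟨E * R, by positivity, fun t ht y hy => ((ℓ j t).le_opNorm y).trans ?_⟩
    gcongr
    exact hE t ht
  refine ⟨ζ, ⟨hunif.continuousOn (Frequently.of_forall fun n =>
    (ι.continuous.comp (hz n).cont).continuousOn), fun j => ?_, fun j t ht => ?_⟩, fun t ht => ?_⟩
  · obtain ⟨E, hE0, hE⟩ := hbd j
    rw [intervalIntegrable_iff_integrableOn_Icc_of_le hab]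
    refine Integrable.mono' (integrable_const E) (hmeas j) ?_
    filter_upwards [ae_restrict_mem measurableSet_Icc] with r hr
    exact hE r hr _ (hζ r hr).1
  · obtain ⟨E, hE0, hE⟩ := hbd j
    have hsub : uIoc a t ⊆ Icc a b := by
      rw [uIoc_of_le ht.1]
      exact fun r hr => ⟨hr.1.le, hr.2.trans ht.2⟩
    have hft : IntervalIntegrable (f j) volume a t := (hf j).mono_set (by
      rw [uIcc_of_le hab, uIcc_of_le ht.1]
      exact Icc_subset_Icc_right ht.2)
    have h1 : Tendsto (fun n => ∫ r in a..t, (ℓ j r (z n r) + f j r)) atTop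
        (𝓝 (∫ r in a..t, (ℓ j r (ζ r) + f j r))) := by
      refine intervalIntegral.tendsto_integral_filter_of_dominated_convergence
        (fun r => E + ‖f j r‖) (Eventually.of_forall fun n => ?_) (Eventually.of_forall fun n => ?_)
        (intervalIntegrable_const.add hft.norm) ?_
      · exact ((hD.continuous_coord j).clm_apply (hz n).cont).aestronglyMeasurable.add
          (by
            rw [uIoc_of_le ht.1]
            exact hft.1.aestronglyMeasurable)
      · refine Eventually.of_forall fun r hr => (norm_add_le _ _).trans ?_
        gcongr
        exact hE r (hsub hr) _ (hzR n r (hsub hr))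
      · exact Eventually.of_forall fun r hr => (hfun r (hsub hr) (ℓ j r)).add_const _
    refine tendsto_nhds_unique ((hζ t ht).2 (h j)) ((h1.const_add _).congr' ?_)
    filter_upwards [eventually_gt_atTop j] with n hn
    exact ((hz n).eq j hn t ht).symm
  · have := pow_le_pow_left₀ (norm_nonneg _) (hζ t ht).1 2
    rwa [hR, Real.sq_sqrt hB0] at this

end IsDissipativeSystem

end Existence

/-! ### Uniqueness of solutions -/

section Uniqueness

variable {H K : Type*} [NormedAddCommGroup H] [InnerProductSpace ℝ H]
  [NormedAddCommGroup K] [InnerProductSpace ℝ K] {h : HilbertBasis ℕ ℝ H} {ι : H →L[ℝ] K}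
  {ℓ : ℕ → ℝ → H →L[ℝ] ℝ} {Λ : ℝ → H → K} {M L C : ℝ} {f : ℕ → ℝ → ℝ} {a b : ℝ} {x : H}
  {ζ : ℝ → H}

theorem HilbertBasis.ext_inner {H : Type*} [NormedAddCommGroup H] [InnerProductSpace ℝ H]
    (h : HilbertBasis ℕ ℝ H) {u v : H} (huv : ∀ j, inner ℝ (h j) u = inner ℝ (h j) v) : u = v := by
  refine h.repr.injective ?_
  ext j
  rw [h.repr_apply_apply, h.repr_apply_apply, huv]

namespace IsCoordSolution

theorem left_eq (hζ : IsCoordSolution h ι ℓ f a b x ζ) (hab : a ≤ b) : ζ a = x :=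
  h.ext_inner fun j => by
    rw [hζ.eq j a ⟨le_rfl, hab⟩, intervalIntegral.integral_same, add_zero]

theorem mono (hζ : IsCoordSolution h ι ℓ f a b x ζ)
    (hf : ∀ j, IntervalIntegrable (f j) volume a b) {s t : ℝ} (has : a ≤ s) (hst : s ≤ t)
    (htb : t ≤ b) : IsCoordSolution h ι ℓ f s t (ζ s) ζ := by
  have hsub : uIcc s t ⊆ uIcc a b := by
    rw [uIcc_of_le hst, uIcc_of_le (has.trans (hst.trans htb))]
    exact Icc_subset_Icc has htb
  refine ⟨hζ.cont.mono (Icc_subset_Icc has htb), fun j => (hζ.integrable j).mono_set hsub,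
    fun j r hr => ?_⟩
  have hint : IntervalIntegrable (fun r => ℓ j r (ζ r) + f j r) volume a b :=
    (hζ.integrable j).add (hf j)
  have hr' : r ∈ Icc a b := ⟨has.trans hr.1, hr.2.trans htb⟩
  have hs' : s ∈ Icc a b := ⟨has, hst.trans htb⟩
  have hI : ∀ u ∈ Icc a b, ∀ v ∈ Icc a b,
      IntervalIntegrable (fun r => ℓ j r (ζ r) + f j r) volume u v := fun u hu v hv =>
    hint.mono_set (by
      rw [uIcc_of_le (hu.1.trans hu.2)]
      exact uIcc_subset_Icc hu hv)
  have ha' : a ∈ Icc a b := ⟨le_rfl, hr'.1.trans hr'.2⟩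
  rw [hζ.eq j r hr', hζ.eq j s hs', add_assoc,
    intervalIntegral.integral_add_adjacent_intervals (hI a ha' s hs') (hI s hs' r hr')]

theorem sub {x' : H} {ζ' : ℝ → H} (hζ : IsCoordSolution h ι ℓ f a b x ζ)
    (hζ' : IsCoordSolution h ι ℓ f a b x' ζ')
    (hf : ∀ j, IntervalIntegrable (f j) volume a b) :
    IsCoordSolution h ι ℓ (fun _ _ => 0) a b (x - x') fun t => ζ t - ζ' t := by
  refine ⟨?_, fun j => ?_, fun j t ht => ?_⟩
  · simp only [map_sub]
    exact hζ.cont.sub hζ'.cont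
  · simpa only [map_sub] using (hζ.integrable j).sub (hζ'.integrable j)
  · have hsub : uIcc a t ⊆ uIcc a b := by
      rw [uIcc_of_le ht.1, uIcc_of_le (ht.1.trans ht.2)]
      exact Icc_subset_Icc_right ht.2
    simp only [inner_sub_right]
    rw [hζ.eq j t ht, hζ'.eq j t ht, add_sub_add_comm,
      ← intervalIntegral.integral_sub (((hζ.integrable j).add (hf j)).mono_set hsub)
        (((hζ'.integrable j).add (hf j)).mono_set hsub)]
    congr 1
    exact intervalIntegral.integral_congr fun r _ => by simp

theorem continuousOn_inner (hζ : IsCoordSolution h ι ℓ f a b x ζ)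
    (hD : IsDissipativeSystem h ι ℓ Λ M L C) (j : ℕ) :
    ContinuousOn (fun t => inner ℝ (h j) (ζ t)) (Icc a b) := by
  have h2 : ‖ι (h j)‖ ^ 2 ≠ 0 := pow_ne_zero 2 (norm_ne_zero_iff.2 (hD.ne_zero j))
  have h1 : ContinuousOn (fun t => (‖ι (h j)‖ ^ 2)⁻¹ * inner ℝ (ι (h j)) (ι (ζ t))) (Icc a b) :=
    continuousOn_const.mul ((innerSL ℝ (ι (h j))).continuous.comp_continuousOn hζ.cont)
  simpa only [hD.inner_map_basis, inv_mul_cancel_left₀ h2] using h1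

/-- Energy estimate in `K` for solutions that are bounded in `H`. -/
theorem norm_map_sq_le (hζ : IsCoordSolution h ι ℓ (fun _ _ => 0) a b x ζ)
    (hD : IsDissipativeSystem h ι ℓ Λ M L C) {R : ℝ} (hR : ∀ t ∈ Icc a b, ‖ζ t‖ ≤ R) :
    ∀ t ∈ Icc a b, ‖ι (ζ t)‖ ^ 2 ≤ ‖ι x‖ ^ 2 * Real.exp (2 * L * (t - a)) := by
  intro t ht
  have hab : a ≤ b := ht.1.trans ht.2
  have hM := hD.M_nonneg
  have hL := hD.L_nonneg
  have hR0 : 0 ≤ R := (norm_nonneg _).trans (hR t ht)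
  have hxa := hζ.left_eq hab
  have hycont : ContinuousOn (fun t => ‖ι (ζ t)‖ ^ 2) (Icc a b) := hζ.cont.norm.pow 2
  refine le_mul_exp_of_le_add_mul_integral (y := fun t => ‖ι (ζ t)‖ ^ 2) (b := b)
    (by positivity) hycont (fun t ht => ?_) t ht
  have hsub : uIcc a t ⊆ uIcc a b := by
    rw [uIcc_of_le ht.1, uIcc_of_le hab]
    exact Icc_subset_Icc_right ht.2
  have hsq := fun j => sq_eq_add_integral_of_eq_add_integral (u := fun r => inner ℝ (h j) (ζ r))
    hab (hζ.integrable j) fun t ht => by simpa [hxa] using hζ.eq j t ht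
  have hP : ∀ u : H, Tendsto (fun d => ∑ j ∈ Finset.range d, inner ℝ (h j) u • h j) atTop
      (𝓝 u) := fun u => by
    have := (h.hasSum_repr u).tendsto_sum_nat
    simpa only [h.repr_apply_apply] using this
  have hPle : ∀ u : H, ∀ d, ‖∑ j ∈ Finset.range d, inner ℝ (h j) u • h j‖ ≤ ‖u‖ := fun u d =>
    le_of_sq_le_sq (by rw [h.norm_sum_smul_sq]; exact h.sum_sq_le _ _) (norm_nonneg _)
  let F : ℕ → ℝ → ℝ := fun d r =>
    2 * inner ℝ (ι (∑ j ∈ Finset.range d, inner ℝ (h j) (ζ r) • h j)) (Λ r (ζ r))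
  have hF : ∀ d, F d = fun r => ∑ j ∈ Finset.range d,
      ‖ι (h j)‖ ^ 2 * (2 * inner ℝ (h j) (ζ r) * ℓ j r (ζ r)) := fun d => by
    funext r
    simp only [F]
    rw [hD.inner_map_sum _ fun j => inner ℝ (h j) (ζ r), Finset.mul_sum]
    exact Finset.sum_congr rfl fun j _ => by ring
  have hFint : ∀ d, IntervalIntegrable (F d) volume a t := fun d => by
    rw [hF]
    simpa only [Finset.sum_fn] using IntervalIntegrable.sum (Finset.range d)
      fun j _ => ((hsq j).2.1.const_mul (‖ι (h j)‖ ^ 2)).mono_set hsub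
  have hFlim : ∀ r, Tendsto (fun d => F d r) atTop (𝓝 (2 * inner ℝ (ι (ζ r)) (Λ r (ζ r)))) :=
    fun r => ((((innerSL ℝ (Λ r (ζ r))).comp ι).continuous.tendsto _).comp
      (hP (ζ r))).const_mul 2 |>.congr (fun d => by
        simp only [F, Function.comp_apply, ContinuousLinearMap.comp_apply, innerSL_apply_apply]
        rw [real_inner_comm])
      |> fun h => by
        simp only [ContinuousLinearMap.comp_apply, innerSL_apply_apply] at h
        rwa [real_inner_comm] at h
  have hbound : ∀ u : H, ‖u‖ ≤ R → ∀ r ∈ uIoc a t,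
      ‖2 * inner ℝ (ι u) (Λ r (ζ r))‖ ≤ 2 * (‖ι‖ * R * (M * (1 + R))) := by
    intro u hu r hr
    rw [uIoc_of_le ht.1] at hr
    have hr' : r ∈ Icc a b := ⟨hr.1.le, hr.2.trans ht.2⟩
    rw [norm_mul, Real.norm_of_nonneg zero_le_two]
    refine mul_le_mul_of_nonneg_left ((norm_inner_le_norm _ _).trans ?_) zero_le_two
    gcongr
    · exact (ι.le_opNorm u).trans (by gcongr)
    · refine (hD.growth _ _).trans ?_
      gcongr
      exact hR r hr'
  have hζR : ∀ r ∈ uIoc a t, ‖ζ r‖ ≤ R := fun r hr => by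
    rw [uIoc_of_le ht.1] at hr
    exact hR r ⟨hr.1.le, hr.2.trans ht.2⟩
  have hS : ∀ d, ‖ι (∑ j ∈ Finset.range d, inner ℝ (h j) (ζ t) • h j)‖ ^ 2
      = ‖ι (∑ j ∈ Finset.range d, inner ℝ (h j) x • h j)‖ ^ 2 + ∫ r in a..t, F d r := by
    intro d
    rw [hD.norm_map_sum_sq _ fun j => inner ℝ (h j) (ζ t),
      hD.norm_map_sum_sq _ fun j => inner ℝ (h j) x, hF,
      intervalIntegral.integral_finsetSum
        fun j _ => ((hsq j).2.1.const_mul (‖ι (h j)‖ ^ 2)).mono_set hsub,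
      ← Finset.sum_add_distrib]
    refine Finset.sum_congr rfl fun j _ => ?_
    rw [(hsq j).2.2 t ht, intervalIntegral.integral_const_mul, hxa, mul_add]
  have hIlim : Tendsto (fun d => ∫ r in a..t, F d r) atTop
      (𝓝 (∫ r in a..t, 2 * inner ℝ (ι (ζ r)) (Λ r (ζ r)))) := by
    refine intervalIntegral.tendsto_integral_filter_of_dominated_convergence
      (fun _ => 2 * (‖ι‖ * R * (M * (1 + R))))
      (Eventually.of_forall fun d => ?_) (Eventually.of_forall fun d => ?_)
      intervalIntegrable_const (Eventually.of_forall fun r _ => hFlim r)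
    · rw [uIoc_of_le ht.1]
      exact (hFint d).1.aestronglyMeasurable
    · exact Eventually.of_forall fun r hr => hbound _ ((hPle _ _).trans (hζR r hr)) r hr
  have heq : ‖ι (ζ t)‖ ^ 2 = ‖ι x‖ ^ 2 + ∫ r in a..t, 2 * inner ℝ (ι (ζ r)) (Λ r (ζ r)) := by
    have hn : ∀ u : H, Tendsto (fun d => ‖ι (∑ j ∈ Finset.range d, inner ℝ (h j) u • h j)‖ ^ 2)
        atTop (𝓝 (‖ι u‖ ^ 2)) := fun u =>
      (((ι.continuous.tendsto u).comp (hP u)).norm).pow 2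
    refine tendsto_nhds_unique (hn (ζ t)) ?_
    simp only [hS]
    exact (hn x).add hIlim
  have hint : IntervalIntegrable (fun r => 2 * inner ℝ (ι (ζ r)) (Λ r (ζ r))) volume a t := by
    rw [intervalIntegrable_iff]
    refine Integrable.mono' (g := fun _ => 2 * (‖ι‖ * R * (M * (1 + R))))
      (integrableOn_const (by simp)) (aestronglyMeasurable_of_tendsto_ae atTop (f := F)
        (fun d => (intervalIntegrable_iff.1 (hFint d)).aestronglyMeasurable)
        (Eventually.of_forall hFlim)) ?_
    filter_upwards [ae_restrict_mem measurableSet_uIoc] with r hr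
    exact hbound _ (hζR r hr) r hr
  have hyint : IntervalIntegrable (fun r => ‖ι (ζ r)‖ ^ 2) volume a t :=
    ContinuousOn.intervalIntegrable (by
      rw [uIcc_of_le ht.1]
      exact hycont.mono (Icc_subset_Icc_right ht.2))
  rw [heq, ← intervalIntegral.integral_const_mul]
  refine add_le_add_right (intervalIntegral.integral_mono_on ht.1 hint (hyint.const_mul _)
    fun r _ => ?_) _
  have := hD.dissipative r (ζ r)
  linarith

variable [CompleteSpace H] [CompleteSpace K]

/-- If a solution is bounded in `H` on each `[s', t]` with `s < s'`, then on `[s, t]` it is the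
solution constructed from its value at `s`, and so obeys the energy bound in `H` from `s` on. -/
theorem norm_le_of_bounded_of_lt (hζ : IsCoordSolution h ι ℓ (fun _ _ => 0) a b x ζ)
    (hD : IsDissipativeSystem h ι ℓ Λ M L C) {s t : ℝ} (has : a ≤ s) (hst : s ≤ t) (htb : t ≤ b)
    (hbdd : ∀ s', s < s' → ∃ R, ∀ r ∈ Icc s' t, ‖ζ r‖ ≤ R) :
    ‖ζ t‖ ≤ ‖ζ s‖ * Real.exp ((2 * C + 1) * (b - a)) := by
  have h0 : ∀ u v : ℝ, ∀ j : ℕ,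
      IntervalIntegrable ((fun (_ : ℕ) (_ : ℝ) => (0 : ℝ)) j) volume u v :=
    fun _ _ _ => intervalIntegrable_const
  obtain ⟨ξ, hξ, hξb⟩ := hD.exists_isCoordSolution (f := fun _ _ => 0) hst (h0 s t)
    (β := fun _ => 0) intervalIntegrable_const (Eventually.of_forall fun _ _ => by simp) (ζ s)
  have hs := hζ.mono (h0 a b) has hst htb
  have hv := hs.sub hξ (h0 s t)
  rw [sub_self] at hv
  set v : ℝ → H := fun r => ζ r - ξ r with hvdef
  have hC := hD.C_nonneg
  -- the energy estimate in `K` holds on `[s', t]`; let `s'` decrease to `s`, where `ι ∘ v` is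
  -- continuous and vanishes
  have hvt : ι (v t) = 0 := by
    rcases hst.eq_or_lt with rfl | hlt
    · rw [hv.left_eq le_rfl, map_zero]
    set B : ℝ := ‖ζ s‖ ^ 2 * Real.exp ((2 * C + 1) * (t - s)) with hB
    have hle : ∀ s' ∈ Ioo s t,
        ‖ι (v t)‖ ^ 2 ≤ ‖ι (v s')‖ ^ 2 * Real.exp (2 * L * (t - s')) := by
      intro s' hs'
      obtain ⟨R, hR⟩ := hbdd s' hs'.1
      refine (hv.mono (h0 s t) hs'.1.le hs'.2.le le_rfl).norm_map_sq_le hD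
        (R := R + Real.sqrt B) (fun r hr => (norm_sub_le _ _).trans (add_le_add (hR r hr) ?_)) t
        ⟨hs'.2.le, le_rfl⟩
      refine Real.le_sqrt_of_sq_le ?_
      have := hξb r ⟨hs'.1.le.trans hr.1, hr.2⟩
      rwa [intervalIntegral.integral_zero, add_zero] at this
    have hlim : Tendsto (fun s' => ‖ι (v s')‖ ^ 2 * Real.exp (2 * L * (t - s'))) (𝓝[Ioo s t] s)
        (𝓝 (‖ι (v s)‖ ^ 2 * Real.exp (2 * L * (t - s)))) := by
      have h1 : Tendsto (fun s' => ι (v s')) (𝓝[Ioo s t] s) (𝓝 (ι (v s))) :=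
        (hv.cont s ⟨le_rfl, hst⟩).mono_left (nhdsWithin_mono _ Ioo_subset_Icc_self)
      have h2 : Continuous fun s' : ℝ => Real.exp (2 * L * (t - s')) := by fun_prop
      exact (h1.norm.pow 2).mul ((h2.tendsto s).mono_left nhdsWithin_le_nhds)
    have hne : (𝓝[Ioo s t] s).NeBot := left_nhdsWithin_Ioo_neBot hlt
    have := ge_of_tendsto hlim (by
      filter_upwards [self_mem_nhdsWithin] with s' hs'
      exact hle s' hs')
    rw [hv.left_eq hst, map_zero, norm_zero, zero_pow two_ne_zero, zero_mul] at this
    exact norm_eq_zero.1 (pow_eq_zero_iff two_ne_zero |>.1 (le_antisymm this (sq_nonneg _)))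
  have heq : ζ t = ξ t := sub_eq_zero.1 (hD.eq_zero_of_map_eq_zero hvt)
  have h1 := hξb t ⟨hst, le_rfl⟩
  rw [intervalIntegral.integral_zero, add_zero, ← heq] at h1
  refine le_of_sq_le_sq (h1.trans ?_) (by positivity)
  rw [mul_pow, ← Real.exp_nat_mul]
  refine mul_le_mul_of_nonneg_left (Real.exp_le_exp.2 ?_) (sq_nonneg _)
  have : (2 * C + 1) * (t - s) ≤ (2 * C + 1) * (b - a) := by gcongr
  have h2 : 0 ≤ (2 * C + 1) * (t - s) := mul_nonneg (by positivity) (by linarith)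
  push_cast
  linarith

/-- A solution is automatically bounded in `H`. The points near which it is unbounded form a closed
set; by Baire's theorem the solution is bounded on a nonempty relatively open part of this set, and
the gaps are controlled by restarting the equation at their left end points. -/
theorem exists_norm_le (hζ : IsCoordSolution h ι ℓ (fun _ _ => 0) a b x ζ)
    (hD : IsDissipativeSystem h ι ℓ Λ M L C) : ∃ R, ∀ t ∈ Icc a b, ‖ζ t‖ ≤ R := by
  let Good : ℝ → Prop := fun t => ∃ U ∈ 𝓝 t, ∃ R, ∀ r ∈ U ∩ Icc a b, ‖ζ r‖ ≤ R
  have hcompact : ∀ S : Set ℝ, IsCompact S → (∀ t ∈ S, Good t) →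
      ∃ R, ∀ r ∈ S ∩ Icc a b, ‖ζ r‖ ≤ R := by
    intro S hS hgood
    refine hS.induction_on (p := fun S => ∃ R, ∀ r ∈ S ∩ Icc a b, ‖ζ r‖ ≤ R)
      ⟨0, fun r hr => absurd hr.1 (notMem_empty r)⟩ ?_ ?_ fun t ht => ?_
    · rintro S T hST ⟨R, hR⟩
      exact ⟨R, fun r hr => hR r ⟨hST hr.1, hr.2⟩⟩
    · rintro S T ⟨R, hR⟩ ⟨R', hR'⟩
      refine ⟨max R R', fun r hr => ?_⟩
      rcases hr.1 with h1 | h1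
      · exact (hR r ⟨h1, hr.2⟩).trans (le_max_left _ _)
      · exact (hR' r ⟨h1, hr.2⟩).trans (le_max_right _ _)
    · obtain ⟨U, hU, hR⟩ := hgood t ht
      exact ⟨U, mem_nhdsWithin_of_mem_nhds hU, hR⟩
  suffices hall : ∀ t ∈ Icc a b, Good t by
    obtain ⟨R, hR⟩ := hcompact (Icc a b) isCompact_Icc hall
    exact ⟨R, fun t ht => hR t ⟨ht, ht⟩⟩
  by_contra! hbad
  set F : Set ℝ := {t | t ∈ Icc a b ∧ ¬ Good t} with hF
  have hFclosed : IsClosed F := by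
    refine isClosed_Icc.inter (isOpen_compl_iff.1 ?_)
    rw [isOpen_iff_mem_nhds]
    intro t ht
    obtain ⟨U, hU, R, hR⟩ := not_not.1 ht
    obtain ⟨V, hVU, hV, htV⟩ := mem_nhds_iff.1 hU
    refine mem_nhds_iff.2 ⟨V, fun s hs => not_not.2 ?_, hV, htV⟩
    exact ⟨V, hV.mem_nhds hs, R, fun r hr => hR r ⟨hVU hr.1, hr.2⟩⟩
  have hFne : Nonempty F := by
    obtain ⟨t, ht, htb⟩ := hbad
    exact ⟨⟨t, ht, htb⟩⟩
  have hFcomplete : CompleteSpace F := hFclosed.completeSpace_coe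
  -- the sublevel sets of the norm are closed because the norm is a supremum of finite sums of
  -- squares of continuous coordinates
  have hclosed : ∀ n : ℕ, IsClosed {t : F | ‖ζ t‖ ≤ n} := by
    intro n
    have hset : {t : F | ‖ζ t‖ ≤ n} = ⋂ d : ℕ,
        {t : F | ∑ j ∈ Finset.range d, inner ℝ (h j) (ζ t) ^ 2 ≤ (n : ℝ) ^ 2} := by
      ext t
      simp only [mem_ofPred_eq, mem_iInter]
      refine ⟨fun ht d => (h.sum_sq_le _ _).trans (pow_le_pow_left₀ (norm_nonneg _) ht 2),
        fun ht => ?_⟩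
      refine le_of_sq_le_sq ?_ (Nat.cast_nonneg n)
      have hP : Tendsto (fun d => ∑ j ∈ Finset.range d, inner ℝ (h j) (ζ t) • h j) atTop
          (𝓝 (ζ t)) := by
        have := (h.hasSum_repr (ζ t)).tendsto_sum_nat
        simpa only [h.repr_apply_apply] using this
      refine le_of_tendsto (hP.norm.pow 2) (Eventually.of_forall fun d => ?_)
      rw [h.norm_sum_smul_sq]
      exact ht d
    rw [hset]
    refine isClosed_iInter fun d => isClosed_le ?_ continuous_const
    refine continuous_finsetSum _ fun j _ => ?_
    exact ((hζ.continuousOn_inner hD j).comp_continuous continuous_subtype_val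
      fun t => t.2.1).pow 2
  obtain ⟨n, g, hg⟩ := nonempty_interior_of_iUnion_of_closed hclosed (by
    refine eq_univ_of_forall fun t => mem_iUnion.2 ?_
    exact exists_nat_ge ‖ζ t‖)
  obtain ⟨ε, hε, hball⟩ := Metric.mem_nhds_iff.1 (mem_interior_iff_mem_nhds.1 hg)
  have hFn : ∀ r ∈ F, |r - g| < ε → ‖ζ r‖ ≤ n := fun r hr hrg =>
    hball (show (⟨r, hr⟩ : F) ∈ Metric.ball g ε from hrg)
  refine g.2.2 ⟨Metric.ball g (ε / 2), Metric.ball_mem_nhds _ (by positivity),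
    max (n : ℝ) ‖ζ (max a (g - ε / 2))‖ * Real.exp ((2 * C + 1) * (b - a)), fun r hr => ?_⟩
  set c : ℝ := max a (g - ε / 2) with hc
  have hrg : |r - g| < ε / 2 := hr.1
  rw [abs_lt] at hrg
  have hcr : c ≤ r := max_le hr.2.1 (by linarith)
  -- `s` is the last point before `r` at which a bound is known
  obtain ⟨s, ⟨hsI, hsF⟩, hsmax⟩ := ((isCompact_Icc (a := c) (b := r)).inter_right
    (hFclosed.union (isClosed_singleton (x := c)))).exists_isGreatest
    ⟨c, ⟨le_rfl, hcr⟩, Or.inr rfl⟩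
  have hac : a ≤ c := le_max_left _ _
  have hgc : g - ε / 2 ≤ c := le_max_right _ _
  have hsn : ‖ζ s‖ ≤ max (n : ℝ) ‖ζ c‖ := by
    rcases hsF with hsF | hsF
    · refine (hFn s hsF ?_).trans (le_max_left _ _)
      rw [abs_lt]
      constructor <;> linarith [hsI.1, hsI.2, hrg.1, hrg.2]
    · rw [mem_singleton_iff.1 hsF]
      exact le_max_right _ _
  refine (hζ.norm_le_of_bounded_of_lt hD (hac.trans hsI.1) hsI.2 hr.2.2 fun s' hs' => ?_).trans ?_
  · obtain ⟨R, hR⟩ := hcompact (Icc s' r) isCompact_Icc (by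
      intro t ht
      have htI : t ∈ Icc a b := ⟨(hac.trans hsI.1).trans (hs'.le.trans ht.1), ht.2.trans hr.2.2⟩
      by_contra hgt
      have := hsmax ⟨⟨hsI.1.trans (hs'.le.trans ht.1), ht.2⟩, Or.inl ⟨htI, hgt⟩⟩
      linarith [ht.1])
    exact ⟨R, fun t ht => hR t
      ⟨ht, (hac.trans hsI.1).trans (hs'.le.trans ht.1), ht.2.trans hr.2.2⟩⟩
  · gcongr

/-- Solutions are unique. -/
theorem eqOn {ζ' : ℝ → H} (hζ : IsCoordSolution h ι ℓ f a b x ζ)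
    (hζ' : IsCoordSolution h ι ℓ f a b x ζ') (hD : IsDissipativeSystem h ι ℓ Λ M L C)
    (hf : ∀ j, IntervalIntegrable (f j) volume a b) : EqOn ζ ζ' (Icc a b) := by
  intro t ht
  have hv := hζ.sub hζ' hf
  rw [sub_self] at hv
  obtain ⟨R, hR⟩ := hv.exists_norm_le hD
  have h1 := hv.norm_map_sq_le hD hR t ht
  rw [map_zero, norm_zero, zero_pow two_ne_zero, zero_mul] at h1
  have h2 := norm_eq_zero.1 (pow_eq_zero_iff two_ne_zero |>.1 (le_antisymm h1 (sq_nonneg _)))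
  exact sub_eq_zero.1 (hD.eq_zero_of_map_eq_zero h2)

end IsCoordSolution

end Uniqueness

/-! ### Orthogonal coordinates in the spaces `Φ₋ₙ` -/

/-- The image of an orthonormal basis under a Hilbert-Schmidt operator is square summable; this is
shown for the case that the image is orthogonal. -/
theorem IsHilbertSchmidt.summable_of_orthogonal {H K : Type*} [NormedAddCommGroup H]
    [InnerProductSpace ℝ H] [NormedAddCommGroup K] [InnerProductSpace ℝ K] {ι : H →L[ℝ] K}
    (hι : IsHilbertSchmidt ι) (h : HilbertBasis ℕ ℝ H)
    (ho : Pairwise fun i j => inner ℝ (ι (h i)) (ι (h j)) = 0) :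
    Summable fun j => ‖ι (h j)‖ ^ 2 := by
  obtain ⟨w, c, hc⟩ := hι
  refine summable_of_sum_le (c := ∑' i, ‖ι (c i)‖ ^ 2) (fun j => sq_nonneg _) fun s => ?_
  have hpars : ∀ u : H, ∑ j ∈ s, ‖ι (h j)‖ ^ 2 * inner ℝ (h j) u ^ 2 ≤ ‖ι u‖ ^ 2 := by
    intro u
    have h1 : HasSum (fun j => inner ℝ (ι u) (ι (h.repr u j • h j))) (inner ℝ (ι u) (ι u)) := by
      have := (h.hasSum_repr u).mapL ((innerSL ℝ (ι u)).comp ι)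
      simpa [real_inner_smul_right] using this
    have h2 : ∀ j, inner ℝ (ι u) (ι (h.repr u j • h j))
        = ‖ι (h j)‖ ^ 2 * inner ℝ (h j) u ^ 2 := fun j => by
      rw [map_smul, real_inner_smul_right, real_inner_comm, h.inner_map_of_orthogonal ho,
        h.repr_apply_apply]
      ring
    simp only [h2] at h1
    rw [real_inner_self_eq_norm_sq] at h1
    exact sum_le_hasSum s (fun j _ => by positivity) h1
  have hone : ∀ j, HasSum (fun i => inner ℝ (h j) (c i) ^ 2) 1 := fun j => by
    have := c.hasSum_inner_mul_inner (h j) (h j)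
    rw [real_inner_self_eq_norm_sq, h.orthonormal.1 j, one_pow] at this
    refine this.congr_fun fun i => ?_
    rw [real_inner_comm (h j) (c i), pow_two]
  have hs : HasSum (fun i => ∑ j ∈ s, ‖ι (h j)‖ ^ 2 * inner ℝ (h j) (c i) ^ 2)
      (∑ j ∈ s, ‖ι (h j)‖ ^ 2) := by
    have := hasSum_sum fun j (_ : j ∈ s) => (hone j).mul_left (‖ι (h j)‖ ^ 2)
    simpa only [mul_one] using this
  exact hasSum_le (fun i => hpars (c i)) hs hc.hasSum

namespace CountablyHilbertian

variable {Φ : Type*} [AddCommGroup Φ] [Module ℝ Φ] [UniformSpace Φ] (S : CountablyHilbertian Φ)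
  {e : ℕ → Φ}

theorem emb_add (n : ℕ) (u v : S.Neg n) (φ : Φ) : S.emb n (u + v) φ = S.emb n u φ + S.emb n v φ :=
  rfl

theorem emb_smul (n : ℕ) (r : ℝ) (u : S.Neg n) (φ : Φ) : S.emb n (r • u) φ = r * S.emb n u φ :=
  rfl

theorem abs_emb_le (n : ℕ) (u : S.Neg n) (φ : Φ) : |S.emb n u φ| ≤ ‖u‖ * ‖S.toPos n φ‖ :=
  (S.negEquiv n u).le_opNorm (S.toPos n φ)

theorem emb_lift {n : ℕ} {u : StrongDual ℝ Φ} (hu : S.MemNeg n u) : S.emb n (S.lift n u) = u := by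
  obtain ⟨w, rfl⟩ := hu
  rw [lift_emb]

theorem negIncl_toNeg {n m : ℕ} (h : n ≤ m) (φ : Φ) :
    S.negIncl h (S.toNeg n φ) = S.toNeg m φ := by
  apply S.emb_injective m
  ext χ
  rw [emb_negIncl, emb_toNeg, emb_toNeg]

theorem negIncl_injective {n m : ℕ} (h : n ≤ m) : Function.Injective (S.negIncl h) := by
  intro u v huv
  apply S.emb_injective n
  rw [← S.emb_negIncl h, huv, S.emb_negIncl h]

/-- Linearity of `toNeg` in the form of a bundled map. -/
def toNegₗ (n : ℕ) : Φ →ₗ[ℝ] S.Neg n where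
  toFun := S.toNeg n
  map_add' φ χ := by
    apply S.emb_injective n
    ext ξ
    rw [emb_add]
    simp only [emb_toNeg, map_add, inner_add_left]
  map_smul' r φ := by
    apply S.emb_injective n
    ext ξ
    rw [RingHom.id_apply, emb_smul]
    simp only [emb_toNeg, map_smul, real_inner_smul_left]

theorem inner_eq_emb {n : ℕ} {u : S.Neg n} {χ : Φ} (h : S.theta n u = S.toPos n χ) (v : S.Neg n) :
    inner ℝ u v = S.emb n v χ := by
  change inner ℝ (S.theta n u) (S.theta n v) = S.negEquiv n v (S.toPos n χ)
  rw [← h, real_inner_comm]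
  exact InnerProductSpace.toDual_symm_apply

theorem norm_toPos_ne_zero (he : S.IsBasis e) (n j : ℕ) : ‖S.toPos n (e j)‖ ≠ 0 :=
  norm_ne_zero_iff.2 ((he.pos n).ne_zero j)

theorem norm_toNeg (he : S.IsBasis e) (n j : ℕ) : ‖S.toNeg n (e j)‖ = ‖S.toPos n (e j)‖⁻¹ := by
  have h0 := S.norm_toPos_ne_zero he n j
  rw [← S.norm_theta, S.theta_toNeg_basis he, norm_smul, norm_inv, norm_pow, norm_norm]
  field_simp

theorem theta_smul_toNeg (he : S.IsBasis e) (n j : ℕ) :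
    S.theta n (‖S.toPos n (e j)‖ • S.toNeg n (e j)) = S.toPos n (S.normalize n (e j)) := by
  rw [← S.theta_basis he, S.norm_toNeg he, inv_inv]

theorem orthonormal_smul_toNeg (he : S.IsBasis e) (n : ℕ) :
    Orthonormal ℝ fun j => ‖S.toPos n (e j)‖ • S.toNeg n (e j) := by
  refine ⟨fun j => ?_, fun i j hij => ?_⟩
  · rw [norm_smul, norm_norm, S.norm_toNeg he, mul_inv_cancel₀ (S.norm_toPos_ne_zero he n j)]
  · change inner ℝ (‖S.toPos n (e i)‖ • S.toNeg n (e i))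
      (‖S.toPos n (e j)‖ • S.toNeg n (e j)) = 0
    rw [real_inner_smul_left, real_inner_smul_right, (he.neg n).orthogonal hij]
    ring

/-- The vectors `φⱼ / ‖φⱼ‖₋ₙ` as a Hilbert basis of `Φ₋ₙ`. -/
def negBasis (he : S.IsBasis e) (n : ℕ) : HilbertBasis ℕ ℝ (S.Neg n) :=
  HilbertBasis.mk (v := fun j => ‖S.toPos n (e j)‖ • S.toNeg n (e j))
    (S.orthonormal_smul_toNeg he n)
    (by
      have hd := (he.neg n).dense_span
      have hle : Submodule.span ℝ (range fun j => S.toNeg n (e j)) ≤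
          Submodule.span ℝ (range fun j => ‖S.toPos n (e j)‖ • S.toNeg n (e j)) := by
        rw [Submodule.span_le]
        rintro _ ⟨j, rfl⟩
        have := Submodule.smul_mem _ (‖S.toPos n (e j)‖⁻¹) (Submodule.subset_span (R := ℝ)
          (mem_range_self (f := fun j => ‖S.toPos n (e j)‖ • S.toNeg n (e j)) j))
        rwa [smul_smul, inv_mul_cancel₀ (S.norm_toPos_ne_zero he n j), one_smul] at this
      intro u _
      exact closure_mono hle (hd u))

theorem negBasis_apply (he : S.IsBasis e) (n j : ℕ) :
    S.negBasis he n j = ‖S.toPos n (e j)‖ • S.toNeg n (e j) :=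
  congrFun (HilbertBasis.coe_mk (S.orthonormal_smul_toNeg he n) _) j

theorem inner_negBasis (he : S.IsBasis e) (n j : ℕ) (u : S.Neg n) :
    inner ℝ (S.negBasis he n j) u = S.emb n u (S.normalize n (e j)) := by
  rw [negBasis_apply]
  exact S.inner_eq_emb (S.theta_smul_toNeg he n j) u

theorem negIncl_negBasis (he : S.IsBasis e) {n m : ℕ} (h : n ≤ m) (j : ℕ) :
    S.negIncl h (S.negBasis he n j) =
      (‖S.toPos n (e j)‖ * ‖S.toPos m (e j)‖⁻¹) • S.negBasis he m j := by
  rw [negBasis_apply, negBasis_apply, map_smul, negIncl_toNeg, smul_smul, mul_assoc,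
    inv_mul_cancel₀ (S.norm_toPos_ne_zero he m j), mul_one]

theorem negIncl_negBasis_ne_zero (he : S.IsBasis e) {n m : ℕ} (h : n ≤ m) (j : ℕ) :
    S.negIncl h (S.negBasis he n j) ≠ 0 := by
  rw [(map_ne_zero_iff _ (S.negIncl_injective h))]
  exact (S.negBasis he n).orthonormal.ne_zero j

theorem orthogonal_negIncl_negBasis (he : S.IsBasis e) {n m : ℕ} (h : n ≤ m) :
    Pairwise fun i j => inner ℝ (S.negIncl h (S.negBasis he n i))
      (S.negIncl h (S.negBasis he n j)) = 0 := by
  intro i j hij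
  rw [negIncl_negBasis, negIncl_negBasis, real_inner_smul_left, real_inner_smul_right,
    (S.negBasis he m).orthonormal.2 hij, mul_zero, mul_zero]

/-- The `Φ₋ₘ`-inner product with a basis vector is, up to the weight of this vector, the coordinate
with respect to the basis of `Φ₋ₙ`. -/
theorem inner_negIncl_negBasis (he : S.IsBasis e) {n m : ℕ} (h : n ≤ m) (j : ℕ) (u : S.Neg m) :
    inner ℝ (S.negIncl h (S.negBasis he n j)) u =
      ‖S.negIncl h (S.negBasis he n j)‖ ^ 2 * S.emb m u (S.normalize n (e j)) := by
  have hn := S.norm_toPos_ne_zero he n j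
  have hm := S.norm_toPos_ne_zero he m j
  rw [negIncl_negBasis, real_inner_smul_left, inner_negBasis, norm_smul,
    (S.negBasis he m).orthonormal.1 j, normalize, normalize, map_smul, map_smul, smul_eq_mul,
    smul_eq_mul, norm_mul, norm_inv, norm_norm, norm_norm]
  field_simp

theorem tendsto_norm_negIncl_negBasis (he : S.IsBasis e) {n m : ℕ} (h : n ≤ m)
    (hHS : IsHilbertSchmidt (S.negIncl h)) :
    Tendsto (fun j => ‖S.negIncl h (S.negBasis he n j)‖) atTop (𝓝 0) := by
  have h1 := (hHS.summable_of_orthogonal (S.negBasis he n)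
    (S.orthogonal_negIncl_negBasis he h)).tendsto_atTop_zero
  have h2 := (Real.continuous_sqrt.tendsto 0).comp h1
  simpa [Function.comp_def] using h2

/-- A finite linear combination of the basis of `Φ₋ₙ` comes from an element of `Φ`, and so does its
image under `θₙ`. -/
theorem sum_smul_negBasis (he : S.IsBasis e) (n : ℕ) (s : Finset ℕ) (c : ℕ → ℝ) :
    ∑ j ∈ s, c j • S.negBasis he n j
        = S.toNeg n (∑ j ∈ s, (c j * ‖S.toPos n (e j)‖) • e j) ∧
      S.theta n (∑ j ∈ s, c j • S.negBasis he n j)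
        = S.toPos n (∑ j ∈ s, c j • S.normalize n (e j)) := by
  constructor
  · change _ = S.toNegₗ n _
    rw [map_sum]
    refine Finset.sum_congr rfl fun j _ => ?_
    rw [negBasis_apply, smul_smul, map_smul]
    rfl
  · have hsum : S.theta n (∑ j ∈ s, c j • S.negBasis he n j)
        = ∑ j ∈ s, c j • S.theta n (S.negBasis he n j) := by
      simp only [theta, map_sum, map_smul]
    rw [hsum, map_sum]
    refine Finset.sum_congr rfl fun j _ => ?_
    rw [negBasis_apply, S.theta_smul_toNeg he, map_smul]

/-- A linear functional on `Φ` that is bounded for `‖·‖ₙ` is an element of `Φ₋ₙ`. -/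
theorem exists_emb_eq (n : ℕ) (g : Φ →ₗ[ℝ] ℝ) {c : ℝ} (hc : 0 ≤ c)
    (hg : ∀ φ, |g φ| ≤ c * ‖S.toPos n φ‖) :
    ∃ u : S.Neg n, ‖u‖ ≤ c ∧ ∀ φ, S.emb n u φ = g φ := by
  let g' : Renormed (S.core n) →L[ℝ] ℝ :=
    LinearMap.mkContinuous (E := Renormed (S.core n)) (g : Φ →ₗ[ℝ] ℝ) c fun φ => by
      rw [← (S.complIncl n).norm_map]
      exact hg φ
  let u : StrongDual ℝ (S.Pos n) := g'.extend (S.complIncl n).toContinuousLinearMap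
  have hu : ∀ φ : Φ, u (S.toPos n φ) = g φ := fun φ =>
    ContinuousLinearMap.extend_eq (E := Renormed (S.core n)) (f := g')
      (e := (S.complIncl n).toContinuousLinearMap) (S.denseRange_toPos n)
      (S.complIncl n).isometry.isUniformInducing φ
  refine ⟨(S.negEquiv n).symm u, ?_, hu⟩
  rw [LinearIsometryEquiv.norm_map]
  refine u.opNorm_le_bound hc fun v => ?_
  refine (S.denseRange_toPos n).induction_on v
    (isClosed_le u.continuous.norm (continuous_const.mul continuous_norm)) fun φ => ?_
  rw [hu]
  exact hg φ

end CountablyHilbertian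

/-! ### Integrals over `[0,T]` and over `X × [0,T]` -/

section TimeIntegrals

variable {T : ℝ}

theorem map_val_lebT (T : ℝ) : (lebT T).map Subtype.val = volume.restrict (Icc 0 T) := by
  rw [lebT, (MeasurableEmbedding.subtype_coe measurableSet_Icc).map_comap, Subtype.range_val]

instance (T : ℝ) : IsFiniteMeasure (lebT T) := by
  refine ⟨?_⟩
  have h : (lebT T).map Subtype.val univ = volume.restrict (Icc 0 T) univ := by
    rw [map_val_lebT]
  rw [Measure.map_apply measurable_subtype_coe MeasurableSet.univ, preimage_univ] at h
  rw [h]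
  simp

theorem integrable_lebT_iff (hT : 0 ≤ T) {g : Icc (0 : ℝ) T → ℝ} :
    Integrable g (lebT T) ↔ IntervalIntegrable (fun r => g (projIcc 0 T hT r)) volume 0 T := by
  rw [intervalIntegrable_iff_integrableOn_Icc_of_le hT, IntegrableOn, ← map_val_lebT,
    (MeasurableEmbedding.subtype_coe measurableSet_Icc).integrable_map_iff]
  simp [Function.comp_def]

theorem setIntegral_lebT (hT : 0 ≤ T) (g : Icc (0 : ℝ) T → ℝ) (t : Icc (0 : ℝ) T) :
    ∫ s in {s : Icc (0 : ℝ) T | s ≤ t}, g s ∂(lebT T)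
      = ∫ r in (0 : ℝ)..t, g (projIcc 0 T hT r) := by
  have hset : {s : Icc (0 : ℝ) T | s ≤ t} = Subtype.val ⁻¹' Iic (t : ℝ) := rfl
  have hinter : Iic (t : ℝ) ∩ Icc 0 T = Icc 0 (t : ℝ) := by
    ext r
    exact ⟨fun h => ⟨h.2.1, h.1⟩, fun h => ⟨h.2, h.1, h.2.trans t.2.2⟩⟩
  have h := (MeasurableEmbedding.subtype_coe
    (measurableSet_Icc (a := (0 : ℝ)) (b := T))).setIntegral_map (μ := lebT T)
    (fun r => g (projIcc 0 T hT r)) (Iic (t : ℝ))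
  rw [map_val_lebT, Measure.restrict_restrict measurableSet_Iic, hinter,
    integral_Icc_eq_integral_Ioc, ← intervalIntegral.integral_of_le t.2.1] at h
  rw [hset, h]
  simp

theorem ae_restrict_of_ae_lebT (hT : 0 ≤ T) {P : Icc (0 : ℝ) T → Prop}
    (h : ∀ᵐ s ∂(lebT T), P s) : ∀ᵐ r ∂volume.restrict (Icc 0 T), P (projIcc 0 T hT r) := by
  rw [← map_val_lebT, (MeasurableEmbedding.subtype_coe measurableSet_Icc).ae_map_iff]
  simpa using h

variable {X : Type*} [MeasurableSpace X] {ν : Measure X} [SFinite ν]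

theorem setIntegral_nuT (hT : 0 ≤ T) {g : X × Icc (0 : ℝ) T → ℝ} (hg : Integrable g (nuT ν T))
    (t : Icc (0 : ℝ) T) :
    IntervalIntegrable (fun r => ∫ y, g (y, projIcc 0 T hT r) ∂ν) volume 0 T ∧
    ∫ z in {z : X × Icc (0 : ℝ) T | z.2 ≤ t}, g z ∂(nuT ν T)
      = ∫ r in (0 : ℝ)..t, ∫ y, g (y, projIcc 0 T hT r) ∂ν := by
  refine ⟨(integrable_lebT_iff hT).1 hg.integral_prod_right, ?_⟩
  rw [← setIntegral_lebT hT fun s => ∫ y, g (y, s) ∂ν]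
  have hset : {z : X × Icc (0 : ℝ) T | z.2 ≤ t} = univ ×ˢ {s | s ≤ t} := by
    ext z
    simp
  have hres : (nuT ν T).restrict {z : X × Icc (0 : ℝ) T | z.2 ≤ t}
      = ν.prod ((lebT T).restrict {s | s ≤ t}) := by
    rw [hset, nuT, ← Measure.prod_restrict, Measure.restrict_univ]
  have hg' : Integrable g (ν.prod ((lebT T).restrict {s | s ≤ t})) := hres ▸ hg.restrict
  rw [hres, integral_prod_symm _ hg']

end TimeIntegrals

/-- A function on a product that is a.e. measurable in one variable and continuous in the other is
a.e. measurable. -/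
theorem aestronglyMeasurable_prod_of_continuous {X Y : Type*} [MeasurableSpace X]
    [TopologicalSpace Y] [TopologicalSpace.MetrizableSpace Y] [SecondCountableTopology Y]
    [MeasurableSpace Y] [OpensMeasurableSpace Y] {μ : Measure X} {τ : Measure Y} [SFinite μ] [SFinite τ] {g : X → Y → ℝ}
    (hc : ∀ x, Continuous (g x)) (hm : ∀ y, AEStronglyMeasurable (fun x => g x y) μ) :
    AEStronglyMeasurable (fun z : X × Y => g z.1 z.2) (μ.prod τ) := by
  obtain ⟨D, hDc, hDd⟩ := TopologicalSpace.exists_countable_dense Y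
  have hDc' : Countable D := hDc.to_subtype
  have hae : ∀ᵐ x ∂μ, ∀ y : D, g x y = (hm y).mk _ x := ae_all_iff.2 fun y => (hm y).ae_eq_mk
  obtain ⟨N, hN, hNm, hN0⟩ := exists_measurable_superset_of_null (ae_iff.1 hae)
  have hNg : ∀ x ∉ N, ∀ y : D, g x y = (hm y).mk _ x := fun x hx => by
    by_contra hcon
    exact hx (hN hcon)
  classical
  let g' : Y → X → ℝ := fun y => Nᶜ.indicator fun x => g x y
  have hg'c : ∀ x, Continuous fun y => g' y x := fun x => by
    by_cases hx : x ∈ N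
    · simp [g', hx, continuous_const]
    · simpa [g', hx] using hc x
  have hg'D : ∀ y : D, StronglyMeasurable (g' y) := fun y => by
    have : g' y = Nᶜ.indicator ((hm y).mk _) := by
      funext x
      by_cases hx : x ∈ N
      · simp [g', hx]
      · simp [g', hx, hNg x hx y]
    rw [this]
    exact (hm y).stronglyMeasurable_mk.indicator hNm.compl
  have hg'm : ∀ y, StronglyMeasurable (g' y) := fun y => by
    obtain ⟨u, hu, hul⟩ := mem_closure_iff_seq_limit.1 (hDd y)
    refine stronglyMeasurable_of_tendsto atTop (fun n => hg'D ⟨u n, hu n⟩) ?_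
    rw [tendsto_pi_nhds]
    exact fun x => ((hg'c x).tendsto y).comp hul
  have hsm : StronglyMeasurable fun z : X × Y => g' z.2 z.1 :=
    (stronglyMeasurable_uncurry_of_continuous_of_stronglyMeasurable hg'c hg'm).comp_measurable
      measurable_swap
  refine ⟨_, hsm, ?_⟩
  have hN' : ∀ᵐ x ∂μ, x ∉ N := measure_eq_zero_iff_ae_notMem.1 hN0
  have hz : ∀ᵐ z ∂(μ.prod τ), z.1 ∉ N := Measure.quasiMeasurePreserving_fst.ae hN'
  filter_upwards [hz] with z hz
  simp [g', hz]

/-- A weakly continuous curve, paired with a continuous family of functionals, gives a measurable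
function. -/
theorem HilbertBasis.measurable_clm_apply {H Y : Type*} [NormedAddCommGroup H]
    [InnerProductSpace ℝ H] [TopologicalSpace Y] [MeasurableSpace Y] [OpensMeasurableSpace Y]
    (h : HilbertBasis ℕ ℝ H) {g : Y → H →L[ℝ] ℝ} (hg : Continuous g) {ζ : Y → H}
    (hζ : ∀ j, Continuous fun y => inner ℝ (h j) (ζ y)) : Measurable fun y => g y (ζ y) := by
  refine measurable_of_tendsto_metrizable
    (f := fun (d : ℕ) y => ∑ j ∈ Finset.range d, inner ℝ (h j) (ζ y) * g y (h j)) (fun d => ?_) ?_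
  · exact (continuous_finsetSum _ fun j _ =>
      (hζ j).mul (hg.clm_apply continuous_const)).measurable
  · rw [tendsto_pi_nhds]
    intro y
    have h1 := ((h.hasSum_repr (ζ y)).mapL (g y)).tendsto_sum_nat
    simpa only [map_smul, smul_eq_mul, h.repr_apply_apply] using h1

namespace CountablyHilbertian

variable {Φ : Type*} [AddCommGroup Φ] [Module ℝ Φ] [UniformSpace Φ] (S : CountablyHilbertian Φ)
  {e : ℕ → Φ}

theorem neg_ext (he : S.IsBasis e) {n : ℕ} {u v : S.Neg n}
    (h : ∀ j, S.emb n u (e j) = S.emb n v (e j)) : u = v :=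
  (S.negBasis he n).ext_inner fun j => by
    rw [inner_negBasis, inner_negBasis, normalize, map_smul, map_smul, h]

/-- A family of functions on a measure space that depends linearly on `φ ∈ Φ` and whose integral is
bounded by `‖φ‖ₙ` integrates to an element of `Φ₋ₙ`. -/
theorem exists_emb_eq_integral {Ω : Type*} [MeasurableSpace Ω] {μ : Measure Ω} (n : ℕ)
    {F : Φ → Ω → ℝ} (hadd : ∀ φ χ ω, F (φ + χ) ω = F φ ω + F χ ω)
    (hsmul : ∀ (c : ℝ) φ ω, F (c • φ) ω = c * F φ ω) (hint : ∀ φ, Integrable (F φ) μ) {c : ℝ}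
    (hc : 0 ≤ c) (hle : ∀ φ, |∫ ω, F φ ω ∂μ| ≤ c * ‖S.toPos n φ‖) :
    ∃ u : S.Neg n, ‖u‖ ≤ c ∧ ∀ φ, S.emb n u φ = ∫ ω, F φ ω ∂μ :=
  S.exists_emb_eq n
    { toFun := fun φ => ∫ ω, F φ ω ∂μ
      map_add' := fun φ χ => by
        simp only [hadd]
        exact integral_add (hint φ) (hint χ)
      map_smul' := fun r φ => by
        simp only [hsmul]
        exact integral_const_mul r _ } hc hle

theorem norm_toPos_mono {n m : ℕ} (h : n ≤ m) (φ : Φ) : ‖S.toPos n φ‖ ≤ ‖S.toPos m φ‖ := by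
  rw [norm_toPos, norm_toPos]
  exact S.mono n m h φ

end CountablyHilbertian

/-! ### The linearized drift as a dissipative system -/

namespace CountablyHilbertian

variable {Φ : Type*} [AddCommGroup Φ] [Module ℝ Φ] [UniformSpace Φ] (S : CountablyHilbertian Φ)
  {e : ℕ → Φ}

theorem continuous_emb_apply (n : ℕ) (φ : Φ) : Continuous fun u : S.Neg n => S.emb n u φ :=
  (S.negEquiv n).continuous.clm_apply continuous_const

theorem exists_seq_negIncl_tendsto (he : S.IsBasis e) {n m : ℕ} (h : n ≤ m) (k : S.Neg m) :
    ∃ u : ℕ → S.Neg n, Tendsto (fun d => S.negIncl h (u d)) atTop (𝓝 k) := by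
  refine ⟨fun d => ∑ j ∈ Finset.range d,
    (S.negBasis he m).repr k j • (‖S.toPos m (e j)‖ • S.toNeg n (e j)), ?_⟩
  have h1 := ((S.negBasis he m).hasSum_repr k).tendsto_sum_nat
  simpa only [map_sum, map_smul, negIncl_toNeg, negBasis_apply] using h1

end CountablyHilbertian

section Coefficients

variable {Φ : Type*} [AddCommGroup Φ] [Module ℝ Φ] [UniformSpace Φ] {S : CountablyHilbertian Φ}
  {e : ℕ → Φ} {X : Type*} [MeasurableSpace X] {ν : Measure X}
  {b : StrongDual ℝ Φ → StrongDual ℝ Φ} {G : StrongDual ℝ Φ → X → StrongDual ℝ Φ}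
  {MG LG : X → ℝ} {p q q₁ : ℕ} {hpq : p < q} {hq : q < q₁} {m : ℝ}

namespace BasicConditions

theorem memLp_G_apply (hbasic : BasicConditions S ν b G MG LG hpq) (u : S.Neg p) (φ : Φ) :
    MemLp (fun y => G (S.emb p u) y φ) 2 ν := by
  have h1 : (fun y => G (S.emb p u) y φ) = fun y => S.emb p (S.lift p (G (S.emb p u) y)) φ := by
    funext y
    rw [S.emb_lift (hbasic.G_mem u y)]
  rw [h1]
  refine MemLp.of_le_mul (c := ‖S.toPos p φ‖) (hbasic.G_memLp u)
    ((S.continuous_emb_apply p φ).comp_aestronglyMeasurable (hbasic.G_memLp u).1)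
    (Eventually.of_forall fun y => ?_)
  rw [mul_comm]
  exact S.abs_emb_le p _ φ

theorem abs_G_apply_le (hbasic : BasicConditions S ν b G MG LG hpq) (u : S.Neg p) (y : X)
    (φ : Φ) : |G (S.emb p u) y φ| ≤ |MG y| * (1 + ‖u‖) * ‖S.toPos p φ‖ := by
  have h1 := S.abs_emb_le p (S.lift p (G (S.emb p u) y)) φ
  rw [S.emb_lift (hbasic.G_mem u y)] at h1
  refine h1.trans ?_
  gcongr
  refine (hbasic.G_growth u y).trans ?_
  gcongr
  exact le_abs_self _

end BasicConditions

namespace DerivativeConditions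

theorem derivG_add (hderiv : DerivativeConditions S ν b G e MG LG hpq hq m) (φ χ : Φ)
    (v : S.Neg q₁) (y : X) :
    derivG S G q₁ (φ + χ) v y = derivG S G q₁ φ v y + derivG S G q₁ χ v y := by
  have h1 : (fun w : S.Neg q₁ => G (S.emb q₁ w) y (φ + χ))
      = (fun w : S.Neg q₁ => G (S.emb q₁ w) y φ) + fun w : S.Neg q₁ => G (S.emb q₁ w) y χ := by
    funext w
    exact map_add _ _ _
  rw [derivG, h1, fderiv_add (hderiv.G_diff φ y v) (hderiv.G_diff χ y v)]
  rfl

theorem derivG_smul (hderiv : DerivativeConditions S ν b G e MG LG hpq hq m) (c : ℝ) (φ : Φ)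
    (v : S.Neg q₁) (y : X) : derivG S G q₁ (c • φ) v y = c • derivG S G q₁ φ v y := by
  have h1 : (fun w : S.Neg q₁ => G (S.emb q₁ w) y (c • φ))
      = c • fun w : S.Neg q₁ => G (S.emb q₁ w) y φ := by
    funext w
    exact map_smul _ _ _
  rw [derivG, h1, fderiv_const_smul (hderiv.G_diff φ y v)]
  rfl

/-- Measurability of `G` is only known on `Φ₋ₚ`. The derivative in directions of `Φ₋ₚ` is a limit of
difference quotients there, and these directions are dense. -/
theorem aestronglyMeasurable_derivG (hderiv : DerivativeConditions S ν b G e MG LG hpq hq m)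
    (hbasic : BasicConditions S ν b G MG LG hpq) (he : S.IsBasis e) (u : S.Neg p) (φ : Φ)
    (k : S.Neg q₁) :
    AEStronglyMeasurable (fun y => derivG S G q₁ φ (S.negIncl (hpq.trans hq).le u) y k) ν := by
  have hdir : ∀ w : S.Neg p, AEStronglyMeasurable (fun y => derivG S G q₁ φ
      (S.negIncl (hpq.trans hq).le u) y (S.negIncl (hpq.trans hq).le w)) ν := by
    intro w
    refine aestronglyMeasurable_of_tendsto_ae atTop (f := fun (n : ℕ) y => (n : ℝ) •
      (G (S.emb p (u + (n : ℝ)⁻¹ • w)) y φ - G (S.emb p u) y φ)) (fun n => ?_)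
      (Eventually.of_forall fun y => ?_)
    · exact ((hbasic.memLp_G_apply _ φ).1.sub (hbasic.memLp_G_apply u φ).1).const_smul (n : ℝ)
    · have h1 := ((hderiv.G_diff φ y) (S.negIncl (hpq.trans hq).le u)).hasFDerivAt.lim
        (S.negIncl (hpq.trans hq).le w) (c := fun n : ℕ => (n : ℝ)) (l := atTop)
        (by simpa using tendsto_natCast_atTop_atTop)
      simpa only [← map_smul, ← map_add, CountablyHilbertian.emb_negIncl, derivG] using h1
  obtain ⟨w, hw⟩ := S.exists_seq_negIncl_tendsto he (hpq.trans hq).le k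
  exact aestronglyMeasurable_of_tendsto_ae atTop (fun n => hdir (w n))
    (Eventually.of_forall fun y => ((derivG S G q₁ φ _ y).continuous.tendsto k).comp hw)

/-- The bounds on the derivative of `G` in terms of one family of integrable functions. -/
theorem exists_derivG_bound (hderiv : DerivativeConditions S ν b G e MG LG hpq hq m) :
    ∃ (N : S.Neg p → X → ℝ) (c : ℝ), 0 ≤ c ∧
      (∀ u : S.Neg p, ‖u‖ ≤ m → Integrable (N u) ν ∧ ∫ y, N u y ∂ν ≤ c) ∧
      (∀ (u : S.Neg p) (φ : Φ) (y : X) (k : S.Neg q₁),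
        |derivG S G q₁ φ (S.negIncl (hpq.trans hq).le u) y k|
          ≤ N u y * (‖S.toPos q₁ φ‖ * ‖k‖)) ∧
      (∀ (u : S.Neg p) (φ : Φ) (y : X) (k : S.Neg q),
        |derivG S G q₁ φ (S.negIncl (hpq.trans hq).le u) y (S.negIncl hq.le k)|
          ≤ N u y * (‖S.toPos q φ‖ * ‖k‖)) := by
  obtain ⟨N, hN0, hN1, hN2, c, hc⟩ := hderiv.DG_bounds
  refine ⟨fun u y => max (N u y) (N u y ^ 2), max c 0, le_max_right _ _,
    fun u hu => ⟨(hc u hu).1, (hc u hu).2.trans (le_max_left _ _)⟩, fun u φ y k => ?_,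
    fun u φ y k => ?_⟩
  · have h1 := (derivG S G q₁ φ (S.negIncl (hpq.trans hq).le u) y).le_opNorm k
    refine h1.trans ?_
    rw [← mul_assoc]
    gcongr
    refine (hN1 u φ y).trans ?_
    gcongr
    exact le_max_left _ _
  · have h1 := ((derivG S G q₁ φ (S.negIncl (hpq.trans hq).le u) y).comp
      (S.negIncl hq.le)).le_opNorm k
    refine h1.trans ?_
    rw [← mul_assoc]
    gcongr
    refine (hN2 u φ y).trans ?_
    gcongr
    exact le_max_left _ _

end DerivativeConditions

/-- A bound on an integral from a pointwise one. No measurability of `g` is needed, since the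
integral of a function that is not a.e. measurable is zero. -/
theorem abs_integral_le_of_le_mul {Ω : Type*} [MeasurableSpace Ω] {μ : Measure Ω} {g N : Ω → ℝ}
    {c r : ℝ} (hN : Integrable N μ) (hNc : ∫ y, N y ∂μ ≤ c) (hr : 0 ≤ r)
    (hg : ∀ y, |g y| ≤ N y * r) : |∫ y, g y ∂μ| ≤ c * r := by
  have h1 : ‖∫ y, g y ∂μ‖ ≤ ∫ y, N y * r ∂μ :=
    norm_integral_le_of_norm_le (hN.mul_const r) (Eventually.of_forall hg)
  rw [integral_mul_const] at h1
  exact h1.trans (mul_le_mul_of_nonneg_right hNc hr)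

namespace DerivativeConditions

theorem integrable_derivG (hderiv : DerivativeConditions S ν b G e MG LG hpq hq m)
    (hbasic : BasicConditions S ν b G MG LG hpq) (he : S.IsBasis e) {u : S.Neg p} (hu : ‖u‖ ≤ m)
    (φ : Φ) (k : S.Neg q₁) :
    Integrable (fun y => derivG S G q₁ φ (S.negIncl (hpq.trans hq).le u) y k) ν := by
  obtain ⟨N, c, hc, hN, hN1, -⟩ := hderiv.exists_derivG_bound
  exact ((hN u hu).1.mul_const _).mono' (hderiv.aestronglyMeasurable_derivG hbasic he u φ k)
    (Eventually.of_forall fun y => hN1 u φ y k)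

/-- The integrated derivative of `G`, as a functional of the direction and as an operator of
`Φ_{-q₁}`. -/
theorem exists_integral_derivG (hderiv : DerivativeConditions S ν b G e MG LG hpq hq m)
    (hbasic : BasicConditions S ν b G MG LG hpq) (he : S.IsBasis e) :
    ∃ (D : Φ → S.Neg p → S.Neg q₁ →L[ℝ] ℝ) (B : S.Neg p → S.Neg q₁ → S.Neg q₁) (c : ℝ),
      0 ≤ c ∧ ∀ u : S.Neg p, ‖u‖ ≤ m →
        (∀ φ k, D φ u k = ∫ y, derivG S G q₁ φ (S.negIncl (hpq.trans hq).le u) y k ∂ν) ∧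
        (∀ φ k, S.emb q₁ (B u k) φ = D φ u k) ∧ (∀ k, ‖B u k‖ ≤ c * ‖k‖) ∧
        ∀ φ k, |D φ u (S.negIncl hq.le k)| ≤ c * (‖S.toPos q φ‖ * ‖k‖) := by
  obtain ⟨N, c, hc, hN, hN1, hN2⟩ := hderiv.exists_derivG_bound
  have hint := fun u (hu : ‖u‖ ≤ m) => hderiv.integrable_derivG hbasic he hu
  have hD : ∀ (φ : Φ) (u : S.Neg p), ∃ D : S.Neg q₁ →L[ℝ] ℝ, ‖u‖ ≤ m → ∀ k,
      D k = ∫ y, derivG S G q₁ φ (S.negIncl (hpq.trans hq).le u) y k ∂ν := by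
    intro φ u
    by_cases hu : ‖u‖ ≤ m
    · refine ⟨LinearMap.mkContinuous
        { toFun := fun k => ∫ y, derivG S G q₁ φ (S.negIncl (hpq.trans hq).le u) y k ∂ν
          map_add' := fun k k' => by
            simp only [map_add]
            exact integral_add (hint u hu φ k) (hint u hu φ k')
          map_smul' := fun r k => by
            simp only [map_smul, smul_eq_mul, RingHom.id_apply]
            exact integral_const_mul r _ } (c * ‖S.toPos q₁ φ‖) fun k => ?_, fun _ k => rfl⟩
      rw [mul_assoc]
      exact abs_integral_le_of_le_mul (hN u hu).1 (hN u hu).2 (by positivity)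
        fun y => hN1 u φ y k
    · exact ⟨0, fun h => absurd h hu⟩
  have hB : ∀ (u : S.Neg p) (k : S.Neg q₁), ∃ w : S.Neg q₁, ‖u‖ ≤ m → ‖w‖ ≤ c * ‖k‖ ∧
      ∀ φ, S.emb q₁ w φ = ∫ y, derivG S G q₁ φ (S.negIncl (hpq.trans hq).le u) y k ∂ν := by
    intro u k
    by_cases hu : ‖u‖ ≤ m
    · obtain ⟨w, hw⟩ := S.exists_emb_eq_integral q₁ (μ := ν)
        (F := fun φ y => derivG S G q₁ φ (S.negIncl (hpq.trans hq).le u) y k)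
        (fun φ χ y => by rw [hderiv.derivG_add]; rfl)
        (fun r φ y => by rw [hderiv.derivG_smul]; rfl) (fun φ => hint u hu φ k)
        (c := c * ‖k‖) (by positivity) fun φ => by
          rw [mul_assoc, mul_comm ‖k‖]
          exact abs_integral_le_of_le_mul (hN u hu).1 (hN u hu).2 (by positivity)
            fun y => hN1 u φ y k
      exact ⟨w, fun _ => hw⟩
    · exact ⟨0, fun h => absurd h hu⟩
  choose D hD using hD
  choose B hB using hB
  refine ⟨D, B, c, hc, fun u hu => ⟨fun φ k => hD φ u hu k, fun φ k => ?_,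
    fun k => (hB u k hu).1, fun φ k => ?_⟩⟩
  · rw [(hB u k hu).2, hD φ u hu]
  · rw [hD φ u hu]
    exact abs_integral_le_of_le_mul (hN u hu).1 (hN u hu).2 (by positivity)
      fun y => hN2 u φ y k

variable {T : ℝ} {X₀ : Icc (0 : ℝ) T → S.Neg p}

theorem continuous_derivB (hderiv : DerivativeConditions S ν b G e MG LG hpq hq m)
    (hX : Continuous fun t => S.negIncl hpq.le (X₀ t)) (φ : Φ) :
    Continuous fun t => derivB S b q φ (S.negIncl hpq.le (X₀ t)) := by
  obtain ⟨L, hL, h⟩ := hderiv.Db_lipschitz φ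
  rw [continuous_iff_continuousAt]
  intro t
  rw [ContinuousAt, tendsto_iff_norm_sub_tendsto_zero]
  have h1 := (tendsto_iff_norm_sub_tendsto_zero.1 (hX.tendsto t)).const_mul L
  rw [mul_zero] at h1
  refine squeeze_zero (fun _ => norm_nonneg _) (fun s => ?_) h1
  rw [← map_sub]
  exact h _ _

theorem continuous_derivG (hderiv : DerivativeConditions S ν b G e MG LG hpq hq m)
    (hX : Continuous fun t => S.negIncl hpq.le (X₀ t)) (φ : Φ) (y : X) :
    Continuous fun t => derivG S G q₁ φ (S.negIncl (hpq.trans hq).le (X₀ t)) y := by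
  obtain ⟨L, hL, h⟩ := hderiv.DG_lipschitz φ
  rw [continuous_iff_continuousAt]
  intro t
  rw [ContinuousAt, tendsto_iff_norm_sub_tendsto_zero]
  have h1 := (tendsto_iff_norm_sub_tendsto_zero.1 (hX.tendsto t)).const_mul (L y)
  rw [mul_zero] at h1
  refine squeeze_zero (fun _ => norm_nonneg _) (fun s => ?_) h1
  rw [← map_sub]
  exact h _ _ y

/-- Continuity in time of the integrated derivative of `G`. -/
theorem continuous_integral_derivG (hderiv : DerivativeConditions S ν b G e MG LG hpq hq m)
    (hbasic : BasicConditions S ν b G MG LG hpq) (he : S.IsBasis e)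
    (hX : Continuous fun t => S.negIncl hpq.le (X₀ t)) (hXm : ∀ t, ‖X₀ t‖ ≤ m) (φ : Φ)
    {D : Icc (0 : ℝ) T → S.Neg q₁ →L[ℝ] ℝ} (hD : ∀ t k, D t k =
      ∫ y, derivG S G q₁ φ (S.negIncl (hpq.trans hq).le (X₀ t)) y k ∂ν) : Continuous D := by
  obtain ⟨L, hL, h⟩ := hderiv.DG_lipschitz φ
  have hle : ∀ s t, ‖D s - D t‖
      ≤ (∫ y, |L y| ∂ν) * ‖S.negIncl hpq.le (X₀ s) - S.negIncl hpq.le (X₀ t)‖ := by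
    intro s t
    refine ContinuousLinearMap.opNorm_le_bound _ (by positivity) fun k => ?_
    rw [_root_.sub_apply, hD, hD, mul_assoc,
      ← integral_sub (hderiv.integrable_derivG hbasic he (hXm s) φ k)
        (hderiv.integrable_derivG hbasic he (hXm t) φ k)]
    refine abs_integral_le_of_le_mul hL.abs le_rfl (by positivity) fun y => ?_
    rw [← _root_.sub_apply, ← mul_assoc]
    refine ((derivG S G q₁ φ (S.negIncl (hpq.trans hq).le (X₀ s)) y
      - derivG S G q₁ φ (S.negIncl (hpq.trans hq).le (X₀ t)) y).le_opNorm k).trans ?_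
    gcongr
    refine (h _ _ y).trans ?_
    rw [map_sub]
    gcongr
    exact le_abs_self _
  rw [continuous_iff_continuousAt]
  intro t
  rw [ContinuousAt, tendsto_iff_norm_sub_tendsto_zero]
  have h1 := (tendsto_iff_norm_sub_tendsto_zero.1 (hX.tendsto t)).const_mul (∫ y, |L y| ∂ν)
  rw [mul_zero] at h1
  exact squeeze_zero (fun _ => norm_nonneg _) (fun s => hle s t) h1

/-- The linearized drift along a path is a dissipative system for the pair `Φ_{-q} ⊂ Φ_{-q₁}`. -/
theorem exists_isDissipativeSystem (hderiv : DerivativeConditions S ν b G e MG LG hpq hq m)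
    (hbasic : BasicConditions S ν b G MG LG hpq) (he : S.IsBasis e) (hT : 0 ≤ T)
    (hX : Continuous fun t => S.negIncl hpq.le (X₀ t)) (hXm : ∀ t, ‖X₀ t‖ ≤ m) :
    ∃ (ℓ : ℕ → ℝ → S.Neg q →L[ℝ] ℝ) (Λ : ℝ → S.Neg q → S.Neg q₁) (M L C : ℝ),
      IsDissipativeSystem (S.negBasis he q) (S.negIncl hq.le) ℓ Λ M L C ∧
      ∀ j r x, ℓ j r x
        = derivB S b q (S.normalize q (e j)) (S.negIncl hpq.le (X₀ (projIcc 0 T hT r))) x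
          + ∫ y, derivG S G q₁ (S.normalize q (e j))
            (S.negIncl (hpq.trans hq).le (X₀ (projIcc 0 T hT r))) y (S.negIncl hq.le x) ∂ν := by
  obtain ⟨D, B, c, hc, hDB⟩ := hderiv.exists_integral_derivG hbasic he
  obtain ⟨A, hA, -, ⟨MA, hMA0, hMA⟩, ⟨LA, hLA0, hLA⟩, ⟨CA, hCA0, hCA⟩⟩ := hderiv.Db_bounds
  let P : ℝ → Icc (0 : ℝ) T := projIcc 0 T hT
  have hPc : Continuous P := continuous_projIcc
  have hm : ∀ r, ‖X₀ (P r)‖ ≤ m := fun r => hXm _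
  let ℓ : ℕ → ℝ → S.Neg q →L[ℝ] ℝ := fun j r =>
    derivB S b q (S.normalize q (e j)) (S.negIncl hpq.le (X₀ (P r)))
      + (D (S.normalize q (e j)) (X₀ (P r))).comp (S.negIncl hq.le)
  let Λ : ℝ → S.Neg q → S.Neg q₁ := fun r x =>
    A (X₀ (P r)) x + B (X₀ (P r)) (S.negIncl hq.le x)
  have hℓΛ : ∀ j r x, ℓ j r x = S.emb q₁ (Λ r x) (S.normalize q (e j)) := fun j r x => by
    rw [S.emb_add, hA _ (hm r), (hDB _ (hm r)).2.1]
    rfl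
  refine ⟨ℓ, Λ, MA + c * ‖S.negIncl hq.le‖, LA + c, CA / 2 + c, ?_, fun j r x => ?_⟩
  · refine ⟨S.orthogonal_negIncl_negBasis he hq.le, S.negIncl_negBasis_ne_zero he hq.le,
      S.tendsto_norm_negIncl_negBasis he hq.le hderiv.hilbertSchmidt, fun j => ?_, fun j r x => ?_,
      by positivity, by positivity, by positivity, fun r x => ?_, fun r x => ?_, fun s r a => ?_⟩
    · have h1 : Continuous fun t => D (S.normalize q (e j)) (X₀ t) :=
        hderiv.continuous_integral_derivG hbasic he hX hXm (S.normalize q (e j))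
          fun t k => (hDB _ (hXm t)).1 _ k
      exact ((hderiv.continuous_derivB hX _).comp hPc).add
        ((h1.comp hPc).clm_comp continuous_const)
    · rw [hℓΛ, S.inner_negIncl_negBasis]
    · calc ‖Λ r x‖ ≤ ‖A (X₀ (P r)) x‖ + ‖B (X₀ (P r)) (S.negIncl hq.le x)‖ := norm_add_le _ _
        _ ≤ MA * (1 + ‖x‖) + c * (‖S.negIncl hq.le‖ * ‖x‖) := by
          refine add_le_add (hMA _ (hm r) x) (((hDB _ (hm r)).2.2.1 _).trans ?_)
          gcongr
          exact (S.negIncl hq.le).le_opNorm x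
        _ ≤ _ := by
          have : 0 ≤ c * ‖S.negIncl hq.le‖ := by positivity
          nlinarith
    · rw [inner_add_right, add_mul]
      refine add_le_add (hLA _ (hm r) x) ((real_inner_le_norm _ _).trans ?_)
      rw [pow_two, ← mul_assoc, mul_comm (c * _)]
      gcongr
      exact (hDB _ (hm r)).2.2.1 _
    · obtain ⟨h1, h2⟩ := S.sum_smul_negBasis he q s a
      set x : S.Neg q := ∑ j ∈ s, a j • S.negBasis he q j with hx
      set χ : Φ := ∑ j ∈ s, a j • S.normalize q (e j) with hχ
      have hnx : ‖x‖ ^ 2 = ∑ j ∈ s, a j ^ 2 := (S.negBasis he q).norm_sum_smul_sq s a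
      have hsum : ∑ j ∈ s, a j * ℓ j r x = S.emb q₁ (Λ r x) χ := by
        rw [hχ, map_sum]
        refine Finset.sum_congr rfl fun j _ => ?_
        rw [map_smul, hℓΛ, smul_eq_mul]
      have hAx : 2 * S.emb q₁ (A (X₀ (P r)) x) χ ≤ CA * ‖x‖ * ‖x‖ := by
        have := hCA _ (hm r) (∑ j ∈ s, (a j * ‖S.toPos q (e j)‖) • e j) χ 0 (by rw [← h1, h2])
        rwa [← h1, map_zero, add_zero, norm_zero, zero_add] at this
      have hBx : S.emb q₁ (B (X₀ (P r)) (S.negIncl hq.le x)) χ ≤ c * (‖x‖ * ‖x‖) := by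
        rw [(hDB _ (hm r)).2.1]
        refine (le_abs_self _).trans (((hDB _ (hm r)).2.2.2 _ _).trans ?_)
        rw [← h2, S.norm_theta]
      rw [hsum, ← hnx, S.emb_add]
      nlinarith
  · change _ + D _ _ _ = _
    rw [(hDB _ (hm r)).1]
    rfl

end DerivativeConditions

end Coefficients

/-! ### The forcing term -/

theorem sq_integral_abs_mul_abs_le {Ω : Type*} [MeasurableSpace Ω] {μ : Measure Ω} {g k : Ω → ℝ}
    (hg : MemLp g 2 μ) (hk : MemLp k 2 μ) :
    (∫ y, |g y| * |k y| ∂μ) ^ 2 ≤ (∫ y, g y ^ 2 ∂μ) * ∫ y, k y ^ 2 ∂μ := by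
  have h2 : ENNReal.ofReal 2 = 2 := by simp
  have h1 := integral_mul_le_Lp_mul_Lq_of_nonneg (μ := μ) (f := fun y => |g y|)
    (g := fun y => |k y|) Real.HolderConjugate.two_two
    (Eventually.of_forall fun y => abs_nonneg _) (Eventually.of_forall fun y => abs_nonneg _)
    (by rw [h2]; exact hg.abs) (by rw [h2]; exact hk.abs)
  have h0 : 0 ≤ ∫ y, |g y| * |k y| ∂μ := integral_nonneg fun y => by positivity
  refine (pow_le_pow_left₀ h0 h1 2).trans ?_
  simp only [Real.rpow_two, sq_abs, ← Real.sqrt_eq_rpow]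
  rw [mul_pow, Real.sq_sqrt (integral_nonneg fun y => sq_nonneg _),
    Real.sq_sqrt (integral_nonneg fun y => sq_nonneg _)]

section Forcing

variable {Φ : Type*} [AddCommGroup Φ] [Module ℝ Φ] [UniformSpace Φ] {S : CountablyHilbertian Φ}
  {e : ℕ → Φ} {X : Type*} [MeasurableSpace X] {ν : Measure X}
  {b : StrongDual ℝ Φ → StrongDual ℝ Φ} {G : StrongDual ℝ Φ → X → StrongDual ℝ Φ}
  {MG LG : X → ℝ} {p q q₁ : ℕ} {hpq : p < q} {hq : q < q₁} {m : ℝ}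
  {T : ℝ} {x₀ : S.Neg p} {X₀ : Icc (0 : ℝ) T → S.Neg p}

theorem integrable_MG_mul (hbasic : BasicConditions S ν b G MG LG hpq) (ψ : Lp ℝ 2 (nuT ν T)) :
    Integrable (fun z : X × Icc (0 : ℝ) T => |MG z.1| * |ψ z|) (nuT ν T) :=
  MemLp.integrable_mul (p := 2) (q := 2) (hbasic.MG_memLp.comp_fst (lebT T)).abs (Lp.memLp ψ).abs

theorem abs_G_path_mul_le (hbasic : BasicConditions S ν b G MG LG hpq) (hXm : ∀ t, ‖X₀ t‖ ≤ m)
    (φ : Φ) (s : Icc (0 : ℝ) T) (y : X) (r : ℝ) :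
    |G (S.emb p (X₀ s)) y φ * r| ≤ |MG y| * |r| * ((1 + m) * ‖S.toPos p φ‖) := by
  rw [abs_mul]
  calc |G (S.emb p (X₀ s)) y φ| * |r|
      ≤ |MG y| * (1 + ‖X₀ s‖) * ‖S.toPos p φ‖ * |r| := by
        gcongr
        exact hbasic.abs_G_apply_le _ y φ
    _ ≤ |MG y| * (1 + m) * ‖S.toPos p φ‖ * |r| := by
        gcongr
        exact hXm s
    _ = _ := by ring

theorem integrable_G_path_mul (hbasic : BasicConditions S ν b G MG LG hpq)
    (hX₀ : IsLimitPath S ν b G hpq x₀ X₀) (hXm : ∀ t, ‖X₀ t‖ ≤ m) (ψ : Lp ℝ 2 (nuT ν T)) (φ : Φ) :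
    Integrable (fun z : X × Icc (0 : ℝ) T => G (S.emb p (X₀ z.2)) z.1 φ * ψ z) (nuT ν T) :=
  ((integrable_MG_mul hbasic ψ).mul_const ((1 + m) * ‖S.toPos p φ‖)).mono'
    ((hX₀.G_integrable φ).1.mul (Lp.aestronglyMeasurable ψ))
    (Eventually.of_forall fun z => abs_G_path_mul_le hbasic hXm φ z.2 z.1 (ψ z))

theorem norm_sq_eq_integral (ψ : Lp ℝ 2 (nuT ν T)) : ∫ z, ψ z ^ 2 ∂(nuT ν T) = ‖ψ‖ ^ 2 := by
  rw [← real_inner_self_eq_norm_sq, L2.inner_def]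
  refine integral_congr_ae (Eventually.of_forall fun z => ?_)
  simp [pow_two]

/-- Square integrability of the forcing term as a curve in `Φ_{-q}`. -/
theorem exists_forcing_bound [SFinite ν] (hbasic : BasicConditions S ν b G MG LG hpq)
    (he : S.IsBasis e) (hT : 0 ≤ T) (hXm : ∀ t, ‖X₀ t‖ ≤ m) (ψ : Lp ℝ 2 (nuT ν T)) :
    ∃ β : ℝ → ℝ, IntervalIntegrable β volume 0 T ∧
      (∀ᵐ r ∂volume.restrict (Icc 0 T), ∀ s : Finset ℕ, ∑ j ∈ s,
        (∫ y, G (S.emb p (X₀ (projIcc 0 T hT r))) y (S.normalize q (e j))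
          * ψ (y, projIcc 0 T hT r) ∂ν) ^ 2 ≤ β r) ∧
      ∫ r in (0 : ℝ)..T, β r = (1 + m) ^ 2 * (∫ y, MG y ^ 2 ∂ν) * ‖ψ‖ ^ 2 := by
  have hψ2 : Integrable (fun z : X × Icc (0 : ℝ) T => ψ z ^ 2) (nuT ν T) :=
    (Lp.memLp ψ).integrable_sq
  have hψm : StronglyMeasurable (fun z : X × Icc (0 : ℝ) T => ψ z) := Lp.stronglyMeasurable ψ
  have hm0 : 0 ≤ 1 + m := by
    have := (norm_nonneg _).trans (hXm ⟨0, le_rfl, hT⟩)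
    linarith
  obtain ⟨hβ, hβeq⟩ := setIntegral_nuT hT hψ2 ⟨T, hT, le_rfl⟩
  refine ⟨fun r => (1 + m) ^ 2 * (∫ y, MG y ^ 2 ∂ν) * ∫ y, ψ (y, projIcc 0 T hT r) ^ 2 ∂ν,
    hβ.const_mul _, ?_, ?_⟩
  · refine ae_restrict_of_ae_lebT hT (P := fun t => ∀ s : Finset ℕ, ∑ j ∈ s,
      (∫ y, G (S.emb p (X₀ t)) y (S.normalize q (e j)) * ψ (y, t) ∂ν) ^ 2
        ≤ (1 + m) ^ 2 * (∫ y, MG y ^ 2 ∂ν) * ∫ y, ψ (y, t) ^ 2 ∂ν) ?_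
    filter_upwards [hψ2.prod_left_ae] with t ht s
    have hg : MemLp (fun y => ψ (y, t)) 2 ν :=
      (memLp_two_iff_integrable_sq
        (hψm.comp_measurable measurable_prodMk_right).aestronglyMeasurable).2 ht
    have hGg : ∀ φ, Integrable (fun y => G (S.emb p (X₀ t)) y φ * ψ (y, t)) ν := fun φ =>
      MemLp.integrable_mul (p := 2) (q := 2) (hbasic.memLp_G_apply (X₀ t) φ) hg
    set f : ℕ → ℝ := fun j => ∫ y, G (S.emb p (X₀ t)) y (S.normalize q (e j)) * ψ (y, t) ∂ν with hf
    set F : ℝ := ∑ j ∈ s, f j ^ 2 with hF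
    have hF0 : 0 ≤ F := Finset.sum_nonneg fun j _ => sq_nonneg _
    set a : ℝ := ∫ y, |MG y| * |ψ (y, t)| ∂ν with ha
    have hcs : a ^ 2 ≤ (∫ y, MG y ^ 2 ∂ν) * ∫ y, ψ (y, t) ^ 2 ∂ν :=
      sq_integral_abs_mul_abs_le hbasic.MG_memLp hg
    -- test the forcing with the element of `Φ` whose coordinates are those of the forcing itself
    set χ : Φ := ∑ j ∈ s, f j • S.normalize q (e j) with hχ
    have hχn : ‖S.toPos q χ‖ ^ 2 = F := by
      rw [hχ, ← (S.sum_smul_negBasis he q s f).2, S.norm_theta, (S.negBasis he q).norm_sum_smul_sq]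
    have hFχ : F = ∫ y, G (S.emb p (X₀ t)) y χ * ψ (y, t) ∂ν := by
      have h1 : ∀ y, G (S.emb p (X₀ t)) y χ * ψ (y, t)
          = ∑ j ∈ s, f j * (G (S.emb p (X₀ t)) y (S.normalize q (e j)) * ψ (y, t)) := fun y => by
        rw [hχ, map_sum, Finset.sum_mul]
        refine Finset.sum_congr rfl fun j _ => ?_
        rw [map_smul, smul_eq_mul, mul_assoc]
      simp only [h1]
      rw [integral_finsetSum s fun j _ => (hGg _).const_mul (f j)]
      refine Finset.sum_congr rfl fun j _ => ?_
      rw [integral_const_mul, pow_two]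
    have hle : F ≤ a * ((1 + m) * ‖S.toPos q χ‖) := by
      rw [hFχ]
      refine (le_abs_self _).trans (abs_integral_le_of_le_mul
        (MemLp.integrable_mul (p := 2) (q := 2) hbasic.MG_memLp.abs hg.abs) le_rfl
        (by positivity) fun y => ?_)
      refine (abs_G_path_mul_le hbasic hXm χ t y _).trans ?_
      change _ ≤ |MG y| * |ψ (y, t)| * _
      gcongr
      exact S.norm_toPos_mono hpq.le χ
    have ha0 : 0 ≤ a := integral_nonneg fun y => by positivity
    have hFa : F ≤ (1 + m) ^ 2 * a ^ 2 := by
      rcases hF0.eq_or_lt with h0 | h0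
      · rw [← h0]
        positivity
      · have h1 : F ^ 2 ≤ (a * ((1 + m) * ‖S.toPos q χ‖)) ^ 2 := pow_le_pow_left₀ hF0 hle 2
        rw [mul_pow, mul_pow, hχn] at h1
        refine le_of_mul_le_mul_right ?_ h0
        linarith
    calc F ≤ (1 + m) ^ 2 * a ^ 2 := hFa
      _ ≤ (1 + m) ^ 2 * ((∫ y, MG y ^ 2 ∂ν) * ∫ y, ψ (y, t) ^ 2 ∂ν) := by gcongr
      _ = _ := by ring
  · rw [intervalIntegral.integral_const_mul, ← hβeq, ← norm_sq_eq_integral ψ]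
    congr 1
    have : {z : X × Icc (0 : ℝ) T | z.2 ≤ ⟨T, hT, le_rfl⟩} = univ :=
      eq_univ_of_forall fun z => z.2.2.2
    rw [this, Measure.restrict_univ]

end Forcing

/-! ### The linearized equation in coordinates -/

theorem IsCoordSolution.congr {H K : Type*} [NormedAddCommGroup H] [InnerProductSpace ℝ H]
    [NormedAddCommGroup K] [InnerProductSpace ℝ K] {h : HilbertBasis ℕ ℝ H} {ι : H →L[ℝ] K}
    {ℓ : ℕ → ℝ → H →L[ℝ] ℝ} {f : ℕ → ℝ → ℝ} {a b : ℝ} {x : H} {ζ ζ' : ℝ → H}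
    (hζ : IsCoordSolution h ι ℓ f a b x ζ) (hab : a ≤ b) (heq : EqOn ζ' ζ (Icc a b)) :
    IsCoordSolution h ι ℓ f a b x ζ' := by
  refine ⟨hζ.cont.congr fun t ht => by simp only [heq ht], fun j => ?_, fun j t ht => ?_⟩
  · refine (hζ.integrable j).congr fun r hr => ?_
    rw [uIoc_of_le hab] at hr
    simp only [heq (Ioc_subset_Icc_self hr)]
  · rw [heq ht, hζ.eq j t ht]
    congr 1
    refine intervalIntegral.integral_congr fun r hr => ?_
    rw [uIcc_of_le ht.1] at hr
    simp only [heq (Icc_subset_Icc_right ht.2 hr)]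

section Linearized

variable {Φ : Type*} [AddCommGroup Φ] [Module ℝ Φ] [UniformSpace Φ] {S : CountablyHilbertian Φ}
  {e : ℕ → Φ} {X : Type*} [MeasurableSpace X] {ν : Measure X} [SFinite ν]
  {b : StrongDual ℝ Φ → StrongDual ℝ Φ} {G : StrongDual ℝ Φ → X → StrongDual ℝ Φ}
  {MG LG : X → ℝ} {p q q₁ : ℕ} {hpq : p < q} {hq : q < q₁} {m : ℝ}
  {T : ℝ} {x₀ : S.Neg p} {X₀ : Icc (0 : ℝ) T → S.Neg p}

/-- The coordinates of the forcing term. -/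
def forcingCoord (S : CountablyHilbertian Φ) (e : ℕ → Φ) (G : StrongDual ℝ Φ → X → StrongDual ℝ Φ)
    (q : ℕ) (hT : 0 ≤ T) (X₀ : Icc (0 : ℝ) T → S.Neg p) (ψ : Lp ℝ 2 (nuT ν T)) (j : ℕ)
    (r : ℝ) : ℝ :=
  ∫ y, G (S.emb p (X₀ (projIcc 0 T hT r))) y (S.normalize q (e j)) * ψ (y, projIcc 0 T hT r) ∂ν

/-- `ℓ` is the coordinate family of the linearized drift along `X₀`. -/
def IsDriftCoord (S : CountablyHilbertian Φ) (e : ℕ → Φ) (ν : Measure X)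
    (b : StrongDual ℝ Φ → StrongDual ℝ Φ) (G : StrongDual ℝ Φ → X → StrongDual ℝ Φ)
    (hpq : p < q) (hq : q < q₁) (hT : 0 ≤ T) (X₀ : Icc (0 : ℝ) T → S.Neg p)
    (ℓ : ℕ → ℝ → S.Neg q →L[ℝ] ℝ) : Prop :=
  ∀ j r x, ℓ j r x
    = derivB S b q (S.normalize q (e j)) (S.negIncl hpq.le (X₀ (projIcc 0 T hT r))) x
      + ∫ y, derivG S G q₁ (S.normalize q (e j))
        (S.negIncl (hpq.trans hq).le (X₀ (projIcc 0 T hT r))) y (S.negIncl hq.le x) ∂ν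

/-- Fubini: the three terms of the linearized equation, tested against a basis vector, as one
integral over time. -/
theorem linearized_rhs_eq {hT : 0 ≤ T} {ℓ : ℕ → ℝ → S.Neg q →L[ℝ] ℝ}
    (hℓ : IsDriftCoord S e ν b G hpq hq hT X₀ ℓ) {ψ : Lp ℝ 2 (nuT ν T)}
    {ζ : Icc (0 : ℝ) T → S.Neg q} {η : Icc (0 : ℝ) T → S.Neg q₁}
    (hη : ∀ s, S.negIncl hq.le (ζ s) = η s) {j : ℕ} {φ : Φ} (hφ : φ = S.normalize q (e j))
    (h1 : Integrable (fun s => derivB S b q φ (S.negIncl hpq.le (X₀ s)) (ζ s)) (lebT T))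
    (h2 : Integrable (fun z : X × Icc (0 : ℝ) T =>
      derivG S G q₁ φ (S.negIncl (hpq.trans hq).le (X₀ z.2)) z.1 (η z.2)) (nuT ν T))
    (h3 : Integrable (fun z : X × Icc (0 : ℝ) T => G (S.emb p (X₀ z.2)) z.1 φ * ψ z) (nuT ν T)) :
    IntervalIntegrable (fun r => ℓ j r (ζ (projIcc 0 T hT r))) volume 0 T ∧
    ∀ t : Icc (0 : ℝ) T,
      (∫ s in {s : Icc (0 : ℝ) T | s ≤ t},
          derivB S b q φ (S.negIncl hpq.le (X₀ s)) (ζ s) ∂(lebT T))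
      + (∫ z in {z : X × Icc (0 : ℝ) T | z.2 ≤ t},
          derivG S G q₁ φ (S.negIncl (hpq.trans hq).le (X₀ z.2)) z.1 (η z.2) ∂(nuT ν T))
      + ∫ z in {z : X × Icc (0 : ℝ) T | z.2 ≤ t}, G (S.emb p (X₀ z.2)) z.1 φ * ψ z ∂(nuT ν T)
      = ∫ r in (0 : ℝ)..t,
          (ℓ j r (ζ (projIcc 0 T hT r)) + forcingCoord S e G q hT X₀ ψ j r) := by
  subst hφ
  have i1 := (integrable_lebT_iff hT).1 h1
  have i2 := fun t => setIntegral_nuT hT h2 t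
  have i3 := fun t => setIntegral_nuT hT h3 t
  have hT' : (0 : ℝ) ∈ Icc 0 T := ⟨le_rfl, hT⟩
  have i2' := (i2 ⟨0, hT'⟩).1
  have i3' : IntervalIntegrable (fun r => forcingCoord S e G q hT X₀ ψ j r) volume 0 T :=
    (i3 ⟨0, hT'⟩).1
  have hℓζ : (fun r => ℓ j r (ζ (projIcc 0 T hT r))) = fun r =>
      derivB S b q (S.normalize q (e j)) (S.negIncl hpq.le (X₀ (projIcc 0 T hT r)))
        (ζ (projIcc 0 T hT r))
      + ∫ y, derivG S G q₁ (S.normalize q (e j))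
        (S.negIncl (hpq.trans hq).le (X₀ (projIcc 0 T hT r))) y (η (projIcc 0 T hT r)) ∂ν := by
    funext r
    rw [hℓ, hη]
  have hsum : IntervalIntegrable (fun r => ℓ j r (ζ (projIcc 0 T hT r))) volume 0 T := by
    rw [hℓζ]
    exact i1.add i2'
  refine ⟨hsum, fun t => ?_⟩
  have hsub : uIcc 0 (t : ℝ) ⊆ uIcc 0 T := by
    rw [uIcc_of_le hT, uIcc_of_le t.2.1]
    exact Icc_subset_Icc_right t.2.2
  rw [setIntegral_lebT hT, (i2 t).2, (i3 t).2]
  rw [intervalIntegral.integral_add (hsum.mono_set hsub) (i3'.mono_set hsub),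
    ← intervalIntegral.integral_add (i1.mono_set hsub) (i2'.mono_set hsub)]
  congr 1
  exact intervalIntegral.integral_congr fun r _ => (congrFun hℓζ r).symm

theorem SolvesLinearized.exists_isCoordSolution {hT : 0 ≤ T} (he : S.IsBasis e)
    {ℓ : ℕ → ℝ → S.Neg q →L[ℝ] ℝ} (hℓ : IsDriftCoord S e ν b G hpq hq hT X₀ ℓ)
    {ψ : Lp ℝ 2 (nuT ν T)} {η : C(Icc (0 : ℝ) T, S.Neg q₁)}
    (hη : SolvesLinearized S ν b G hpq hq X₀ ψ η) :
    ∃ ζ : Icc (0 : ℝ) T → S.Neg q, (∀ s, S.negIncl hq.le (ζ s) = η s) ∧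
      IsCoordSolution (S.negBasis he q) (S.negIncl hq.le) ℓ (forcingCoord S e G q hT X₀ ψ) 0 T 0
        fun r => ζ (projIcc 0 T hT r) := by
  obtain ⟨ζ, hζ, h⟩ := hη
  have hrhs := fun j => linearized_rhs_eq hℓ (ψ := ψ) hζ (rfl : S.normalize q (e j) = _)
    (h _).1 (h _).2.1 (h _).2.2.1
  refine ⟨ζ, hζ, ⟨?_, fun j => (hrhs j).1, fun j t ht => ?_⟩⟩
  · simp only [hζ]
    exact (η.continuous.comp continuous_projIcc).continuousOn
  · have h1 := (h (S.normalize q (e j))).2.2.2 ⟨t, ht⟩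
    rw [(hrhs j).2 ⟨t, ht⟩, ← hζ, S.emb_negIncl] at h1
    rw [S.inner_negBasis, projIcc_of_mem hT ht, h1, inner_zero_right, zero_add]

/-- A solution in coordinates that is bounded in `Φ_{-q}` solves the linearized equation tested
against all of `Φ`: the right-hand side is a functional in `Φ_{-q₁}`, and hence determined by its
values on the basis. -/
theorem IsCoordSolution.solvesLinearized {hT : 0 ≤ T}
    (hderiv : DerivativeConditions S ν b G e MG LG hpq hq m)
    (hbasic : BasicConditions S ν b G MG LG hpq) (he : S.IsBasis e)
    (hX₀ : IsLimitPath S ν b G hpq x₀ X₀) (hXm : ∀ t, ‖X₀ t‖ ≤ m)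
    {ℓ : ℕ → ℝ → S.Neg q →L[ℝ] ℝ} (hℓ : IsDriftCoord S e ν b G hpq hq hT X₀ ℓ)
    {ψ : Lp ℝ 2 (nuT ν T)} {ζ : Icc (0 : ℝ) T → S.Neg q} {R : ℝ} (hR : ∀ s, ‖ζ s‖ ≤ R)
    (hζ : IsCoordSolution (S.negBasis he q) (S.negIncl hq.le) ℓ (forcingCoord S e G q hT X₀ ψ) 0 T 0
        fun r => ζ (projIcc 0 T hT r))
    {η : C(Icc (0 : ℝ) T, S.Neg q₁)} (hη : ∀ s, S.negIncl hq.le (ζ s) = η s) :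
    SolvesLinearized S ν b G hpq hq X₀ ψ η := by
  obtain ⟨N, c, hc, hN, hN1, -⟩ := hderiv.exists_derivG_bound
  obtain ⟨A, hA, -, ⟨MA, hMA0, hMA⟩, -, -⟩ := hderiv.Db_bounds
  have hR0 : 0 ≤ R := (norm_nonneg _).trans (hR ⟨0, le_rfl, hT⟩)
  have hm0 : 0 ≤ 1 + m := by
    have := (norm_nonneg _).trans (hXm ⟨0, le_rfl, hT⟩)
    linarith
  have hweak : ∀ j, Continuous fun s => inner ℝ (S.negBasis he q j) (ζ s) := fun j => by
    simp only [S.inner_negBasis]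
    have h1 : ∀ s, S.emb q (ζ s) (S.normalize q (e j)) = S.emb q₁ (η s) (S.normalize q (e j)) :=
      fun s => by rw [← hη, S.emb_negIncl]
    simp only [h1]
    exact (S.continuous_emb_apply q₁ _).comp η.continuous
  have hbB : ∀ φ s, |derivB S b q φ (S.negIncl hpq.le (X₀ s)) (ζ s)|
      ≤ MA * (1 + R) * ‖S.toPos q₁ φ‖ := fun φ s => by
    rw [← hA _ (hXm s)]
    refine (S.abs_emb_le q₁ _ φ).trans ?_
    gcongr
    refine (hMA _ (hXm s) _).trans ?_
    gcongr
    exact hR s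
  have hηR : ∀ s, ‖η s‖ ≤ ‖η‖ := fun s => η.norm_coe_le_norm s
  have hbG : ∀ φ s y, |derivG S G q₁ φ (S.negIncl (hpq.trans hq).le (X₀ s)) y (η s)|
      ≤ N (X₀ s) y * (‖S.toPos q₁ φ‖ * ‖η s‖) := fun φ s y => hN1 _ φ y _
  have hcG : ∀ φ s, c * (‖S.toPos q₁ φ‖ * ‖η s‖) ≤ c * ‖η‖ * ‖S.toPos q₁ φ‖ := fun φ s => by
    rw [mul_comm ‖S.toPos q₁ φ‖, ← mul_assoc]
    gcongr
    exact hηR s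
  have h1 : ∀ φ, Integrable (fun s => derivB S b q φ (S.negIncl hpq.le (X₀ s)) (ζ s)) (lebT T) :=
    fun φ => (integrable_const (MA * (1 + R) * ‖S.toPos q₁ φ‖)).mono'
      ((S.negBasis he q).measurable_clm_apply (hderiv.continuous_derivB hX₀.cont φ)
        hweak).aestronglyMeasurable (Eventually.of_forall fun s => hbB φ s)
  have h2 : ∀ φ, Integrable (fun z : X × Icc (0 : ℝ) T =>
      derivG S G q₁ φ (S.negIncl (hpq.trans hq).le (X₀ z.2)) z.1 (η z.2)) (nuT ν T) := by
    intro φ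
    have hm : AEStronglyMeasurable (fun z : X × Icc (0 : ℝ) T =>
        derivG S G q₁ φ (S.negIncl (hpq.trans hq).le (X₀ z.2)) z.1 (η z.2)) (ν.prod (lebT T)) :=
      aestronglyMeasurable_prod_of_continuous
        (g := fun y s => derivG S G q₁ φ (S.negIncl (hpq.trans hq).le (X₀ s)) y (η s))
        (fun y => (hderiv.continuous_derivG hX₀.cont φ y).clm_apply η.continuous)
        fun s => hderiv.aestronglyMeasurable_derivG hbasic he (X₀ s) φ (η s)
    refine (integrable_prod_iff' hm).2 ⟨Eventually.of_forall fun s =>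
      hderiv.integrable_derivG hbasic he (hXm s) φ (η s), ?_⟩
    refine (integrable_const (c * ‖η‖ * ‖S.toPos q₁ φ‖)).mono'
      hm.norm.prod_swap.integral_prod_right' (Eventually.of_forall fun s => ?_)
    refine (abs_integral_le_of_le_mul (hN _ (hXm s)).1 (hN _ (hXm s)).2 (by positivity)
      fun y => ?_).trans (hcG φ s)
    rw [abs_of_nonneg (norm_nonneg _)]
    exact hbG φ s y
  have h3 := fun φ => integrable_G_path_mul hbasic hX₀ hXm ψ φ
  refine ⟨ζ, hη, fun φ => ⟨h1 φ, h2 φ, h3 φ, fun t => ?_⟩⟩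
  obtain ⟨u₁, -, hu₁⟩ := S.exists_emb_eq_integral q₁
    (μ := (lebT T).restrict {s : Icc (0 : ℝ) T | s ≤ t})
    (F := fun φ s => derivB S b q φ (S.negIncl hpq.le (X₀ s)) (ζ s))
    (fun φ χ s => by simp only [← hA _ (hXm s), map_add])
    (fun r φ s => by simp only [← hA _ (hXm s), map_smul, smul_eq_mul])
    (fun φ => (h1 φ).restrict)
    (c := ∫ s in {s : Icc (0 : ℝ) T | s ≤ t}, MA * (1 + R) ∂(lebT T))
    (integral_nonneg fun _ => by positivity)
    fun φ => abs_integral_le_of_le_mul (integrable_const _) le_rfl (norm_nonneg _)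
      fun s => hbB φ s
  obtain ⟨u₂, -, hu₂⟩ := S.exists_emb_eq_integral q₁
    (μ := (nuT ν T).restrict {z : X × Icc (0 : ℝ) T | z.2 ≤ t})
    (F := fun φ z => derivG S G q₁ φ (S.negIncl (hpq.trans hq).le (X₀ z.2)) z.1 (η z.2))
    (fun φ χ z => by rw [hderiv.derivG_add]; rfl)
    (fun r φ z => by rw [hderiv.derivG_smul]; rfl)
    (fun φ => (h2 φ).restrict) (c := c * ‖η‖ * T) (by positivity)
    fun φ => by
      rw [(setIntegral_nuT hT (h2 φ) t).2]
      have hle := intervalIntegral.norm_integral_le_of_norm_le_const (a := 0) (b := (t : ℝ))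
        (C := c * ‖η‖ * ‖S.toPos q₁ φ‖)
        (f := fun r => ∫ y, derivG S G q₁ φ (S.negIncl (hpq.trans hq).le (X₀ (projIcc 0 T hT r))) y
          (η (projIcc 0 T hT r)) ∂ν) fun r _ =>
          (abs_integral_le_of_le_mul (hN _ (hXm _)).1 (hN _ (hXm _)).2 (by positivity)
            fun y => hbG φ _ y).trans (hcG φ _)
      refine hle.trans ?_
      rw [sub_zero, abs_of_nonneg t.2.1, mul_right_comm]
      gcongr
      exact t.2.2
  obtain ⟨u₃, -, hu₃⟩ := S.exists_emb_eq_integral q₁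
    (μ := (nuT ν T).restrict {z : X × Icc (0 : ℝ) T | z.2 ≤ t})
    (F := fun φ z => G (S.emb p (X₀ z.2)) z.1 φ * ψ z)
    (fun φ χ z => by rw [map_add, add_mul])
    (fun r φ z => by rw [map_smul, smul_eq_mul, mul_assoc])
    (fun φ => (h3 φ).restrict)
    (c := (∫ z in {z : X × Icc (0 : ℝ) T | z.2 ≤ t}, |MG z.1| * |ψ z| ∂(nuT ν T)) * (1 + m))
    (mul_nonneg (integral_nonneg fun _ => by positivity) hm0)
    fun φ => by
      rw [mul_assoc]
      refine abs_integral_le_of_le_mul (integrable_MG_mul hbasic ψ).restrict le_rfl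
        (by positivity) fun z => (abs_G_path_mul_le hbasic hXm φ z.2 z.1 (ψ z)).trans ?_
      gcongr
      exact S.norm_toPos_mono (hpq.trans hq).le φ
  have hW : ∀ φ, S.emb q₁ (u₁ + u₂ + u₃) φ = S.emb q₁ u₁ φ + S.emb q₁ u₂ φ + S.emb q₁ u₃ φ :=
    fun φ => rfl
  have heq : η t = u₁ + u₂ + u₃ := by
    refine S.neg_ext he fun j => ?_
    have hn := S.norm_toPos_ne_zero he q j
    have hej : e j = ‖S.toPos q (e j)‖ • S.normalize q (e j) := by
      rw [CountablyHilbertian.normalize, smul_smul, mul_inv_cancel₀ hn, one_smul]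
    have htest : S.emb q₁ (η t) (S.normalize q (e j))
        = S.emb q₁ (u₁ + u₂ + u₃) (S.normalize q (e j)) := by
      rw [hW, hu₁, hu₂, hu₃, (linearized_rhs_eq hℓ (ψ := ψ) hη (rfl : S.normalize q (e j) = _)
        (h1 _) (h2 _) (h3 _)).2 t, ← hη, S.emb_negIncl, ← S.inner_negBasis he]
      have h4 := hζ.eq j t t.2
      rwa [projIcc_val, inner_zero_right, zero_add] at h4
    rw [hej, map_smul, map_smul, htest]
  rw [heq, hW, hu₁, hu₂, hu₃]

end Linearized

/-! ### Well-posedness of the linearized equation -/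

theorem theorem8
    {Φ : Type*} [AddCommGroup Φ] [Module ℝ Φ] [UniformSpace Φ]
    (S : CountablyHilbertian Φ) (hS : S.IsNuclear) (e : ℕ → Φ) (he : S.IsBasis e)
    {X : Type*} [TopologicalSpace X] [PolishSpace X] [LocallyCompactSpace X]
    [MeasurableSpace X] [BorelSpace X] (ν : Measure X) [IsFiniteMeasureOnCompacts ν]
    (T : ℝ) (hT : 0 < T)
    (b : StrongDual ℝ Φ → StrongDual ℝ Φ) (G : StrongDual ℝ Φ → X → StrongDual ℝ Φ)
    (MG LG : X → ℝ) (p q q₁ : ℕ) (hpq : p < q) (hq : q < q₁)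
    (hbasic : BasicConditions S ν b G MG LG hpq)
    (x₀ : S.Neg p) (X₀ : Set.Icc (0 : ℝ) T → S.Neg p)
    (hX₀ : IsLimitPath S ν b G hpq x₀ X₀)
    (hderiv : DerivativeConditions S ν b G e MG LG hpq hq (⨆ t, ‖X₀ t‖)) :
    (∀ ψ : Lp ℝ 2 (nuT ν T), ∃! η : C(Set.Icc (0 : ℝ) T, S.Neg q₁),
      SolvesLinearized S ν b G hpq hq X₀ ψ η) ∧
    ∀ M : ℝ, 0 < M → ∃ C : ℝ, ∀ ψ : Lp ℝ 2 (nuT ν T), ‖ψ‖ ≤ M →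
      ∀ η : C(Set.Icc (0 : ℝ) T, S.Neg q₁), SolvesLinearized S ν b G hpq hq X₀ ψ η →
        ∀ t : Set.Icc (0 : ℝ) T, ∃ w : S.Neg q, S.negIncl hq.le w = η t ∧ ‖w‖ ≤ C := by
  have hT0 : 0 ≤ T := hT.le
  have hXm : ∀ t, ‖X₀ t‖ ≤ ⨆ t, ‖X₀ t‖ := fun t => le_ciSup hX₀.bdd t
  set m : ℝ := ⨆ t, ‖X₀ t‖
  obtain ⟨ℓ, Λ, M₀, L, C, hD, hℓ⟩ :=
    hderiv.exists_isDissipativeSystem hbasic he hT0 hX₀.cont hXm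
  have hℓ' : IsDriftCoord S e ν b G hpq hq hT0 X₀ ℓ := hℓ
  have hf : ∀ (ψ : Lp ℝ 2 (nuT ν T)) (j : ℕ),
      IntervalIntegrable (forcingCoord S e G q hT0 X₀ ψ j) volume 0 T := fun ψ j =>
    (setIntegral_nuT hT0 (integrable_G_path_mul hbasic hX₀ hXm ψ (S.normalize q (e j)))
      ⟨0, le_rfl, hT0⟩).1
  set Q : ℝ := (1 + m) ^ 2 * ∫ y, MG y ^ 2 ∂ν with hQ
  have hQ0 : 0 ≤ Q := mul_nonneg (sq_nonneg _) (integral_nonneg fun _ => sq_nonneg _)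
  set E : ℝ := Real.exp ((2 * C + 1) * (T - 0)) with hE
  have hex : ∀ ψ : Lp ℝ 2 (nuT ν T), ∃ ζ : Icc (0 : ℝ) T → S.Neg q,
      IsCoordSolution (S.negBasis he q) (S.negIncl hq.le) ℓ (forcingCoord S e G q hT0 X₀ ψ) 0 T 0
        (fun r => ζ (projIcc 0 T hT0 r)) ∧ ∀ s, ‖ζ s‖ ^ 2 ≤ Q * ‖ψ‖ ^ 2 * E := by
    intro ψ
    obtain ⟨β, hβ, hfβ, hβint⟩ := exists_forcing_bound hbasic he hT0 hXm ψ
    obtain ⟨ζ, hζ, hζb⟩ := hD.exists_isCoordSolution hT0 (hf ψ) hβ hfβ 0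
    refine ⟨fun s => ζ s, hζ.congr hT0 fun r hr => ?_, fun s => ?_⟩
    · simp only [projIcc_of_mem hT0 hr]
    · have := hζb s s.2
      rwa [hβint, norm_zero, zero_pow two_ne_zero, zero_add] at this
  have huniq : ∀ (ψ : Lp ℝ 2 (nuT ν T)) (ζ ζ' : Icc (0 : ℝ) T → S.Neg q),
      IsCoordSolution (S.negBasis he q) (S.negIncl hq.le) ℓ (forcingCoord S e G q hT0 X₀ ψ) 0 T 0
        (fun r => ζ (projIcc 0 T hT0 r)) →
      IsCoordSolution (S.negBasis he q) (S.negIncl hq.le) ℓ (forcingCoord S e G q hT0 X₀ ψ) 0 T 0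
        (fun r => ζ' (projIcc 0 T hT0 r)) → ζ = ζ' := by
    intro ψ ζ ζ' hζ hζ'
    funext s
    simpa using hζ.eqOn hζ' hD (hf ψ) s.2
  refine ⟨fun ψ => ?_, fun M hM => ⟨Real.sqrt (Q * M ^ 2 * E), fun ψ hψ η hη t => ?_⟩⟩
  · obtain ⟨ζ, hζ, hζb⟩ := hex ψ
    have hc : Continuous fun s : Icc (0 : ℝ) T => S.negIncl hq.le (ζ s) := by
      have := hζ.cont.comp_continuous continuous_subtype_val fun s : Icc (0 : ℝ) T => s.2
      simpa [Function.comp_def] using this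
    refine ⟨⟨_, hc⟩, hζ.solvesLinearized hderiv hbasic he hX₀ hXm hℓ'
      (fun s => Real.le_sqrt_of_sq_le (hζb s)) fun s => rfl, fun η' hη' => ?_⟩
    obtain ⟨ζ', hζη', hζ'⟩ := hη'.exists_isCoordSolution he hℓ'
    ext1 s
    rw [← hζη', huniq ψ ζ' ζ hζ' hζ]
    rfl
  · obtain ⟨ζ, hζ, hζb⟩ := hex ψ
    obtain ⟨ζ', hζη', hζ'⟩ := hη.exists_isCoordSolution he hℓ'
    refine ⟨ζ t, by rw [← hζη', huniq ψ ζ' ζ hζ' hζ], Real.le_sqrt_of_sq_le ((hζb t).trans ?_)⟩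
    gcongr

end
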